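/- \textbf{Model.} Fix $p_\circ,p_\bullet\in[0,1]$, $v_\circ=2p_\circ-1$, $v_\bullet=2p_\bullet-1$, $q\in(0,1)$ and $\rho\in(0,\infty)$. Let $N(z)$, $z\in\mathbb Z$, be i.i.d.\ Poisson($\rho$). Let $S^{z,i}=(S^{z,i}_n)_{n\in\mathbb Z}$, $z\in\mathbb Z$, $i\ge 1$, be independent two-sided lazy simple random walks on $\mathbb Z$ with $S^{z,i}_0=z$, whose steps are $-1,0,1$ with probabilities $\frac{1-q}2,q,\frac{1-q}2$. Let $U_y$, $y\in\mathbb Z^2$, be i.i.d.\ uniform on $[0,1]$. The three families are independent, and $\mathbb P$ is their joint law. For a set $A$ of trajectories let $\omega(A)=\#\{(z,i):1\le i\le N(z),\ S^{z,i}\in A\}$, and let $\mathcal T=\{(S^{z,i}_n,n): z\in\mathbb Z,\ 1\le i\le N(z),\ n\in\mathbb Z\}$. For $y\in\mathbb Z^2$ let $Y^y_0=y$ and $Y^y_{n+1}=Y^y_n+(1,1)$ if either $Y^y_n\in\mathcal T$ and $U_{Y^y_n}\le p_\bullet$, or $Y^y_n\notin\mathcal T$ and $U_{Y^y_n}\le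 p_\circ$; otherwise $Y^y_{n+1}=Y^y_n+(-1,1)$. Write $Y=Y^{(0,0)}$ and let $X_n$ be the first coordinate of $Y_n$. \textbf{Regeneration time.} For $v_\star\in(0,v_\bullet)$ let $\bar v=v_\star/3$ and \[\angle(y)=y+\{(x,n)\in\mathbb Z^2: x\ge 0,\ n\ge 0,\ x\ge\bar v n\},\qquad \angle^-(y)=y+\{(x,n)\in\mathbb Z^2: x\le 0,\ n\le 0,\ x<\bar v n\}.\] Let $W^{\times}_y$ be the set of nearest-neighbour (lazy steps allowed) trajectories $w:\mathbb Z\to\mathbb Z$ whose trace $\{(w(n),n):n\in\mathbb Z\}$ intersects both $\angle(y)$ and $\angle^-(y)$. Let $A^y=\{Y^y_i\in\angle(y)\ \forall i\ge 0\}$ and $\Gamma(y)=\{\omega(W^\times_y)=0\}\cap A^y$. For $k\ge 1$ let $R_k=\inf\{n\ge 0: X_n\ge(1-\bar v)k+\bar v n\}$. Let $\mathcal I=\inf\{k\ge 1: R_k<\infty \text{ and } \Gamma(Y_{R_k})\text{ occurs}\}$ and $\tau=R_{\mathcal I}$, with $\tau=\infty$ if $\mathcal I=\infty$. Let $\mathbb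 P^\angle=\mathbb P(\,\cdot\mid\Gamma(0,0))$. \textbf{Theorem.} Let $v_\circ>-1$, $v_\star\in(0,v_\bullet)$, and assume that the $v_\star$-ballisticity condition holds with constants $c_0>0$ and $\gamma>1$, i.e. \[\mathbb P\big(\exists\,n\ge 1: X_n<nv_\star-L\big)\le c_0^{-1}e^{-c_0\log^\gamma L}\qquad\text{for all integers }L\ge 1.\] Then $\mathbb P(\Gamma(0,0))>0$, so that $\mathbb P^\angle$ is well defined, and there exists a constant $c>0$ such that \[\mathbb E\big[e^{c\log^\gamma\tau}\big]<\infty\quad\text{and}\quad\mathbb E^\angle\big[e^{c\log^\gamma\tau}\big]<\infty,\] where $\gamma$ is the exponent of the ballisticity condition and $e^{c\log^\gamma\infty}=\infty$. (In particular $\tau<\infty$ almost surely under both laws.) -/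

import Mathlib

open scoped NNReal ENNReal

namespace RWDRE

/-! ### The probability space

A sample consists of
* the initial numbers `N z` of environment particles at the sites `z : ℤ`,
* the increments `ξ (z, i, k)` (the step between times `k` and `k + 1`) of the two-sided
  trajectory of the `i`-th potential particle that is at `z` at time `0`,
* the variables `U y`, `y : ℤ × ℤ`, that are used to move the walk.
A space-time point is a pair `(x, n)` with `x` the space and `n` the time coordinate. -/

/-- The canonical sample space. -/
abbrev Sample : Type :=
  (ℤ → ℕ) × (ℤ × ℕ × ℤ → ℤ) × (ℤ × ℤ → unitInterval)

/-- The law of one step of a lazy simple random walk: `-1`, `0`, `1` with probabilities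
`(1 - q) / 2`, `q`, `(1 - q) / 2`. -/
noncomputable def lazyStep (q : ℝ) : MeasureTheory.Measure ℤ :=
  ENNReal.ofReal ((1 - q) / 2) • MeasureTheory.Measure.dirac (-1) +
    ENNReal.ofReal q • MeasureTheory.Measure.dirac 0 +
    ENNReal.ofReal ((1 - q) / 2) • MeasureTheory.Measure.dirac 1

theorem isProbabilityMeasure_lazyStep {q : ℝ} (h0 : 0 ≤ q) (h1 : q ≤ 1) :
    MeasureTheory.IsProbabilityMeasure (lazyStep q) := by
  constructor
  have h2 : 0 ≤ (1 - q) / 2 := by linarith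
  simp only [lazyStep, MeasureTheory.Measure.coe_add, MeasureTheory.Measure.coe_smul,
    Pi.add_apply, Pi.smul_apply, MeasureTheory.measure_univ, smul_eq_mul, mul_one]
  rw [← ENNReal.ofReal_add h2 h0, ← ENNReal.ofReal_add (by linarith) h2, ← ENNReal.ofReal_one]
  congr 1
  ring

/-- The joint law `ℙ^ρ` of the independent families: i.i.d. Poisson(`ρ`) initial numbers, i.i.d.
lazy steps, and i.i.d. uniform variables on `[0,1]`. -/
noncomputable def law (q : ℝ) (ρ : ℝ≥0) : MeasureTheory.Measure Sample :=
  (MeasureTheory.Measure.infinitePi fun _ : ℤ => ProbabilityTheory.poissonMeasure ρ).prod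
    ((MeasureTheory.Measure.infinitePi fun _ : ℤ × ℕ × ℤ => lazyStep q).prod
      (MeasureTheory.Measure.infinitePi fun _ : ℤ × ℤ =>
        (MeasureTheory.volume : MeasureTheory.Measure unitInterval)))

theorem isProbabilityMeasure_law {q : ℝ} (h0 : 0 ≤ q) (h1 : q ≤ 1) (ρ : ℝ≥0) :
    MeasureTheory.IsProbabilityMeasure (law q ρ) := by
  have := isProbabilityMeasure_lazyStep h0 h1
  unfold law
  infer_instance

/-! ### The environment -/

/-- The two-sided trajectory `S^{z,i}`: it is at `z` at time `0`, and
`S^{z,i}_{n+1} - S^{z,i}_n = ξ (z, i, n)` for every `n : ℤ`. -/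
noncomputable def path (s : Sample) (z : ℤ) (i : ℕ) (n : ℤ) : ℤ :=
  z + ∑ k ∈ Finset.Ico 0 n, s.2.1 (z, i, k) - ∑ k ∈ Finset.Ico n 0, s.2.1 (z, i, k)

/-- `ω(A)`: the number of environment particles whose trajectory lies in `A`. The particles that
start at `z` are those with index `i < N z`. -/
noncomputable def omega (s : Sample) (A : Set (ℤ → ℤ)) : ℕ∞ :=
  Set.encard {p : ℤ × ℕ | p.2 < s.1 p.1 ∧ path s p.1 p.2 ∈ A}

/-- The set `𝒯` of space-time points covered by the trajectory of some environment particle. -/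
def trace (s : Sample) : Set (ℤ × ℤ) :=
  {y | ∃ z : ℤ, ∃ i : ℕ, i < s.1 z ∧ path s z i y.2 = y.1}

/-! ### The random walk -/

open Classical in
/-- The space-time process `Y^y` started at `y`. -/
noncomputable def Y (p₀ p₁ : ℝ) (s : Sample) (y : ℤ × ℤ) : ℕ → ℤ × ℤ
  | 0 => y
  | n + 1 =>
    if (Y p₀ p₁ s y n ∈ trace s ∧ (s.2.2 (Y p₀ p₁ s y n) : ℝ) ≤ p₁) ∨
        (Y p₀ p₁ s y n ∉ trace s ∧ (s.2.2 (Y p₀ p₁ s y n) : ℝ) ≤ p₀)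
    then Y p₀ p₁ s y n + (1, 1)
    else Y p₀ p₁ s y n + (-1, 1)

/-- The random walk `X` started at the origin at time `0`. -/
noncomputable def X (p₀ p₁ : ℝ) (s : Sample) (n : ℕ) : ℤ := (Y p₀ p₁ s (0, 0) n).1

/-- The bound `ℙ^ρ(∃ n ∈ ℕ, X_n < n v⋆ - L) ≤ c⁻¹ exp(-c (log L)^γ)` for all `L ∈ ℕ`, where
`ℕ = {1, 2, …}`: the `v⋆`-ballisticity condition with constants `c` and `γ`. -/
def BallisticityBound (p₀ p₁ q : ℝ) (ρ : ℝ≥0) (vstar c γ : ℝ) : Prop :=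
  ∀ L : ℕ, 1 ≤ L →
    law q ρ {s | ∃ n : ℕ, 1 ≤ n ∧ (X p₀ p₁ s n : ℝ) < n * vstar - L} ≤
      ENNReal.ofReal (c⁻¹ * Real.exp (-c * Real.log L ^ γ))

/-! ### Cones and trajectories; `v` is the slope of the cones -/

/-- The cone `∠(y)` in the first quadrant based at `y`. -/
def cone (v : ℝ) (y : ℤ × ℤ) : Set (ℤ × ℤ) :=
  {z | 0 ≤ z.1 - y.1 ∧ 0 ≤ z.2 - y.2 ∧ v * ((z.2 - y.2 : ℤ) : ℝ) ≤ ((z.1 - y.1 : ℤ) : ℝ)}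

/-- The cone in the third quadrant based at `y`. -/
def backCone (v : ℝ) (y : ℤ × ℤ) : Set (ℤ × ℤ) :=
  {z | z.1 - y.1 ≤ 0 ∧ z.2 - y.2 ≤ 0 ∧ ((z.1 - y.1 : ℤ) : ℝ) < v * ((z.2 - y.2 : ℤ) : ℝ)}

/-- The set `W` of two-sided nearest-neighbour trajectories on `ℤ`. -/
def trajectories : Set (ℤ → ℤ) := {w | ∀ n : ℤ, |w (n + 1) - w n| ≤ 1}

/-- The trajectories in `W` that intersect both the cone and the backward cone based at `y`. -/
def crossing (v : ℝ) (y : ℤ × ℤ) : Set (ℤ → ℤ) :=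
  {w | w ∈ trajectories ∧ (∃ n : ℤ, (w n, n) ∈ cone v y) ∧ ∃ n : ℤ, (w n, n) ∈ backCone v y}

/-- The event `A^y`: the walk started at `y` stays in the cone `∠(y)` forever. -/
def StaysInCone (p₀ p₁ v : ℝ) (s : Sample) (y : ℤ × ℤ) : Prop :=
  ∀ i : ℕ, Y p₀ p₁ s y i ∈ cone v y

/-- The event that no environment particle crosses at `y` and that `A^y` occurs. -/
def Regenerates (p₀ p₁ v : ℝ) (s : Sample) (y : ℤ × ℤ) : Prop :=
  omega s (crossing v y) = 0 ∧ StaysInCone p₀ p₁ v s y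

/-! ### Record times and the regeneration time -/

/-- The record time `R_k`, which is `⊤` if the walk never enters the corresponding cone. -/
noncomputable def recordTime (p₀ p₁ v : ℝ) (s : Sample) (k : ℕ) : ℕ∞ :=
  sInf {t : ℕ∞ | ∃ n : ℕ, t = n ∧ (1 - v) * k + v * n ≤ (X p₀ p₁ s n : ℝ)}

/-- The regeneration record index `ℐ`: the smallest `k ≥ 1` such that `R_k` is finite and a
regeneration takes place at `Y_{R_k}`; it is `⊤` if there is no such `k`. -/
noncomputable def regenerationIndex (p₀ p₁ v : ℝ) (s : Sample) : ℕ∞ :=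
  sInf {j : ℕ∞ | ∃ k n : ℕ, j = k ∧ 1 ≤ k ∧ recordTime p₀ p₁ v s k = n ∧
    Regenerates p₀ p₁ v s (Y p₀ p₁ s (0, 0) n)}

/-- The regeneration time `τ = R_ℐ`, which is `⊤` if `ℐ = ⊤`. -/
noncomputable def regenerationTime (p₀ p₁ v : ℝ) (s : Sample) : ℕ∞ :=
  match regenerationIndex p₀ p₁ v s with
  | ⊤ => ⊤
  | (k : ℕ) => recordTime p₀ p₁ v s k

/-- The event on which the law `ℙ^∠` is conditioned. -/
def originRegenerates (p₀ p₁ v : ℝ) : Set Sample := {s | Regenerates p₀ p₁ v s (0, 0)}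

/-- The conditional law `ℙ^∠`. -/
noncomputable def coneLaw (p₀ p₁ q : ℝ) (ρ : ℝ≥0) (v : ℝ) : MeasureTheory.Measure Sample :=
  ProbabilityTheory.cond (law q ρ) (originRegenerates p₀ p₁ v)

/-- `exp(c (log t)^γ)` for a time `t ∈ {0, 1, 2, …} ∪ {⊤}`, with value `∞` at `⊤`. -/
noncomputable def expLogPow (c γ : ℝ) : ℕ∞ → ℝ≥0∞
  | ⊤ => ⊤
  | (n : ℕ) => ENNReal.ofReal (Real.exp (c * Real.log n ^ γ))

end RWDRE

/-! The environment is a Poisson cloud of trajectories, so all that the walk sees is a function of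
void events ("no particle has its trajectory in `B`") and of the variables `U`. Void probabilities
are `exp (-intensity)` (`law_void_inter`). The intensity is additive and translation invariant:
hence information on disjoint sets of trajectories and of space-time points is independent
(`indep_observed`), and the walk looks the same from every point (`law_shift`). Trajectories that
gain `h` on a line of slope `v = vstar / 3` have intensity of order `exp (-v h / 2)`
(`exists_intensity_steep_le`).

Regeneration at the origin has positive probability because finitely many steps to the right can be
forced through `U` alone, and from far inside the cone leaving it is less likely than the absence of
crossing particles (`law_regen_pos`).

For the tail of the regeneration time, fix a scale `L` and make a trial at each record `3 L j`. A
trial at the record point `y` asks for `K` forced steps, `K` of order `log L`, followed by a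
regeneration in the environment without the particles that meet the backward cone at `y`. This is
independent of the past of `y` and has probability at least `σ`, a negative power of `L`
(`le_law_past_inter`). It yields a true regeneration if no particle links the past of `y` to the
cone at `y + (K, K)`.

The difficulty is that earlier failures bias the particles of the past. The remedy is to look one
record further back: outside an atypical event, a particle that causes a link at record `j + 1`
avoids the backward cone of record point `j`, hence is independent of the failures before record
`j`, and has probability at most `κ ≤ 1 / 4` (`failed_diff_unlinked_subset`). The probabilities `a
j` of `j` failures thus satisfy a two-step recursion that forces geometric decay up to twice the
atypical probability (`recursion_bound`). Polynomially many trials suffice, and ballisticity makes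
atypical events cost `exp (-c₀ log ^ γ L)` up to powers of `L`, which are negligible since `γ > 1`.
Summing the tail gives the moment; conditioning on an event of positive probability costs only a
constant factor. -/

namespace RWDRE
open MeasureTheory ProbabilityTheory Filter Topology

/-! ### Void probabilities of the Poisson cloud -/

/-- The law of the increments of a two-sided lazy simple random walk. -/
noncomputable def stepLaw (q : ℝ) : Measure (ℤ → ℤ) := Measure.infinitePi fun _ : ℤ => lazyStep q

/-- The two-sided walk started at `0` at time `0` with increments `η`. -/
noncomputable def walkPath (η : ℤ → ℤ) (n : ℤ) : ℤ :=
  ∑ k ∈ Finset.Ico 0 n, η k - ∑ k ∈ Finset.Ico n 0, η k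

@[fun_prop]
theorem measurable_walkPath : Measurable walkPath := by
  refine measurable_pi_lambda _ fun n => ?_
  unfold walkPath
  fun_prop

theorem path_eq (s : Sample) (z : ℤ) (i : ℕ) :
    path s z i = fun n => z + walkPath (fun k => s.2.1 (z, i, k)) n := by
  funext n
  simp only [path, walkPath]
  ring

/-- The intensity measure of the Poisson cloud of environment trajectories. -/
noncomputable def intensity (q : ℝ) (ρ : ℝ≥0) : Measure (ℤ → ℤ) :=
  (ρ : ℝ≥0∞) • Measure.sum fun z : ℤ => (stepLaw q).map fun η n => z + walkPath η n

theorem measurable_startedPath (z : ℤ) : Measurable fun (η : ℤ → ℤ) (n : ℤ) => z + walkPath η n := by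
  fun_prop

theorem intensity_apply (q : ℝ) (ρ : ℝ≥0) {B : Set (ℤ → ℤ)} (hB : MeasurableSet B) :
    intensity q ρ B = ρ * ∑' z : ℤ, stepLaw q {η | (fun n => z + walkPath η n) ∈ B} := by
  simp only [intensity, Measure.smul_apply, smul_eq_mul, Measure.sum_apply _ hB]
  congr 1
  refine tsum_congr fun z => ?_
  rw [Measure.map_apply (measurable_startedPath z) hB]
  rfl

/-- The event that no environment particle has its trajectory in `B`. -/
def void (B : Set (ℤ → ℤ)) : Set Sample := {s | ∀ z i, i < s.1 z → path s z i ∉ B}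

theorem void_union (B B' : Set (ℤ → ℤ)) : void (B ∪ B') = void B ∩ void B' := by
  ext s
  simp only [void, Set.mem_union, not_or, Set.mem_ofPred_eq, Set.mem_inter_iff]
  grind

theorem void_empty : void ∅ = Set.univ := by
  ext s; simp [void]

theorem void_anti {B B' : Set (ℤ → ℤ)} (h : B ⊆ B') : void B' ⊆ void B :=
  fun _ hs z i hi hB => hs z i hi (h hB)

theorem measurable_path (z : ℤ) (i : ℕ) : Measurable fun s : Sample => path s z i := by
  simp only [path_eq]
  fun_prop

theorem measurableSet_void {B : Set (ℤ → ℤ)} (hB : MeasurableSet B) : MeasurableSet (void B) := by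
  have : void B = ⋂ z : ℤ, ⋂ i : ℕ, {s : Sample | i < s.1 z}ᶜ ∪ {s | path s z i ∈ B}ᶜ := by
    ext s
    simp only [void, Set.mem_ofPred_eq, Set.mem_iInter, Set.mem_union, Set.mem_compl_iff]
    grind
  rw [this]
  refine .iInter fun z => .iInter fun i => .union ?_ ?_
  · exact (measurableSet_lt measurable_const (by fun_prop)).compl
  · exact (measurable_path z i hB).compl

theorem lintegral_pow_poissonMeasure (ρ : ℝ≥0) {x : ℝ} (hx : 0 ≤ x) :
    ∫⁻ k, ENNReal.ofReal x ^ k ∂poissonMeasure ρ = ENNReal.ofReal (Real.exp (-(ρ * (1 - x)))) := by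
  have h := (NormedSpace.expSeries_div_hasSum_exp ((ρ : ℝ) * x)).mul_left (Real.exp (-ρ))
  rw [← Real.exp_eq_exp_ℝ, ← Real.exp_add] at h
  simp only [poissonMeasure, lintegral_sum_measure, lintegral_smul_measure, lintegral_dirac,
    smul_eq_mul]
  have h2 : ∀ n : ℕ, ENNReal.ofReal (Real.exp (-ρ) * ρ ^ n / (n.factorial)) * ENNReal.ofReal x ^ n =
      ENNReal.ofReal (Real.exp (-ρ) * ((ρ * x) ^ n / n.factorial)) := by
    intro n
    rw [← ENNReal.ofReal_pow hx, ← ENNReal.ofReal_mul (by positivity)]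
    congr 1
    rw [mul_pow]; ring
  simp only [h2]
  rw [← ENNReal.ofReal_tsum_of_nonneg (fun n => by positivity) h.summable, h.tsum_eq]
  congr 2
  ring

section Law

variable {q : ℝ} [IsProbabilityMeasure (lazyStep q)] {ρ : ℝ≥0}

instance : IsProbabilityMeasure (stepLaw q) := by unfold stepLaw; infer_instance

instance : IsProbabilityMeasure (law q ρ) := by unfold law; infer_instance

/-- Grouping the increments by particle turns the single i.i.d. family into an i.i.d. family of
walks, so that distinct particles can be treated as independent. -/
theorem map_increments : (Measure.infinitePi fun _ : ℤ × ℕ × ℤ => lazyStep q).map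
      (fun ξ (p : ℤ × ℕ) (k : ℤ) => ξ (p.1, p.2, k)) =
    Measure.infinitePi fun _ : ℤ × ℕ => stepLaw q := by
  have h := Measure.map_infinitePi_infinitePi_of_inj (P := fun _ : ℤ × ℕ × ℤ => lazyStep q)
    (f := fun p : (ℤ × ℕ) × ℤ => (p.1.1, p.1.2, p.2))
    (by rintro ⟨⟨a, b⟩, c⟩ ⟨⟨a', b'⟩, c'⟩ h; simp_all)
  have h2 := Measure.infinitePi_map_curry (fun (_ : ℤ × ℕ) (_ : ℤ) => lazyStep q)
  rw [← h, Measure.map_map (by fun_prop) (by fun_prop)] at h2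
  exact h2

theorem increments_apply_void (n : ℤ → ℕ) (Z : Finset ℤ) {B : Set (ℤ → ℤ)}
    (hB : MeasurableSet B) :
    (Measure.infinitePi fun _ : ℤ × ℕ × ℤ => lazyStep q)
      {ξ | ∀ z ∈ Z, ∀ i < n z, (fun m => z + walkPath (fun k => ξ (z, i, k)) m) ∉ B} =
    ∏ z ∈ Z, stepLaw q {η | (fun m => z + walkPath η m) ∉ B} ^ n z := by
  set F : Finset (ℤ × ℕ) :=
    (Z.sigma fun z => Finset.range (n z)).map (Equiv.sigmaEquivProd ℤ ℕ).toEmbedding with hF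
  set t : ℤ × ℕ → Set (ℤ → ℤ) := fun p => {η | (fun m => p.1 + walkPath η m) ∉ B} with ht
  have hmt : ∀ p, MeasurableSet (t p) := fun p => (measurable_startedPath p.1 hB).compl
  have h1 := Measure.infinitePi_pi (fun _ : ℤ × ℕ => stepLaw q) (s := F) (t := t)
    (fun p _ => hmt p)
  rw [← map_increments, Measure.map_apply (by fun_prop)
    (.pi (Finset.countable_toSet _) fun p _ => hmt p)] at h1
  have h2 : {ξ : ℤ × ℕ × ℤ → ℤ | ∀ z ∈ Z, ∀ i < n z,
      (fun m => z + walkPath (fun k => ξ (z, i, k)) m) ∉ B} =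
      (fun (ξ : ℤ × ℕ × ℤ → ℤ) (p : ℤ × ℕ) (k : ℤ) => ξ (p.1, p.2, k)) ⁻¹' (F : Set _).pi t := by
    ext ξ
    simp only [hF, ht, Set.mem_ofPred_eq, Set.mem_preimage, Set.mem_pi, Finset.mem_coe,
      Finset.mem_map, Finset.mem_sigma, Finset.mem_range, Prod.forall]
    constructor
    · rintro h a b ⟨⟨c, d⟩, ⟨h1, h2⟩, h3⟩
      simp only [Equiv.coe_toEmbedding, Equiv.sigmaEquivProd_apply, Prod.mk.injEq] at h3
      obtain ⟨rfl, rfl⟩ := h3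
      exact h _ h1 _ h2
    · intro h z hz i hi
      exact h z i ⟨⟨z, i⟩, ⟨hz, hi⟩, rfl⟩
  rw [h2, h1, hF, Finset.prod_map, Finset.prod_sigma]
  refine Finset.prod_congr rfl fun z _ => ?_
  simp [ht]

/-- The void probabilities of the Poisson cloud together with the law of the variables `U`. -/
theorem law_void_inter {B : Set (ℤ → ℤ)} (hB : MeasurableSet B) (hfin : intensity q ρ B ≠ ∞)
    {C : Set (ℤ × ℤ → unitInterval)} (hC : MeasurableSet C) :
    law q ρ (void B ∩ {s | s.2.2 ∈ C}) =
      ENNReal.ofReal (Real.exp (-(intensity q ρ B).toReal)) *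
        (Measure.infinitePi fun _ : ℤ × ℤ => (volume : Measure unitInterval)) C := by
  set b : ℤ → ℝ := fun z => (stepLaw q {η | (fun m => z + walkPath η m) ∈ B}).toReal with hb
  have hmeas : ∀ z, MeasurableSet {η : ℤ → ℤ | (fun m => z + walkPath η m) ∈ B} :=
    fun z => measurable_startedPath z hB
  have hcompl : ∀ z, stepLaw q {η | (fun m => z + walkPath η m) ∉ B} =
      ENNReal.ofReal (1 - b z) := by
    intro z
    have := prob_compl_eq_one_sub (μ := stepLaw q) (hmeas z)
    rw [ENNReal.ofReal_sub _ ENNReal.toReal_nonneg, ENNReal.ofReal_one,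
      ENNReal.ofReal_toReal (measure_ne_top _ _), ← this]
    rfl
  have hb1 : ∀ z, 0 ≤ 1 - b z := by
    intro z
    have : b z ≤ 1 := by
      simpa [hb] using ENNReal.toReal_mono ENNReal.one_ne_top
        (prob_le_one (μ := stepLaw q) (s := {η | (fun m => z + walkPath η m) ∈ B}))
    linarith
  -- The product formula holds for finitely many starting sites; these windows exhaust `ℤ`, and
  -- continuity from above gives the full void event.
  set Z : ℕ → Finset ℤ := fun m => Finset.Icc (-m : ℤ) m with hZ
  set VZ : ℕ → Set Sample := fun m =>
    {s | ∀ z ∈ Z m, ∀ i < s.1 z, path s z i ∉ B} ∩ {s | s.2.2 ∈ C} with hVZ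
  have hCm : MeasurableSet {s : Sample | s.2.2 ∈ C} := hC.preimage (by fun_prop)
  have hVm : ∀ m, MeasurableSet (VZ m) := by
    intro m
    refine .inter ?_ hCm
    have : {s : Sample | ∀ z ∈ Z m, ∀ i < s.1 z, path s z i ∉ B} =
        ⋂ z ∈ Z m, ⋂ i : ℕ, {s : Sample | i < s.1 z}ᶜ ∪ {s | path s z i ∈ B}ᶜ := by
      ext s
      simp only [Set.mem_ofPred_eq, Set.mem_iInter, Set.mem_union, Set.mem_compl_iff]
      grind
    rw [this]
    refine Finset.measurableSet_biInter _ fun z _ => .iInter fun i => .union ?_ ?_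
    · exact (measurableSet_lt measurable_const (by fun_prop)).compl
    · exact (measurable_path z i hB).compl
  have hval : ∀ m, law q ρ (VZ m) = ENNReal.ofReal (Real.exp (-(ρ * ∑ z ∈ Z m, b z))) *
      (Measure.infinitePi fun _ : ℤ × ℤ => (volume : Measure unitInterval)) C := by
    intro m
    rw [law, Measure.prod_apply (hVm m)]
    have h1 : ∀ n : ℤ → ℕ, Prod.mk n ⁻¹' VZ m =
        {ξ : ℤ × ℕ × ℤ → ℤ | ∀ z ∈ Z m, ∀ i < n z,
          (fun m => z + walkPath (fun k => ξ (z, i, k)) m) ∉ B} ×ˢ C := by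
      intro n
      ext ⟨ξ, u⟩
      simp [hVZ, path_eq]
    simp only [h1, Measure.prod_prod, increments_apply_void _ _ hB, hcompl]
    rw [lintegral_mul_const _ (by fun_prop)]
    congr 1
    have h2 := lintegral_prod_eq_prod_lintegral_of_indepFun
      (μ := Measure.infinitePi fun _ : ℤ => poissonMeasure ρ) (Z m)
      (fun z n => ENNReal.ofReal (1 - b z) ^ n z)
      (iIndepFun_infinitePi (P := fun _ : ℤ => poissonMeasure ρ)
        (X := fun z k => ENNReal.ofReal (1 - b z) ^ k) (fun z => .of_discrete))
      (fun z => by fun_prop)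
    rw [h2]
    -- Averaging over the Poisson number of particles at `z` evaluates its generating function at `1
    -- - b z`.
    have h3 : ∀ z, ∫⁻ n : ℤ → ℕ, ENNReal.ofReal (1 - b z) ^ n z
        ∂(Measure.infinitePi fun _ : ℤ => poissonMeasure ρ) =
        ENNReal.ofReal (Real.exp (-(ρ * b z))) := by
      intro z
      have h4 := (measurePreserving_eval_infinitePi (fun _ : ℤ => poissonMeasure ρ) z).lintegral_comp
        (f := fun k : ℕ => ENNReal.ofReal (1 - b z) ^ k) .of_discrete
      simp only [Function.eval] at h4
      rw [h4, lintegral_pow_poissonMeasure ρ (hb1 z)]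
      simp
    simp only [h3]
    rw [← ENNReal.ofReal_prod_of_nonneg (fun _ _ => by positivity), ← Real.exp_sum,
      Finset.sum_neg_distrib, Finset.mul_sum]
  have hinter : void B ∩ {s | s.2.2 ∈ C} = ⋂ m, VZ m := by
    ext s
    simp only [void, hVZ, Set.mem_inter_iff, Set.mem_ofPred_eq, Set.mem_iInter, hZ, Finset.mem_Icc]
    constructor
    · rintro ⟨h1, h2⟩ m
      exact ⟨fun z _ i hi => h1 z i hi, h2⟩
    · intro h
      refine ⟨fun z i hi => (h z.natAbs).1 z (by omega) i hi, (h 0).2⟩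
  have hanti : Antitone VZ := by
    intro m m' hm s hs
    refine ⟨fun z hz i hi => hs.1 z ?_ i hi, hs.2⟩
    simp only [hZ, Finset.mem_Icc] at hz ⊢
    omega
  have hlim := tendsto_measure_iInter_atTop (μ := law q ρ)
    (fun m => (hVm m).nullMeasurableSet) hanti ⟨0, measure_ne_top _ _⟩
  rw [← hinter] at hlim
  refine tendsto_nhds_unique hlim ?_
  simp only [Function.comp_def, hval]
  -- For `ρ = 0` a finite intensity says nothing about the summability of `b`.
  rcases eq_or_ne ρ 0 with h0 | h0
  · simp [h0, intensity]
  have hsumfin : ∑' z : ℤ, stepLaw q {η | (fun n => z + walkPath η n) ∈ B} ≠ ∞ := by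
    rw [intensity_apply q ρ hB] at hfin
    intro h
    rw [h] at hfin
    simp [h0] at hfin
  have hsummable : Summable b := ENNReal.summable_toReal hsumfin
  have htsum : (intensity q ρ B).toReal = ρ * ∑' z, b z := by
    rw [intensity_apply q ρ hB, ENNReal.toReal_mul, ENNReal.tsum_toReal_eq]
    · rfl
    · intro z; exact measure_ne_top _ _
  rw [htsum]
  have hZt : Tendsto Z atTop atTop := by
    refine tendsto_atTop_finset_of_monotone ?_ ?_
    · intro m m' hm z hz
      simp only [hZ, Finset.mem_Icc] at hz ⊢
      omega
    · intro z
      refine ⟨z.natAbs, ?_⟩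
      simp only [hZ, Finset.mem_Icc]
      omega
  have hs := hsummable.hasSum.comp hZt
  refine ENNReal.Tendsto.mul_const ?_ (Or.inr (measure_ne_top _ _))
  refine ENNReal.tendsto_ofReal ((Real.continuous_exp.tendsto _).comp ?_)
  exact (hs.const_mul (ρ : ℝ)).neg

end Law

/-! ### Translation invariance of the intensity and decay for steep trajectories -/

theorem walkPath_zero (η : ℤ → ℤ) : walkPath η 0 = 0 := by simp [walkPath]

theorem walkPath_add_one (η : ℤ → ℤ) (n : ℤ) : walkPath η (n + 1) = walkPath η n + η n := by
  rcases le_or_gt 0 n with h | h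
  · have h1 : Finset.Ico n 0 = ∅ := Finset.Ico_eq_empty (by omega)
    have h2 : Finset.Ico (n + 1) 0 = ∅ := Finset.Ico_eq_empty (by omega)
    have h3 : Finset.Ico 0 (n + 1) = insert n (Finset.Ico 0 n) := by
      ext k; simp only [Finset.mem_Ico, Finset.mem_insert]; omega
    rw [walkPath, walkPath, h1, h2, h3, Finset.sum_insert (by simp)]
    ring
  · have h1 : Finset.Ico 0 n = ∅ := Finset.Ico_eq_empty (by omega)
    have h2 : Finset.Ico 0 (n + 1) = ∅ := Finset.Ico_eq_empty (by omega)
    have h3 : Finset.Ico n 0 = insert n (Finset.Ico (n + 1) 0) := by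
      ext k; simp only [Finset.mem_Ico, Finset.mem_insert]; omega
    rw [walkPath, walkPath, h1, h2, h3, Finset.sum_insert (by simp)]
    ring

theorem walkPath_add (η : ℤ → ℤ) (m n : ℤ) :
    walkPath η (n + m) = walkPath η m + walkPath (fun k => η (k + m)) n := by
  induction n using Int.induction_on with
  | zero => simp [walkPath_zero]
  | succ i ih =>
    have h : (i : ℤ) + 1 + m = i + m + 1 := by ring
    rw [h, walkPath_add_one, ih, walkPath_add_one]
    ring
  | pred i ih =>
    have h1 := walkPath_add_one η (-(i : ℤ) - 1 + m)
    have h2 := walkPath_add_one (fun k => η (k + m)) (-(i : ℤ) - 1)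
    have h3 : -(i : ℤ) - 1 + m + 1 = -i + m := by ring
    have h4 : -(i : ℤ) - 1 + 1 = -i := by ring
    rw [h3] at h1
    rw [h4] at h2
    linarith

/-- The trajectories that are strictly to the left of the line of slope `v` and level `s` at some
time `≤ t`, and to the right of the line of level `s + h` at some time `≥ t`. -/
def steep (v : ℝ) (t : ℤ) (s h : ℝ) : Set (ℤ → ℤ) :=
  {w | (∃ n ≤ t, (w n : ℝ) - v * n < s) ∧ ∃ n ≥ t, s + h ≤ (w n : ℝ) - v * n}

theorem measurableSet_steep (v : ℝ) (t : ℤ) (s h : ℝ) : MeasurableSet (steep v t s h) := by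
  have : steep v t s h = (⋃ n : ℤ, ⋃ _ : n ≤ t, {w : ℤ → ℤ | (w n : ℝ) - v * n < s}) ∩
      ⋃ n : ℤ, ⋃ _ : n ≥ t, {w : ℤ → ℤ | s + h ≤ (w n : ℝ) - v * n} := by
    ext w; simp [steep]
  rw [this]
  have hc : ∀ n : ℤ, Measurable fun w : ℤ → ℤ => (w n : ℝ) - v * n := fun n =>
    ((measurable_of_countable (fun k : ℤ => (k : ℝ))).comp (measurable_pi_apply n)).sub_const _
  exact .inter (.iUnion fun n => .iUnion fun _ => measurableSet_lt (hc n) measurable_const)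
    (.iUnion fun n => .iUnion fun _ => measurableSet_le measurable_const (hc n))

/-- The left side is `q + (1 - q) cosh θ`, and both `1` and `cosh θ` are at most `exp (θ ^ 2 / 2)`.
-/
theorem lintegral_exp_lazyStep_le {q : ℝ} (h0 : 0 ≤ q) (h1 : q ≤ 1) (θ : ℝ) :
    ∫⁻ x, ENNReal.ofReal (Real.exp (θ * x)) ∂lazyStep q ≤ ENNReal.ofReal (Real.exp (θ ^ 2 / 2)) := by
  have h2 : 0 ≤ (1 - q) / 2 := by linarith
  simp only [lazyStep, lintegral_add_measure, lintegral_smul_measure, lintegral_dirac, smul_eq_mul]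
  rw [← ENNReal.ofReal_mul h2, ← ENNReal.ofReal_mul h0, ← ENNReal.ofReal_mul h2,
    ← ENNReal.ofReal_add (by positivity) (by positivity),
    ← ENNReal.ofReal_add (by positivity) (by positivity)]
  refine ENNReal.ofReal_le_ofReal ?_
  have h3 := Real.cosh_le_exp_half_sq θ
  have h4 := Real.cosh_eq θ
  have h5 : 1 ≤ Real.exp (θ ^ 2 / 2) := Real.one_le_exp (by positivity)
  simp only [Int.cast_neg, Int.cast_one, mul_neg, mul_one, Int.cast_zero, mul_zero, Real.exp_zero]
  nlinarith

section Law

variable {q : ℝ} [IsProbabilityMeasure (lazyStep q)] {ρ : ℝ≥0}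

theorem stepLaw_shift (m : ℤ) :
    MeasurePreserving (fun (η : ℤ → ℤ) (k : ℤ) => η (k + m)) (stepLaw q) (stepLaw q) where
  measurable := by fun_prop
  map_eq := Measure.map_infinitePi_infinitePi_of_inj (P := fun _ : ℤ => lazyStep q)
    (add_left_injective m)

/-- The intensity is invariant under translations in space and time. -/
theorem intensity_shift (m a : ℤ) {B : Set (ℤ → ℤ)} (hB : MeasurableSet B) :
    intensity q ρ {w | (fun n => w (n + m) + a) ∈ B} = intensity q ρ B := by
  have hB' : MeasurableSet {w : ℤ → ℤ | (fun n => w (n + m) + a) ∈ B} :=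
    hB.preimage (by fun_prop)
  rw [intensity_apply _ _ hB', intensity_apply _ _ hB]
  congr 1
  have hmeas : ∀ z, MeasurableSet {η : ℤ → ℤ | (fun n => z + walkPath η n) ∈ B} :=
    fun z => measurable_startedPath z hB
  have h1 : ∀ z, stepLaw q {η | (fun n => z + walkPath η n) ∈ {w | (fun n => w (n + m) + a) ∈ B}} =
      ∫⁻ η, Set.indicator B 1 (fun n => (z + a + walkPath η m) +
        walkPath (fun k => η (k + m)) n) ∂stepLaw q := by
    intro z
    rw [← lintegral_indicator_one]
    · refine lintegral_congr fun η => ?_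
      simp only [Set.indicator, Set.mem_ofPred_eq]
      have : (fun n => z + walkPath η (n + m) + a) =
        fun n => z + a + walkPath η m + walkPath (fun k => η (k + m)) n := by
        funext n; rw [walkPath_add]; ring
      simp only [this, Pi.one_apply]
      split_ifs with h1 h2 h2
      · rfl
      · exact absurd (this ▸ h1) h2
      · exact absurd (this ▸ h2) h1
      · rfl
    · exact hB'.preimage (measurable_startedPath z)
  have h2 : ∀ z, stepLaw q {η | (fun n => z + walkPath η n) ∈ B} =
      ∫⁻ η, Set.indicator B 1 (fun n => z + walkPath (fun k => η (k + m)) n) ∂stepLaw q := by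
    intro z
    rw [← (stepLaw_shift (q := q) m).measure_preimage (hmeas z).nullMeasurableSet,
      ← lintegral_indicator_one ((stepLaw_shift (q := q) m).measurable (hmeas z))]
    rfl
  simp only [h1, h2]
  have hi : Measurable (Set.indicator B (1 : (ℤ → ℤ) → ℝ≥0∞)) := measurable_one.indicator hB
  -- Seen from time `m`, the walk of `z` starts at `z + a + walkPath η m`. For fixed `η` this only
  -- permutes the sites, so the sum over `z` under the integral absorbs the random displacement.
  rw [← lintegral_tsum, ← lintegral_tsum]
  · refine lintegral_congr fun η => ?_
    exact (Equiv.addRight (a + walkPath η m)).tsum_eq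
      (fun z => Set.indicator B (1 : (ℤ → ℤ) → ℝ≥0∞)
        (fun n => z + walkPath (fun k => η (k + m)) n)) ▸
      tsum_congr fun z => by simp [add_assoc]
  · intro z
    exact (hi.comp (by fun_prop)).aemeasurable
  · intro z
    exact (hi.comp (by fun_prop)).aemeasurable

theorem lintegral_exp_sum_le (h0 : 0 ≤ q) (h1 : q ≤ 1) (θ : ℝ) (F : Finset ℤ) :
    ∫⁻ η, ENNReal.ofReal (Real.exp (θ * (∑ k ∈ F, η k : ℤ))) ∂stepLaw q ≤
      ENNReal.ofReal (Real.exp (θ ^ 2 / 2 * F.card)) := by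
  have h2 := lintegral_prod_eq_prod_lintegral_of_indepFun (μ := stepLaw q) F
      (fun k η => ENNReal.ofReal (Real.exp (θ * η k)))
      (iIndepFun_infinitePi (P := fun _ : ℤ => lazyStep q)
        (X := fun _ x => ENNReal.ofReal (Real.exp (θ * x))) (fun z => .of_discrete))
      (fun z => by
        exact (Measurable.of_discrete (f := fun x : ℤ => ENNReal.ofReal (Real.exp (θ * x)))).comp
          (measurable_pi_apply z))
  have h3 : ∀ k, ∫⁻ η, ENNReal.ofReal (Real.exp (θ * η k)) ∂stepLaw q ≤
      ENNReal.ofReal (Real.exp (θ ^ 2 / 2)) := by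
    intro k
    have h4 := (measurePreserving_eval_infinitePi (fun _ : ℤ => lazyStep q) k).lintegral_comp
        (f := fun x : ℤ => ENNReal.ofReal (Real.exp (θ * x))) .of_discrete
    simp only [Function.eval] at h4
    rw [stepLaw, h4]
    exact lintegral_exp_lazyStep_le h0 h1 θ
  calc _ = ∫⁻ η, ∏ k ∈ F, ENNReal.ofReal (Real.exp (θ * η k)) ∂stepLaw q := by
        refine lintegral_congr fun η => ?_
        rw [← ENNReal.ofReal_prod_of_nonneg (fun _ _ => by positivity), ← Real.exp_sum]
        push_cast
        rw [Finset.mul_sum]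
    _ ≤ ∏ k ∈ F, ENNReal.ofReal (Real.exp (θ ^ 2 / 2)) := by
        rw [h2]
        exact Finset.prod_le_prod' fun k _ => h3 k
    _ = _ := by
        rw [Finset.prod_const, ← ENNReal.ofReal_pow (by positivity), ← Real.exp_nat_mul]
        congr 2
        ring

/-- Chernoff bound with parameter `v`: the moment `exp (v ^ 2 n / 2)` against the threshold `exp (v
(r + v n))` leaves `exp (-v r) exp (-v ^ 2 n / 2)`, a geometric series in `n`. -/
theorem stepLaw_tail_le (h0 : 0 ≤ q) (h1 : q ≤ 1) {v : ℝ} (hv : 0 < v) (r : ℝ)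
    (F : ℕ → Finset ℤ) (hF : ∀ n, (F n).card = n) :
    stepLaw q {η | ∃ n : ℕ, r + v * n ≤ (∑ k ∈ F n, η k : ℤ)} ≤
      ENNReal.ofReal ((1 - Real.exp (-(v ^ 2 / 2)))⁻¹ * Real.exp (-(v * r))) := by
  have hx : Real.exp (-(v ^ 2 / 2)) < 1 := by
    rw [Real.exp_lt_one_iff]; nlinarith
  have h2 : ∀ n : ℕ, stepLaw q {η | r + v * n ≤ (∑ k ∈ F n, η k : ℤ)} ≤
      ENNReal.ofReal (Real.exp (-(v * r)) * Real.exp (-(v ^ 2 / 2)) ^ n) := by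
    intro n
    have h3 : Measurable fun η : ℤ → ℤ => ENNReal.ofReal (Real.exp (v * (∑ k ∈ F n, η k : ℤ))) :=
      (Measurable.of_discrete (f := fun x : ℤ => ENNReal.ofReal (Real.exp (v * x)))).comp
        (by fun_prop)
    have h4 := mul_meas_ge_le_lintegral (μ := stepLaw q) h3
      (ENNReal.ofReal (Real.exp (v * (r + v * n))))
    have h5 := h4.trans (lintegral_exp_sum_le h0 h1 v (F n))
    have h6 : {η : ℤ → ℤ | r + v * n ≤ (∑ k ∈ F n, η k : ℤ)} ⊆
        {η | ENNReal.ofReal (Real.exp (v * (r + v * n))) ≤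
          ENNReal.ofReal (Real.exp (v * (∑ k ∈ F n, η k : ℤ)))} := by
      intro η hη
      refine ENNReal.ofReal_le_ofReal (Real.exp_le_exp.2 ?_)
      exact mul_le_mul_of_nonneg_left hη hv.le
    refine (measure_mono h6).trans ?_
    have hpos : ENNReal.ofReal (Real.exp (v * (r + v * n))) ≠ 0 := by
      simpa using Real.exp_pos _
    rw [← ENNReal.mul_le_mul_iff_right hpos ENNReal.ofReal_ne_top]
    refine h5.trans ?_
    rw [← ENNReal.ofReal_mul (by positivity)]
    refine ENNReal.ofReal_le_ofReal ?_
    rw [← Real.exp_nat_mul, ← Real.exp_add, ← Real.exp_add, hF]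
    refine Real.exp_le_exp.2 (le_of_eq ?_)
    ring
  have h7 : {η : ℤ → ℤ | ∃ n : ℕ, r + v * n ≤ (∑ k ∈ F n, η k : ℤ)} =
      ⋃ n : ℕ, {η | r + v * n ≤ (∑ k ∈ F n, η k : ℤ)} := by ext; simp
  rw [h7]
  refine (measure_iUnion_le _).trans ((ENNReal.tsum_le_tsum h2).trans ?_)
  have h8 := (hasSum_geometric_of_lt_one (Real.exp_pos _).le hx).mul_left (Real.exp (-(v * r)))
  rw [← ENNReal.ofReal_tsum_of_nonneg (fun n => by positivity) h8.summable, h8.tsum_eq, mul_comm]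

/-- A walk at `z` at time `0` must have gained `z - s` on the line in the past and must gain `s + h
- z` in the future. Only the costlier of the two requirements is kept. -/
theorem startedPath_steep_le (h0 : 0 ≤ q) (h1 : q ≤ 1) {v : ℝ} (hv : 0 < v) (s h : ℝ) (z : ℤ) :
    stepLaw q {η | (fun n => z + walkPath η n) ∈ steep v 0 s h} ≤
      ENNReal.ofReal ((1 - Real.exp (-(v ^ 2 / 2)))⁻¹ * Real.exp (-(v * max (z - s) (s + h - z)))) := by
  rcases max_choice ((z : ℝ) - s) (s + h - z) with hm | hm <;> rw [hm]
  · refine le_trans (measure_mono ?_) (stepLaw_tail_le h0 h1 hv (z - s)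
      (fun n => Finset.Ico (-n : ℤ) 0) (by simp))
    rintro η ⟨⟨n, hn, hw⟩, -⟩
    refine ⟨n.natAbs, ?_⟩
    have h2 : ((n.natAbs : ℕ) : ℤ) = -n := by omega
    have h3 : ((n.natAbs : ℕ) : ℝ) = -n := by rw [← Int.cast_natCast, h2]; simp
    have h4 : Finset.Ico 0 n = ∅ := Finset.Ico_eq_empty (by omega)
    simp only [walkPath, h4, Finset.sum_empty] at hw
    rw [h2, h3, neg_neg]
    push_cast at hw ⊢
    linarith
  · refine le_trans (measure_mono ?_) (stepLaw_tail_le h0 h1 hv (s + h - z)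
      (fun n => Finset.Ico 0 (n : ℤ)) (by simp))
    rintro η ⟨-, n, hn, hw⟩
    refine ⟨n.natAbs, ?_⟩
    have h2 : ((n.natAbs : ℕ) : ℤ) = n := by omega
    have h3 : ((n.natAbs : ℕ) : ℝ) = n := by rw [← Int.cast_natCast, h2]
    have h4 : Finset.Ico n 0 = ∅ := Finset.Ico_eq_empty (by omega)
    simp only [walkPath, h4, Finset.sum_empty] at hw
    rw [h2, h3]
    push_cast at hw ⊢
    linarith

theorem tsum_exp_neg_abs_ne_top {v : ℝ} (hv : 0 < v) :
    ∑' z : ℤ, ENNReal.ofReal (Real.exp (-(v * |(z : ℝ)|))) ≠ ∞ := by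
  have h1 : Summable fun n : ℕ => Real.exp (-(v * n)) := by
    have := summable_geometric_of_lt_one (r := Real.exp (-v)) (Real.exp_pos _).le
      (by rw [Real.exp_lt_one_iff]; linarith)
    refine this.congr fun n => ?_
    rw [← Real.exp_nat_mul]; ring_nf
  have h2 : Summable fun z : ℤ => Real.exp (-(v * |(z : ℝ)|)) := by
    refine Summable.of_nat_of_neg ?_ ?_ <;> simpa using h1
  exact h2.tsum_ofReal_ne_top

theorem exists_intensity_steep_le (h0 : 0 ≤ q) (h1 : q ≤ 1) {v : ℝ} (hv : 0 < v) (ρ : ℝ≥0) :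
    ∃ C : ℝ, 0 < C ∧ ∀ (t : ℤ) (s h : ℝ),
      intensity q ρ (steep v t s h) ≤ ENNReal.ofReal (C * Real.exp (-(v * h / 2))) := by
  set g : ℝ := (1 - Real.exp (-(v ^ 2 / 2)))⁻¹ with hg
  set S := ∑' z : ℤ, ENNReal.ofReal (Real.exp (-(v * |(z : ℝ)|))) with hS
  have hgpos : 0 < g := by
    have hx : Real.exp (-(v ^ 2 / 2)) < 1 := by
      rw [Real.exp_lt_one_iff]; nlinarith
    exact inv_pos.2 (by linarith)
  refine ⟨ρ * g * Real.exp v * S.toReal + 1, by positivity, fun t s h => ?_⟩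
  have hshift : steep v t s h =
      {w | (fun n => w (n + t) + 0) ∈ steep v 0 (s + v * t) h} := by
    ext w
    simp only [steep, Set.mem_ofPred_eq, add_zero]
    have e : ∀ n : ℤ, (w n : ℝ) - v * n < s ↔
        ((w (n - t + t) : ℝ) - v * ((n - t : ℤ) : ℝ) < s + v * t) := by
      intro n; rw [sub_add_cancel]; push_cast; constructor <;> intro h <;> linarith
    have e' : ∀ n : ℤ, s + h ≤ (w n : ℝ) - v * n ↔
        (s + v * t + h ≤ (w (n - t + t) : ℝ) - v * ((n - t : ℤ) : ℝ)) := by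
      intro n; rw [sub_add_cancel]; push_cast; constructor <;> intro h <;> linarith
    constructor
    · rintro ⟨⟨n, hn, h1⟩, n', hn', h2⟩
      exact ⟨⟨n - t, by omega, (e n).1 h1⟩, n' - t, by omega, (e' n').1 h2⟩
    · rintro ⟨⟨n, hn, h1⟩, n', hn', h2⟩
      refine ⟨⟨n + t, by omega, (e _).2 ?_⟩, n' + t, by omega, (e' _).2 ?_⟩ <;>
        rwa [add_sub_cancel_right]
  rw [hshift, intensity_shift _ _ (measurableSet_steep _ _ _ _),
    intensity_apply _ _ (measurableSet_steep _ _ _ _)]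
  set s' := s + v * t
  -- The maximum of the two costs is `h / 2` plus the distance of `z` to the midpoint `s' + h / 2`.
  -- Rounding the midpoint loses at most `1`, whence the factor `exp v`.
  set m : ℤ := ⌊s' + h / 2⌋ with hm
  have hz : ∀ z : ℤ, stepLaw q {η | (fun n => z + walkPath η n) ∈ steep v 0 s' h} ≤
      ENNReal.ofReal (g * Real.exp v * Real.exp (-(v * h / 2))) *
        ENNReal.ofReal (Real.exp (-(v * |((z - m : ℤ) : ℝ)|))) := by
    intro z
    refine (startedPath_steep_le h0 h1 hv s' h z).trans ?_
    rw [← ENNReal.ofReal_mul (by positivity)]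
    refine ENNReal.ofReal_le_ofReal ?_
    rw [mul_assoc, mul_assoc]
    refine mul_le_mul_of_nonneg_left ?_ hgpos.le
    rw [← Real.exp_add, ← Real.exp_add]
    refine Real.exp_le_exp.2 ?_
    have h3 := Int.floor_le (s' + h / 2)
    have h4 := Int.lt_floor_add_one (s' + h / 2)
    rw [← hm] at h3 h4
    have h5 : |((z - m : ℤ) : ℝ)| + h / 2 - 1 ≤ max ((z : ℝ) - s') (s' + h - z) := by
      push_cast
      rcases le_total 0 ((z : ℝ) - m) with h6 | h6
      · rw [abs_of_nonneg h6]
        exact le_trans (by linarith) (le_max_left _ _)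
      · rw [abs_of_nonpos h6]
        exact le_trans (by linarith) (le_max_right _ _)
    nlinarith [mul_le_mul_of_nonneg_left h5 hv.le]
  have hsum : ∑' z : ℤ, ENNReal.ofReal (Real.exp (-(v * |((z - m : ℤ) : ℝ)|))) = S :=
    (Equiv.subRight m).tsum_eq (fun z : ℤ => ENNReal.ofReal (Real.exp (-(v * |(z : ℝ)|))))
  calc _ ≤ (ρ : ℝ≥0∞) * ∑' z : ℤ, (ENNReal.ofReal (g * Real.exp v * Real.exp (-(v * h / 2))) *
        ENNReal.ofReal (Real.exp (-(v * |((z - m : ℤ) : ℝ)|)))) := by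
        gcongr with z; exact hz z
    _ = ENNReal.ofReal (ρ * (g * Real.exp v * Real.exp (-(v * h / 2))) * S.toReal) := by
        rw [ENNReal.tsum_mul_left, hsum, ENNReal.ofReal_mul (by positivity : 0 ≤ (ρ : ℝ) * _),
          ENNReal.ofReal_mul (by positivity : 0 ≤ (ρ : ℝ)), hS, ENNReal.ofReal_toReal (tsum_exp_neg_abs_ne_top hv),
          ENNReal.ofReal_coe_nnreal, ← mul_assoc]
    _ ≤ _ := by
        refine ENNReal.ofReal_le_ofReal ?_
        have := Real.exp_pos (-(v * h / 2))
        nlinarith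

end Law

/-! ### Sigma-algebras of local information and their independence -/

/-- The events "no particle has its trajectory in `B`, and the variables `U` at finitely many
points `F` lie in prescribed sets", where `B ⊆ A` and `F ⊆ Z`. -/
def patterns (q : ℝ) (ρ : ℝ≥0) (A : Set (ℤ → ℤ)) (Z : Set (ℤ × ℤ)) : Set (Set Sample) :=
  {E | ∃ (B : Set (ℤ → ℤ)) (F : Finset (ℤ × ℤ)) (I : ℤ × ℤ → Set unitInterval),
    MeasurableSet B ∧ B ⊆ A ∧ intensity q ρ B ≠ ∞ ∧ ↑F ⊆ Z ∧ (∀ z, MeasurableSet (I z)) ∧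
    E = void B ∩ {s | s.2.2 ∈ (F : Set (ℤ × ℤ)).pi I}}

/-- The information on the particles with trajectory in `A` and on the variables `U` in `Z`. -/
abbrev observed (q : ℝ) (ρ : ℝ≥0) (A : Set (ℤ → ℤ)) (Z : Set (ℤ × ℤ)) : MeasurableSpace Sample :=
  MeasurableSpace.generateFrom (patterns q ρ A Z)

theorem pi_inter_pi {ι α : Type*} [DecidableEq ι] (F F' : Finset ι) (I I' : ι → Set α) :
    (F : Set ι).pi I ∩ (F' : Set ι).pi I' = ((F ∪ F' : Finset ι) : Set ι).pi fun z =>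
      (if z ∈ F then I z else Set.univ) ∩ (if z ∈ F' then I' z else Set.univ) := by
  ext u
  simp only [Set.mem_inter_iff, Set.mem_pi, Finset.mem_coe, Finset.coe_union, Set.mem_union]
  constructor
  · rintro ⟨h1, h2⟩ z -
    constructor
    · split_ifs with h
      · exact h1 z h
      · trivial
    · split_ifs with h
      · exact h2 z h
      · trivial
  · intro h
    refine ⟨fun z hz => ?_, fun z hz => ?_⟩
    · simpa [hz] using (h z (Or.inl hz)).1
    · simpa [hz] using (h z (Or.inr hz)).2

section Observed

variable {q : ℝ} {ρ : ℝ≥0} {A A' : Set (ℤ → ℤ)} {Z Z' : Set (ℤ × ℤ)}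

theorem isPiSystem_patterns : IsPiSystem (patterns q ρ A Z) := by
  classical
  rintro _ ⟨B, F, I, hB, hBA, hfin, hF, hI, rfl⟩ _ ⟨B', F', I', hB', hBA', hfin', hF', hI', rfl⟩ -
  refine ⟨B ∪ B', F ∪ F', fun z => (if z ∈ F then I z else Set.univ) ∩
    (if z ∈ F' then I' z else Set.univ), hB.union hB', Set.union_subset hBA hBA', ?_, ?_, ?_, ?_⟩
  · exact ((measure_union_le _ _).trans_lt (ENNReal.add_lt_top.2 ⟨hfin.lt_top, hfin'.lt_top⟩)).ne
  · simpa using ⟨hF, hF'⟩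
  · intro z
    refine .inter ?_ ?_
    · split_ifs
      · exact hI z
      · exact .univ
    · split_ifs
      · exact hI' z
      · exact .univ
  · rw [void_union, ← pi_inter_pi]
    ext s
    simp only [Set.mem_inter_iff, Set.mem_ofPred_eq]
    tauto

theorem measurableSet_of_mem_patterns {E : Set Sample} (hE : E ∈ patterns q ρ A Z) :
    MeasurableSet E := by
  obtain ⟨B, F, I, hB, -, -, -, hI, rfl⟩ := hE
  refine (measurableSet_void hB).inter ?_
  exact (MeasurableSet.pi (Finset.countable_toSet _) fun z _ => hI z).preimage (by fun_prop)

theorem observed_le : observed q ρ A Z ≤ inferInstanceAs (MeasurableSpace Sample) :=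
  MeasurableSpace.generateFrom_le fun _ h => measurableSet_of_mem_patterns h

theorem observed_mono (hA : A ⊆ A') (hZ : Z ⊆ Z') : observed q ρ A Z ≤ observed q ρ A' Z' := by
  refine MeasurableSpace.generateFrom_mono ?_
  rintro _ ⟨B, F, I, hB, hBA, hfin, hF, hI, rfl⟩
  exact ⟨B, F, I, hB, hBA.trans hA, hfin, hF.trans hZ, hI, rfl⟩

theorem measurableSet_observed_void {B : Set (ℤ → ℤ)} (hB : MeasurableSet B) (hBA : B ⊆ A)
    (hfin : intensity q ρ B ≠ ∞) : MeasurableSet[observed q ρ A Z] (void B) :=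
  MeasurableSpace.measurableSet_generateFrom
    ⟨B, ∅, fun _ => Set.univ, hB, hBA, hfin, by simp, fun _ => .univ, by simp⟩

theorem measurableSet_observed_uniform {z : ℤ × ℤ} (hz : z ∈ Z) {I : Set unitInterval}
    (hI : MeasurableSet I) : MeasurableSet[observed q ρ A Z] {s : Sample | s.2.2 z ∈ I} :=
  MeasurableSpace.measurableSet_generateFrom
    ⟨∅, {z}, fun _ => I, .empty, Set.empty_subset _, by simp, by simpa using hz, fun _ => hI,
      by simp [void_empty]⟩

section Law

variable [IsProbabilityMeasure (lazyStep q)]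

/-- The law of the variables `U`. -/
noncomputable abbrev uniformLaw : Measure (ℤ × ℤ → unitInterval) :=
  Measure.infinitePi fun _ : ℤ × ℤ => (volume : Measure unitInterval)

theorem law_void {B : Set (ℤ → ℤ)} (hB : MeasurableSet B) (hfin : intensity q ρ B ≠ ∞) :
    law q ρ (void B) = ENNReal.ofReal (Real.exp (-(intensity q ρ B).toReal)) := by
  simpa using law_void_inter hB hfin (C := Set.univ) .univ

theorem law_uniform {C : Set (ℤ × ℤ → unitInterval)} (hC : MeasurableSet C) :
    law q ρ {s | s.2.2 ∈ C} = uniformLaw C := by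
  simpa [void_empty] using law_void_inter (q := q) (ρ := ρ) .empty (by simp) hC

/-- First-moment bound, from `1 - exp (-x) ≤ x`. -/
theorem law_void_compl_le {B : Set (ℤ → ℤ)} (hB : MeasurableSet B) :
    law q ρ (void B)ᶜ ≤ intensity q ρ B := by
  rcases eq_or_ne (intensity q ρ B) ∞ with h | h
  · simp [h]
  rw [prob_compl_eq_one_sub (measurableSet_void hB), law_void hB h, ← ENNReal.ofReal_one,
    ← ENNReal.ofReal_sub _ (by positivity)]
  refine ENNReal.ofReal_le_of_le_toReal ?_
  linarith [Real.add_one_le_exp (-(intensity q ρ B).toReal)]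

/-- The intensity is additive on disjoint sets of trajectories, so void probabilities multiply; the
variables `U` at disjoint points are independent. The patterns form a π-system, which suffices. -/
theorem indep_observed (hA : Disjoint A A') (hZ : Disjoint Z Z') :
    Indep (observed q ρ A Z) (observed q ρ A' Z') (law q ρ) := by
  classical
  refine IndepSets.indep' (fun _ h => measurableSet_of_mem_patterns h)
    (fun _ h => measurableSet_of_mem_patterns h) isPiSystem_patterns isPiSystem_patterns ?_
  rw [IndepSets_iff]
  rintro _ _ ⟨B, F, I, hB, hBA, hfin, hF, hI, rfl⟩ ⟨B', F', I', hB', hBA', hfin', hF', hI', rfl⟩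
  have hmF : MeasurableSet ((F : Set (ℤ × ℤ)).pi I) :=
    MeasurableSet.pi (Finset.countable_toSet _) fun z _ => hI z
  have hmF' : MeasurableSet ((F' : Set (ℤ × ℤ)).pi I') :=
    MeasurableSet.pi (Finset.countable_toSet _) fun z _ => hI' z
  have hd : Disjoint B B' := hA.mono hBA hBA'
  have hdF : Disjoint F F' := by
    rw [← Finset.disjoint_coe]; exact hZ.mono hF hF'
  have hmu : intensity q ρ (B ∪ B') = intensity q ρ B + intensity q ρ B' :=
    measure_union hd hB'
  have h1 : (void B ∩ {s : Sample | s.2.2 ∈ (F : Set (ℤ × ℤ)).pi I}) ∩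
      (void B' ∩ {s | s.2.2 ∈ (F' : Set (ℤ × ℤ)).pi I'}) =
      void (B ∪ B') ∩ {s | s.2.2 ∈ (F : Set (ℤ × ℤ)).pi I ∩ (F' : Set (ℤ × ℤ)).pi I'} := by
    rw [void_union]
    ext s
    simp only [Set.mem_inter_iff, Set.mem_ofPred_eq]
    tauto
  rw [h1, law_void_inter (hB.union hB') (by rw [hmu]; exact ENNReal.add_ne_top.2 ⟨hfin, hfin'⟩)
    (hmF.inter hmF'), law_void_inter hB hfin hmF, law_void_inter hB' hfin' hmF', hmu,
    ENNReal.toReal_add hfin hfin', neg_add, Real.exp_add, ENNReal.ofReal_mul (by positivity)]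
  have h2 : uniformLaw ((F : Set (ℤ × ℤ)).pi I ∩ (F' : Set (ℤ × ℤ)).pi I') =
      uniformLaw ((F : Set (ℤ × ℤ)).pi I) * uniformLaw ((F' : Set (ℤ × ℤ)).pi I') := by
    rw [pi_inter_pi, Measure.infinitePi_pi, Measure.infinitePi_pi _ (fun i _ => hI i),
      Measure.infinitePi_pi _ (fun i _ => hI' i), Finset.prod_union hdF]
    · congr 1
      · refine Finset.prod_congr rfl fun z hz => ?_
        have : z ∉ F' := Finset.disjoint_left.1 hdF hz
        simp [hz, this]
      · refine Finset.prod_congr rfl fun z hz => ?_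
        have : z ∉ F := Finset.disjoint_right.1 hdF hz
        simp [hz, this]
    · intro z _
      refine .inter ?_ ?_
      · split_ifs
        · exact hI z
        · exact .univ
      · split_ifs
        · exact hI' z
        · exact .univ
  rw [uniformLaw] at h2
  rw [h2]
  ring

theorem generateFrom_forall_mem_finset (ι : Type*) :
    MeasurableSpace.generateFrom {S : Set (ι → Prop) | ∃ F : Finset ι, S = {e | ∀ i ∈ F, e i}} =
      MeasurableSpace.pi := by
  refine le_antisymm (MeasurableSpace.generateFrom_le ?_) ?_
  · rintro _ ⟨F, rfl⟩
    have : {e : ι → Prop | ∀ i ∈ F, e i} = ⋂ i ∈ F, {e | e i} := by ext; simp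
    rw [this]
    exact Finset.measurableSet_biInter _ fun i _ => measurableSet_setOfPred.2 (measurable_pi_apply i)
  · refine iSup_le fun i => ?_
    rw [← measurable_iff_comap_le]
    refine @measurable_to_prop _ (MeasurableSpace.generateFrom _) _ ?_
    refine MeasurableSpace.measurableSet_generateFrom ⟨{i}, ?_⟩
    ext e
    simp

/-- The joint law of a family of void indicators and of the variables `U` is determined by the
intensities of the finite unions of the sets in the family. -/
theorem map_void_uniform_eq {ι : Type*} [Countable ι] {B B' : ι → Set (ℤ → ℤ)}
    (hB : ∀ i, MeasurableSet (B i)) (hB' : ∀ i, MeasurableSet (B' i))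
    (hfin : ∀ i, intensity q ρ (B i) ≠ ∞)
    (h : ∀ F : Finset ι, intensity q ρ (⋃ i ∈ F, B i) = intensity q ρ (⋃ i ∈ F, B' i))
    (a : ℤ × ℤ) :
    (law q ρ).map (fun s => ((fun i => s ∈ void (B i) : ι → Prop), s.2.2)) =
      (law q ρ).map (fun s => ((fun i => s ∈ void (B' i) : ι → Prop), fun z => s.2.2 (z + a))) := by
  have hm : ∀ {B : ι → Set (ℤ → ℤ)}, (∀ i, MeasurableSet (B i)) →
      Measurable fun s : Sample => (fun i => s ∈ void (B i) : ι → Prop) := fun hB =>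
    measurable_pi_lambda _ fun i => measurableSet_setOfPred.1 (measurableSet_void (hB i))
  have hmU : Measurable fun (s : Sample) (z : ℤ × ℤ) => s.2.2 (z + a) := by fun_prop
  have hm1 : Measurable fun s : Sample => ((fun i => s ∈ void (B i) : ι → Prop), s.2.2) :=
    (hm hB).prodMk (by fun_prop)
  have hm2 : Measurable fun s : Sample =>
      ((fun i => s ∈ void (B' i) : ι → Prop), fun z => s.2.2 (z + a)) := (hm hB').prodMk hmU
  have hU : uniformLaw.map (fun (u : ℤ × ℤ → unitInterval) z => u (z + a)) = uniformLaw :=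
    Measure.map_infinitePi_infinitePi_of_inj
      (P := fun _ : ℤ × ℤ => (volume : Measure unitInterval)) (add_left_injective a)
  have := Measure.isProbabilityMeasure_map (μ := law q ρ) hm1.aemeasurable
  have hpi : IsPiSystem {S : Set (ι → Prop) | ∃ F : Finset ι, S = {e | ∀ i ∈ F, e i}} := by
    classical
    rintro _ ⟨F, rfl⟩ _ ⟨F', rfl⟩ -
    refine ⟨F ∪ F', ?_⟩
    ext e
    simp only [Set.mem_inter_iff, Set.mem_ofPred_eq, Finset.mem_union]
    grind
  -- An intersection of void events is the void event of the union, so the hypothesis on finite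
  -- unions fixes the law on a generating π-system.
  refine ext_of_generate_finite (Set.image2 (· ×ˢ ·)
    {S : Set (ι → Prop) | ∃ F : Finset ι, S = {e | ∀ i ∈ F, e i}}
    {T : Set (ℤ × ℤ → unitInterval) | MeasurableSet T}) ?_ ?_ ?_ ?_
  · refine (generateFrom_eq_prod (generateFrom_forall_mem_finset ι)
      MeasurableSpace.generateFrom_measurableSet ?_ ?_).symm
    · exact ⟨fun _ => Set.univ, fun _ => ⟨∅, by ext; simp⟩, Set.iUnion_const _⟩
    · exact isCountablySpanning_measurableSet
  · exact hpi.prod MeasurableSpace.isPiSystem_measurableSet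
  · rintro _ ⟨S, ⟨F, rfl⟩, T, hT, rfl⟩
    have hT' : MeasurableSet T := hT
    have hS : MeasurableSet {e : ι → Prop | ∀ i ∈ F, e i} := by
      rw [← generateFrom_forall_mem_finset]
      exact MeasurableSpace.measurableSet_generateFrom ⟨F, rfl⟩
    have key : ∀ {B : ι → Set (ℤ → ℤ)}, {s : Sample | ∀ i ∈ F, s ∈ void (B i)} =
        void (⋃ i ∈ F, B i) := by
      intro B
      ext s
      simp only [void, Set.mem_iUnion, Set.mem_ofPred_eq, not_exists]
      grind
    have hfinU : intensity q ρ (⋃ i ∈ F, B i) ≠ ∞ :=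
      ((measure_biUnion_finset_le _ _).trans_lt
        (ENNReal.sum_lt_top.2 fun i _ => (hfin i).lt_top)).ne
    rw [Measure.map_apply hm1 (hS.prod hT'), Measure.map_apply hm2 (hS.prod hT')]
    have e1 : (fun s : Sample => ((fun i => s ∈ void (B i) : ι → Prop), s.2.2)) ⁻¹'
        ({e : ι → Prop | ∀ i ∈ F, e i} ×ˢ T) = void (⋃ i ∈ F, B i) ∩ {s | s.2.2 ∈ T} := by
      rw [← key]; rfl
    have e2 : (fun s : Sample => ((fun i => s ∈ void (B' i) : ι → Prop),
          fun z => s.2.2 (z + a))) ⁻¹' ({e : ι → Prop | ∀ i ∈ F, e i} ×ˢ T) =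
        void (⋃ i ∈ F, B' i) ∩
          {s | s.2.2 ∈ (fun (u : ℤ × ℤ → unitInterval) z => u (z + a)) ⁻¹' T} := by
      rw [← key]; rfl
    have hsh : Measurable fun (u : ℤ × ℤ → unitInterval) z => u (z + a) := by fun_prop
    rw [e1, e2, law_void_inter (Finset.measurableSet_biUnion _ fun i _ => hB i) hfinU hT',
      law_void_inter (Finset.measurableSet_biUnion _ fun i _ => hB' i) (h F ▸ hfinU)
        (hT'.preimage hsh), h F, ← Measure.map_apply hsh hT', hU]
  · rw [Measure.map_apply hm1 .univ, Measure.map_apply hm2 .univ]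
    simp

end Law

end Observed

/-! ### Walks driven by a field of directions -/

open Classical in
/-- The space-time walk from `y` that steps to the right exactly at the points where `d` holds. -/
noncomputable def walk (d : ℤ × ℤ → Prop) (y : ℤ × ℤ) : ℕ → ℤ × ℤ
  | 0 => y
  | n + 1 => if d (walk d y n) then walk d y n + (1, 1) else walk d y n + (-1, 1)

@[simp] theorem walk_zero (d : ℤ × ℤ → Prop) (y : ℤ × ℤ) : walk d y 0 = y := rfl

theorem walk_succ_of_pos {d : ℤ × ℤ → Prop} {y : ℤ × ℤ} {n : ℕ} (h : d (walk d y n)) :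
    walk d y (n + 1) = walk d y n + (1, 1) := by rw [walk, if_pos h]

theorem walk_succ_of_neg {d : ℤ × ℤ → Prop} {y : ℤ × ℤ} {n : ℕ} (h : ¬d (walk d y n)) :
    walk d y (n + 1) = walk d y n + (-1, 1) := by rw [walk, if_neg h]

theorem walk_succ_cases (d : ℤ × ℤ → Prop) (y : ℤ × ℤ) (n : ℕ) :
    walk d y (n + 1) = walk d y n + (1, 1) ∨ walk d y (n + 1) = walk d y n + (-1, 1) := by
  by_cases h : d (walk d y n)
  · exact Or.inl (walk_succ_of_pos h)
  · exact Or.inr (walk_succ_of_neg h)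

theorem walk_snd (d : ℤ × ℤ → Prop) (y : ℤ × ℤ) (n : ℕ) : (walk d y n).2 = y.2 + n := by
  induction n with
  | zero => simp
  | succ n ih =>
    rcases walk_succ_cases d y n with h | h <;> rw [h] <;> simp [ih] <;> ring

theorem abs_walk_fst_sub_le (d : ℤ × ℤ → Prop) (y : ℤ × ℤ) (n : ℕ) :
    |(walk d y n).1 - y.1| ≤ n := by
  induction n with
  | zero => simp
  | succ n ih =>
    rw [abs_le] at ih ⊢
    rcases walk_succ_cases d y n with h | h <;> rw [h] <;> simp only [Prod.fst_add] <;>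
      push_cast <;> omega

theorem walk_add (d : ℤ × ℤ → Prop) (y : ℤ × ℤ) (n m : ℕ) :
    walk d y (n + m) = walk d (walk d y n) m := by
  induction m with
  | zero => rfl
  | succ m ih => rw [← add_assoc, walk, walk, ih]

theorem walk_congr {d d' : ℤ × ℤ → Prop} {y : ℤ × ℤ} {n : ℕ}
    (h : ∀ m < n, d (walk d y m) ↔ d' (walk d y m)) : walk d' y n = walk d y n := by
  induction n with
  | zero => rfl
  | succ n ih =>
    have h1 := ih fun m hm => h m (by omega)
    have h2 := h n (by omega)
    by_cases h3 : d (walk d y n)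
    · rw [walk_succ_of_pos h3, walk_succ_of_pos (by rw [h1]; exact h2.1 h3), h1]
    · rw [walk_succ_of_neg h3, walk_succ_of_neg (by rw [h1]; exact fun h4 => h3 (h2.2 h4)), h1]

theorem walk_translate (d : ℤ × ℤ → Prop) (a y : ℤ × ℤ) (n : ℕ) :
    walk (fun z => d (z + a)) y n + a = walk d (y + a) n := by
  induction n with
  | zero => rfl
  | succ n ih =>
    by_cases h : d (walk d (y + a) n)
    · rw [walk_succ_of_pos h, walk_succ_of_pos (by rw [ih]; exact h), ← ih]
      abel
    · rw [walk_succ_of_neg h, walk_succ_of_neg (by rw [ih]; exact h), ← ih]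
      abel

theorem walk_eq_of_forall_lt {d : ℤ × ℤ → Prop} {y : ℤ × ℤ} {n : ℕ}
    (h : ∀ l < n, d (y + ((l : ℤ), (l : ℤ)))) : walk d y n = y + ((n : ℤ), (n : ℤ)) := by
  induction n with
  | zero => simp
  | succ n ih =>
    have h1 := ih fun l hl => h l (by omega)
    rw [walk_succ_of_pos (by rw [h1]; exact h n (by omega)), h1]
    ext <;> simp <;> ring

theorem measurable_walk {Ω : Type*} [MeasurableSpace Ω] {d : Ω → ℤ × ℤ → Prop}
    (hd : ∀ z, MeasurableSet {ω | d ω z}) (y : ℤ × ℤ) (n : ℕ) :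
    Measurable fun ω => walk (d ω) y n := by
  induction n with
  | zero => exact measurable_const
  | succ n ih =>
    refine measurable_to_countable' fun z => ?_
    have : (fun ω => walk (d ω) y (n + 1)) ⁻¹' {z} =
        ((fun ω => walk (d ω) y n) ⁻¹' {z - (1, 1)} ∩ {ω | d ω (z - (1, 1))}) ∪
        ((fun ω => walk (d ω) y n) ⁻¹' {z - (-1, 1)} ∩ {ω | d ω (z - (-1, 1))}ᶜ) := by
      ext ω
      simp only [Set.mem_preimage, Set.mem_singleton_iff, Set.mem_union, Set.mem_inter_iff,
        Set.mem_ofPred_eq, Set.mem_compl_iff]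
      constructor
      · intro h
        by_cases h1 : d ω (walk (d ω) y n)
        · rw [walk_succ_of_pos h1] at h
          have h2 : walk (d ω) y n = z - (1, 1) := eq_sub_of_add_eq h
          exact Or.inl ⟨h2, h2 ▸ h1⟩
        · rw [walk_succ_of_neg h1] at h
          have h2 : walk (d ω) y n = z - (-1, 1) := eq_sub_of_add_eq h
          exact Or.inr ⟨h2, h2 ▸ h1⟩
      · rintro (⟨h1, h2⟩ | ⟨h1, h2⟩)
        · rw [walk_succ_of_pos (by rw [h1]; exact h2), h1, sub_add_cancel]
        · rw [walk_succ_of_neg (by rw [h1]; exact h2), h1, sub_add_cancel]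
    rw [this]
    exact ((ih (measurableSet_singleton _)).inter (hd _)).union
      ((ih (measurableSet_singleton _)).inter (hd _).compl)

/-! ### Levels and cones -/

/-- The level of a space-time point with respect to lines of slope `v`. -/
noncomputable def level (v : ℝ) (z : ℤ × ℤ) : ℝ := z.1 - v * z.2

/-- For `v ≥ 0` the quadrant condition on space follows from the other two, so a cone is an order
condition on time and level. Nesting of cones becomes transitivity. -/
theorem mem_cone_iff {v : ℝ} (hv : 0 ≤ v) {y z : ℤ × ℤ} :
    z ∈ cone v y ↔ y.2 ≤ z.2 ∧ level v y ≤ level v z := by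
  simp only [cone, level, Set.mem_ofPred_eq]
  constructor
  · rintro ⟨-, h2, h3⟩
    push_cast at h3
    exact ⟨by omega, by linarith⟩
  · rintro ⟨h2, h3⟩
    have h4 : (0 : ℝ) ≤ ((z.2 - y.2 : ℤ) : ℝ) := by exact_mod_cast sub_nonneg.2 h2
    have h5 : v * ((z.2 - y.2 : ℤ) : ℝ) ≤ ((z.1 - y.1 : ℤ) : ℝ) := by push_cast; linarith
    refine ⟨?_, by omega, h5⟩
    have : (0 : ℝ) ≤ ((z.1 - y.1 : ℤ) : ℝ) := le_trans (by positivity) h5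
    exact_mod_cast this

theorem mem_backCone_iff {v : ℝ} (hv : 0 ≤ v) {y z : ℤ × ℤ} :
    z ∈ backCone v y ↔ z.2 ≤ y.2 ∧ level v z < level v y := by
  simp only [backCone, level, Set.mem_ofPred_eq]
  constructor
  · rintro ⟨-, h2, h3⟩
    push_cast at h3
    exact ⟨by omega, by linarith⟩
  · rintro ⟨h2, h3⟩
    have h4 : ((z.2 - y.2 : ℤ) : ℝ) ≤ 0 := by exact_mod_cast sub_nonpos.2 h2
    have h5 : ((z.1 - y.1 : ℤ) : ℝ) < v * ((z.2 - y.2 : ℤ) : ℝ) := by push_cast; linarith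
    refine ⟨?_, by omega, h5⟩
    have : ((z.1 - y.1 : ℤ) : ℝ) < 0 := lt_of_lt_of_le h5 (mul_nonpos_of_nonneg_of_nonpos hv h4)
    exact_mod_cast this.le

theorem level_add (v : ℝ) (y z : ℤ × ℤ) : level v (y + z) = level v y + level v z := by
  simp only [level, Prod.fst_add, Prod.snd_add]
  push_cast
  ring

theorem level_diag (v : ℝ) (l : ℕ) : level v ((l : ℤ), (l : ℤ)) = (1 - v) * l := by
  simp only [level]
  push_cast
  ring

theorem level_walk_succ_le (v : ℝ) (d : ℤ × ℤ → Prop) (y : ℤ × ℤ) (n : ℕ) :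
    level v (walk d y (n + 1)) ≤ level v (walk d y n) + (1 - v) := by
  rcases walk_succ_cases d y n with h | h <;> rw [h, level_add] <;> simp [level]

theorem level_walk_add_le (v : ℝ) (d : ℤ × ℤ → Prop) (y : ℤ × ℤ) (n m : ℕ) :
    level v (walk d y (n + m)) ≤ level v (walk d y n) + (1 - v) * m := by
  induction m with
  | zero => simp
  | succ m ih =>
    have := level_walk_succ_le v d y (n + m)
    rw [← add_assoc]
    push_cast
    linarith

theorem cone_translate (v : ℝ) (a y z : ℤ × ℤ) : z + a ∈ cone v (y + a) ↔ z ∈ cone v y := by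
  simp [cone]

theorem backCone_translate (v : ℝ) (a y z : ℤ × ℤ) :
    z + a ∈ backCone v (y + a) ↔ z ∈ backCone v y := by
  simp [backCone]

theorem cone_subset {v : ℝ} (hv : 0 ≤ v) {y z : ℤ × ℤ} (h : z ∈ cone v y) :
    cone v z ⊆ cone v y := by
  intro w hw
  rw [mem_cone_iff hv] at *
  exact ⟨h.1.trans hw.1, h.2.trans hw.2⟩

theorem backCone_subset {v : ℝ} (hv : 0 ≤ v) {y z : ℤ × ℤ} (h : z ∈ cone v y) :
    backCone v y ⊆ backCone v z := by
  intro w hw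
  rw [mem_cone_iff hv] at h
  rw [mem_backCone_iff hv] at *
  exact ⟨hw.1.trans h.1, hw.2.trans_le h.2⟩

theorem backCone_subset_of_mem {v : ℝ} (hv : 0 ≤ v) {y z : ℤ × ℤ} (h : z ∈ backCone v y) :
    backCone v z ⊆ backCone v y := by
  intro w hw
  rw [mem_backCone_iff hv] at *
  exact ⟨hw.1.trans h.1, hw.2.trans h.2⟩

theorem disjoint_cone_backCone {v : ℝ} (hv : 0 ≤ v) (y : ℤ × ℤ) :
    Disjoint (cone v y) (backCone v y) := by
  rw [Set.disjoint_left]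
  intro z h1 h2
  rw [mem_cone_iff hv] at h1
  rw [mem_backCone_iff hv] at h2
  linarith [h1.2, h2.2]

theorem diag_mem_cone {v : ℝ} (hv : 0 ≤ v) (hv1 : v ≤ 1) (y : ℤ × ℤ) (l : ℕ) :
    y + ((l : ℤ), (l : ℤ)) ∈ cone v y := by
  rw [mem_cone_iff hv, level_add, level_diag]
  have : (0 : ℝ) ≤ (1 - v) * l := mul_nonneg (by linarith) (by positivity)
  exact ⟨by simp, by linarith⟩

/-! ### Sets of trajectories -/

/-- The trajectories through a given space-time point. -/
def through (z : ℤ × ℤ) : Set (ℤ → ℤ) := {w | w z.2 = z.1}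

/-- The trajectories that meet a given set of space-time points. -/
def meeting (D : Set (ℤ × ℤ)) : Set (ℤ → ℤ) := {w | ∃ n : ℤ, (w n, n) ∈ D}

/-- The trajectories that meet the backward cone at `y` and the cone at `z`. -/
def link (v : ℝ) (y z : ℤ × ℤ) : Set (ℤ → ℤ) := meeting (backCone v y) ∩ meeting (cone v z)

theorem measurableSet_through (z : ℤ × ℤ) : MeasurableSet (through z) :=
  measurableSet_eq_fun (measurable_pi_apply z.2) measurable_const

theorem measurableSet_meeting (D : Set (ℤ × ℤ)) : MeasurableSet (meeting D) := by
  have : meeting D = ⋃ n : ℤ, (fun w : ℤ → ℤ => w n) ⁻¹' {x | (x, n) ∈ D} := by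
    ext; simp [meeting]
  rw [this]
  exact .iUnion fun n => (measurable_pi_apply n) (.of_discrete)

theorem measurableSet_link (v : ℝ) (y z : ℤ × ℤ) : MeasurableSet (link v y z) :=
  (measurableSet_meeting _).inter (measurableSet_meeting _)

theorem meeting_mono {D D' : Set (ℤ × ℤ)} (h : D ⊆ D') : meeting D ⊆ meeting D' :=
  fun _ ⟨n, hn⟩ => ⟨n, h hn⟩

theorem through_subset_meeting {D : Set (ℤ × ℤ)} {z : ℤ × ℤ} (hz : z ∈ D) :
    through z ⊆ meeting D := by
  intro w hw
  refine ⟨z.2, ?_⟩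
  rw [through, Set.mem_ofPred_eq] at hw
  rwa [hw]

theorem link_subset_steep {v : ℝ} (hv : 0 ≤ v) {y z : ℤ × ℤ} (h : y.2 ≤ z.2) :
    link v y z ⊆ steep v y.2 (level v y) (level v z - level v y) := by
  rintro w ⟨⟨n, hn⟩, n', hn'⟩
  rw [mem_backCone_iff hv] at hn
  rw [mem_cone_iff hv] at hn'
  refine ⟨⟨n, hn.1, hn.2⟩, n', h.trans hn'.1, ?_⟩
  rw [add_sub_cancel]
  exact hn'.2

/-- Dropping the nearest-neighbour condition enlarges the set of forbidden trajectories.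
Regeneration defined through `link` is thus stronger than the one of the statement, which is enough
both for positivity and for upper bounds on the regeneration time. -/
theorem crossing_subset_link (v : ℝ) (y : ℤ × ℤ) : crossing v y ⊆ link v y y :=
  fun _ ⟨_, h1, h2⟩ => ⟨h2, h1⟩

theorem omega_eq_zero_iff {s : Sample} {A : Set (ℤ → ℤ)} : omega s A = 0 ↔ s ∈ void A := by
  simp only [omega, Set.encard_eq_zero, Set.eq_empty_iff_forall_notMem, void, Set.mem_ofPred_eq,
    Prod.forall, not_and]

theorem mem_trace_iff {s : Sample} {z : ℤ × ℤ} : z ∈ trace s ↔ s ∉ void (through z) := by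
  simp only [trace, void, through, Set.mem_ofPred_eq]
  push Not
  rfl

/-! ### Directions seen by the walk -/

/-- The direction at `z` when only particles with trajectory in `A` are taken into account. Outside
of `Z` the direction is left. -/
def dirOn (p₀ p₁ : ℝ) (A : Set (ℤ → ℤ)) (Z : Set (ℤ × ℤ)) (s : Sample) (z : ℤ × ℤ) : Prop :=
  z ∈ Z ∧ ((s ∉ void (through z ∩ A) ∧ (s.2.2 z : ℝ) ≤ p₁) ∨
    (s ∈ void (through z ∩ A) ∧ (s.2.2 z : ℝ) ≤ p₀))

/-- The direction of the walk at `z`. -/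
def dir (p₀ p₁ : ℝ) (s : Sample) : ℤ × ℤ → Prop := dirOn p₀ p₁ Set.univ Set.univ s

theorem Y_eq_walk (p₀ p₁ : ℝ) (s : Sample) (y : ℤ × ℤ) (n : ℕ) :
    Y p₀ p₁ s y n = walk (dir p₀ p₁ s) y n := by
  induction n with
  | zero => rfl
  | succ n ih =>
    rw [Y, walk, ih]
    congr 1
    simp [dir, dirOn, mem_trace_iff]

theorem dirOn_iff_dir {p₀ p₁ : ℝ} {A : Set (ℤ → ℤ)} {Z : Set (ℤ × ℤ)} {s : Sample} {z : ℤ × ℤ}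
    (hz : z ∈ Z) (h : s ∈ void (through z \ A)) : dirOn p₀ p₁ A Z s z ↔ dir p₀ p₁ s z := by
  have h1 : s ∈ void (through z) ↔ s ∈ void (through z ∩ A) := by
    conv_lhs => rw [← Set.inter_union_sdiff (through z) A, void_union]
    exact ⟨fun h => h.1, fun h' => ⟨h', h⟩⟩
  simp [dirOn, dir, hz, h1]

/-- Below both thresholds the variable `U` decides alone, whatever the environment; this is how
steps are forced independently of the particles. -/
theorem dir_of_le {p₀ p₁ : ℝ} {s : Sample} {z : ℤ × ℤ} (h : (s.2.2 z : ℝ) ≤ min p₀ p₁) :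
    dir p₀ p₁ s z := by
  have := h.trans (min_le_left _ _)
  have := h.trans (min_le_right _ _)
  simp only [dir, dirOn]
  tauto

section Law

variable {q : ℝ} [IsProbabilityMeasure (lazyStep q)] {ρ : ℝ≥0}

/-- By translation the point may be taken to be the origin, where only the walk started at the site
`0` contributes. -/
theorem intensity_through (z : ℤ × ℤ) : intensity q ρ (through z) ≠ ∞ := by
  have h1 : through z = {w | (fun n => w (n + z.2) + (-z.1)) ∈ through (0, 0)} := by
    ext w
    simp [through]
    omega
  rw [h1, intensity_shift _ _ (measurableSet_through _), intensity_apply _ _ (measurableSet_through _)]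
  refine ENNReal.mul_ne_top ENNReal.coe_ne_top ?_
  rw [tsum_eq_single 0]
  · exact measure_ne_top _ _
  · intro x hx
    simp [through, walkPath_zero, hx]

theorem exists_intensity_link_le (h0 : 0 ≤ q) (h1 : q ≤ 1) {v : ℝ} (hv : 0 < v) (ρ : ℝ≥0) :
    ∃ C : ℝ, 0 < C ∧ ∀ y z : ℤ × ℤ, y.2 ≤ z.2 →
      intensity q ρ (link v y z) ≤
        ENNReal.ofReal (C * Real.exp (-(v * (level v z - level v y) / 2))) := by
  obtain ⟨C, hC, h⟩ := exists_intensity_steep_le h0 h1 hv ρ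
  exact ⟨C, hC, fun y z hyz => (measure_mono (link_subset_steep hv.le hyz)).trans (h _ _ _)⟩

theorem intensity_link (h0 : 0 ≤ q) (h1 : q ≤ 1) {v : ℝ} (hv : 0 < v) {y z : ℤ × ℤ}
    (hyz : y.2 ≤ z.2) : intensity q ρ (link v y z) ≠ ∞ := by
  obtain ⟨C, -, h⟩ := exists_intensity_link_le h0 h1 hv ρ
  exact ((h y z hyz).trans_lt ENNReal.ofReal_lt_top).ne

theorem measurableSet_dirOn (p₀ p₁ : ℝ) {A : Set (ℤ → ℤ)} (hA : MeasurableSet A)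
    (Z : Set (ℤ × ℤ)) (z : ℤ × ℤ) :
    MeasurableSet[observed q ρ A Z] {s | dirOn p₀ p₁ A Z s z} := by
  by_cases hz : z ∈ Z
  · have hV : MeasurableSet[observed q ρ A Z] (void (through z ∩ A)) :=
      measurableSet_observed_void ((measurableSet_through z).inter hA) Set.inter_subset_right
        (((measure_mono Set.inter_subset_left).trans_lt (intensity_through z).lt_top).ne)
    have hU : ∀ p : ℝ, MeasurableSet[observed q ρ A Z] {s : Sample | (s.2.2 z : ℝ) ≤ p} :=
      fun p => measurableSet_observed_uniform (I := {x | (x : ℝ) ≤ p}) hz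
        (measurableSet_le measurable_subtype_coe measurable_const)
    have : {s | dirOn p₀ p₁ A Z s z} =
        ((void (through z ∩ A))ᶜ ∩ {s : Sample | (s.2.2 z : ℝ) ≤ p₁}) ∪
        (void (through z ∩ A) ∩ {s : Sample | (s.2.2 z : ℝ) ≤ p₀}) := by
      ext s
      simp [dirOn, hz]
    rw [this]
    exact @MeasurableSet.union _ (observed q ρ A Z) _ _
      (@MeasurableSet.inter _ (observed q ρ A Z) _ _ (@MeasurableSet.compl _ _ (observed q ρ A Z) hV) (hU p₁))
      (@MeasurableSet.inter _ (observed q ρ A Z) _ _ hV (hU p₀))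
  · have : {s | dirOn p₀ p₁ A Z s z} = ∅ := by
      ext s
      simp [dirOn, hz]
    rw [this]
    exact @MeasurableSet.empty _ (observed q ρ A Z)

theorem measurable_walk_dirOn (p₀ p₁ : ℝ) {A : Set (ℤ → ℤ)} (hA : MeasurableSet A)
    (Z : Set (ℤ × ℤ)) (y : ℤ × ℤ) (n : ℕ) :
    Measurable[observed q ρ A Z] fun s => walk (dirOn p₀ p₁ A Z s) y n :=
  @measurable_walk _ (observed q ρ A Z) _ (measurableSet_dirOn p₀ p₁ hA Z) y n

/-- The joint law of the directions and of the absence of crossing particles is invariant under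
space-time translations. -/
theorem law_shift (h0 : 0 ≤ q) (h1 : q ≤ 1) {v : ℝ} (hv : 0 < v) (p₀ p₁ : ℝ) (a : ℤ × ℤ)
    {S : Set ((ℤ × ℤ → Prop) × (ℤ × ℤ → Prop))} (hS : MeasurableSet S) :
    law q ρ {s | (dir p₀ p₁ s, fun y => s ∈ void (link v y y)) ∈ S} =
      law q ρ {s | (fun z => dir p₀ p₁ s (z + a), fun y => s ∈ void (link v (y + a) (y + a))) ∈ S} := by
  set B : (ℤ × ℤ) ⊕ (ℤ × ℤ) → Set (ℤ → ℤ) := Sum.elim through fun y => link v y y with hBdef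
  set B' : (ℤ × ℤ) ⊕ (ℤ × ℤ) → Set (ℤ → ℤ) :=
    Sum.elim (fun z => through (z + a)) fun y => link v (y + a) (y + a) with hBdef'
  have hB : ∀ i, MeasurableSet (B i) := by
    rintro (z | y)
    · exact measurableSet_through z
    · exact measurableSet_link v y y
  have hB' : ∀ i, MeasurableSet (B' i) := by
    rintro (z | y)
    · exact measurableSet_through _
    · exact measurableSet_link v _ _
  have hfin : ∀ i, intensity q ρ (B i) ≠ ∞ := by
    rintro (z | y)
    · exact intensity_through z
    · exact intensity_link h0 h1 hv le_rfl
  have hpre : ∀ i, B' i = {w | (fun n => w (n + a.2) + (-a.1)) ∈ B i} := by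
    rintro (z | y)
    · ext w
      simp only [hBdef, hBdef', Sum.elim_inl, through, Set.mem_ofPred_eq, Prod.fst_add, Prod.snd_add]
      omega
    · have hm : ∀ (f : ℤ × ℤ → Set (ℤ × ℤ)), (∀ y z, z + a ∈ f (y + a) ↔ z ∈ f y) → ∀ w : ℤ → ℤ,
          w ∈ meeting (f (y + a)) ↔ (fun n => w (n + a.2) + (-a.1)) ∈ meeting (f y) := by
        intro f hf w
        simp only [meeting, Set.mem_ofPred_eq]
        constructor
        · rintro ⟨n, hn⟩
          refine ⟨n - a.2, (hf _ _).1 ?_⟩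
          convert! hn using 1
          ext <;> simp
        · rintro ⟨n, hn⟩
          refine ⟨n + a.2, ?_⟩
          convert! (hf _ _).2 hn using 1
          ext <;> simp
      ext w
      exact and_congr (hm _ (backCone_translate v a) w) (hm _ (cone_translate v a) w)
  have hmain := map_void_uniform_eq (q := q) (ρ := ρ) hB hB' hfin (fun F => by
    have : (⋃ i ∈ F, B' i) = {w | (fun n => w (n + a.2) + (-a.1)) ∈ ⋃ i ∈ F, B i} := by
      ext w
      simp [hpre]
    rw [this, intensity_shift _ _ (Finset.measurableSet_biUnion _ fun i _ => hB i)]) a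
  set g : ((ℤ × ℤ) ⊕ (ℤ × ℤ) → Prop) × (ℤ × ℤ → unitInterval) →
      (ℤ × ℤ → Prop) × (ℤ × ℤ → Prop) := fun e =>
    (fun z => (¬e.1 (Sum.inl z) ∧ (e.2 z : ℝ) ≤ p₁) ∨ (e.1 (Sum.inl z) ∧ (e.2 z : ℝ) ≤ p₀),
      fun y => e.1 (Sum.inr y)) with hg
  have hgm : Measurable g := by
    refine Measurable.prodMk (measurable_pi_lambda _ fun z => ?_)
      (measurable_pi_lambda _ fun y => by fun_prop)
    have e1 : Measurable fun e : ((ℤ × ℤ) ⊕ (ℤ × ℤ) → Prop) × (ℤ × ℤ → unitInterval) =>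
      e.1 (Sum.inl z) := by fun_prop
    have e2 : ∀ p : ℝ, MeasurableSet {e : ((ℤ × ℤ) ⊕ (ℤ × ℤ) → Prop) × (ℤ × ℤ → unitInterval) |
      (e.2 z : ℝ) ≤ p} := fun p => measurableSet_le (by fun_prop) measurable_const
    refine measurableSet_setOfPred.1 ?_
    have e3 := measurableSet_setOfPred.2 e1
    exact (e3.compl.inter (e2 p₁)).union (e3.inter (e2 p₀))
  have hm : ∀ {B : (ℤ × ℤ) ⊕ (ℤ × ℤ) → Set (ℤ → ℤ)}, (∀ i, MeasurableSet (B i)) →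
      Measurable fun s : Sample => (fun i => s ∈ void (B i) : (ℤ × ℤ) ⊕ (ℤ × ℤ) → Prop) := fun hB =>
    measurable_pi_lambda _ fun i => measurableSet_setOfPred.1 (measurableSet_void (hB i))
  have hmU : Measurable fun (s : Sample) (z : ℤ × ℤ) => s.2.2 (z + a) := by fun_prop
  have h2 := congrArg (fun μ => μ (g ⁻¹' S)) hmain
  rw [Measure.map_apply ((hm hB).prodMk (by fun_prop)) (hgm hS),
    Measure.map_apply ((hm hB').prodMk hmU) (hgm hS)] at h2
  convert! h2 using 2
  · ext s
    have hd : dir p₀ p₁ s = fun z => (s ∉ void (through z) ∧ (s.2.2 z : ℝ) ≤ p₁) ∨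
        (s ∈ void (through z) ∧ (s.2.2 z : ℝ) ≤ p₀) := by
      funext z; simp [dir, dirOn]
    simp [hg, hd, hBdef]
  · ext s
    simp [hg, dir, dirOn, hBdef']

end Law

/-! ### Regeneration, fresh regeneration, and positivity at the origin -/

/-- The walk from `y` stays in the cone at `y`, and no particle links the backward cone at `y` to
the cone at `y`. -/
def regen (p₀ p₁ v : ℝ) (y : ℤ × ℤ) : Set Sample :=
  void (link v y y) ∩ {s | ∀ i, walk (dir p₀ p₁ s) y i ∈ cone v y}

theorem regenerates_of_mem_regen {p₀ p₁ v : ℝ} {y : ℤ × ℤ} {s : Sample}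
    (h : s ∈ regen p₀ p₁ v y) : Regenerates p₀ p₁ v s y := by
  refine ⟨omega_eq_zero_iff.2 (void_anti (crossing_subset_link v y) h.1), fun i => ?_⟩
  rw [Y_eq_walk]
  exact h.2 i

/-- The walk from `y` lags behind speed `vstar` by more than `L`. -/
def lagging (p₀ p₁ vstar : ℝ) (L : ℕ) (y : ℤ × ℤ) : Set Sample :=
  {s | ∃ n : ℕ, 1 ≤ n ∧ ((walk (dir p₀ p₁ s) y n).1 : ℝ) - y.1 < n * vstar - L}

/-- The variables `U` make the walk step to the right at the `K` first points of the diagonal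
at `y`. -/
def diagonal (p₀ p₁ : ℝ) (K : ℕ) (y : ℤ × ℤ) : Set Sample :=
  {s | ∀ l < K, (s.2.2 (y + ((l : ℤ), (l : ℤ))) : ℝ) ≤ min p₀ p₁}

/-- The version of `regen` at `y + (K, K)` that ignores the particles which meet the backward cone
at `y`. -/
def freshRegen (p₀ p₁ v : ℝ) (K : ℕ) (y : ℤ × ℤ) : Set Sample :=
  void (link v (y + ((K : ℤ), (K : ℤ))) (y + ((K : ℤ), (K : ℤ))) \ meeting (backCone v y)) ∩
    {s | ∀ i, walk (dirOn p₀ p₁ (meeting (backCone v y))ᶜ (cone v (y + ((K : ℤ), (K : ℤ)))) s)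
      (y + ((K : ℤ), (K : ℤ))) i ∈ cone v (y + ((K : ℤ), (K : ℤ)))}

/-- Probability that a uniform variable forces a step to the right. -/
noncomputable def forceProb (p₀ p₁ : ℝ) : ℝ≥0∞ :=
  (volume : Measure unitInterval) {u | (u : ℝ) ≤ min p₀ p₁}

theorem measurableSet_force (p₀ p₁ : ℝ) :
    MeasurableSet {u : unitInterval | (u : ℝ) ≤ min p₀ p₁} :=
  measurableSet_le measurable_subtype_coe measurable_const

theorem forceProb_eq {p₀ p₁ : ℝ} (h0 : 0 ≤ min p₀ p₁) (h1 : min p₀ p₁ ≤ 1) :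
    forceProb p₀ p₁ = ENNReal.ofReal (min p₀ p₁) := by
  have : {u : unitInterval | (u : ℝ) ≤ min p₀ p₁} = Set.Iic ⟨min p₀ p₁, h0, h1⟩ := by
    ext u; simp [← Subtype.coe_le_coe]
  rw [forceProb, this, unitInterval.volume_Iic]

theorem diagonal_walk {p₀ p₁ : ℝ} {K : ℕ} {y : ℤ × ℤ} {s : Sample} (h : s ∈ diagonal p₀ p₁ K y)
    {l : ℕ} (hl : l ≤ K) : walk (dir p₀ p₁ s) y l = y + ((l : ℤ), (l : ℤ)) :=
  walk_eq_of_forall_lt fun m hm => dir_of_le (h m (by omega))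

/-- Under `regen` the ignored particles never reach the cone at `y + (K, K)`: one that did would
also meet the backward cone there. So ignoring them changes nothing, and fresh regeneration is at
least as likely as regeneration. -/
theorem regen_subset_freshRegen {p₀ p₁ v : ℝ} (hv : 0 ≤ v) (hv1 : v ≤ 1) (K : ℕ) (y : ℤ × ℤ) :
    regen p₀ p₁ v (y + ((K : ℤ), (K : ℤ))) ⊆ freshRegen p₀ p₁ v K y := by
  rintro s ⟨h1, h2⟩
  refine ⟨void_anti Set.sdiff_subset h1, fun i => ?_⟩
  rw [walk_congr (d := dir p₀ p₁ s)]
  · exact h2 i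
  · intro m _
    refine (dirOn_iff_dir (h2 m) (void_anti ?_ h1)).symm
    rw [sdiff_compl]
    rintro w ⟨hw1, hw2⟩
    exact ⟨meeting_mono (backCone_subset hv (diag_mem_cone hv hv1 y K)) hw2,
      through_subset_meeting (h2 m) hw1⟩

/-- Without links, the particles that were ignored do not enter the cone, hence neither cross nor
affect the walk as long as it stays there. -/
theorem freshRegen_inter_subset_regen {p₀ p₁ v : ℝ} (K : ℕ)
    (y : ℤ × ℤ) : freshRegen p₀ p₁ v K y ∩ void (link v y (y + ((K : ℤ), (K : ℤ)))) ⊆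
      regen p₀ p₁ v (y + ((K : ℤ), (K : ℤ))) := by
  rintro s ⟨⟨h1, h2⟩, h3⟩
  refine ⟨?_, fun i => ?_⟩
  · refine void_anti (B' := (link v (y + ((K : ℤ), (K : ℤ))) (y + ((K : ℤ), (K : ℤ))) \
      meeting (backCone v y)) ∪ link v y (y + ((K : ℤ), (K : ℤ)))) ?_ ?_
    · intro w hw
      by_cases hb : w ∈ meeting (backCone v y)
      · exact Or.inr ⟨hb, hw.2⟩
      · exact Or.inl ⟨hw, hb⟩
    · rw [void_union]
      exact ⟨h1, h3⟩
  · have : walk (dir p₀ p₁ s) (y + ((K : ℤ), (K : ℤ))) i = walk (dirOn p₀ p₁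
        (meeting (backCone v y))ᶜ (cone v (y + ((K : ℤ), (K : ℤ)))) s)
        (y + ((K : ℤ), (K : ℤ))) i := by
      refine walk_congr fun m _ => dirOn_iff_dir (h2 m) (void_anti ?_ h3)
      rw [sdiff_compl]
      rintro w ⟨hw1, hw2⟩
      exact ⟨hw2, through_subset_meeting (h2 m) hw1⟩
    rw [Set.mem_ofPred_eq] at *
    rw [this]
    exact h2 i

theorem measurableSet_diagonal {q : ℝ} {ρ : ℝ≥0} (p₀ p₁ : ℝ) {K : ℕ} {y : ℤ × ℤ} {A : Set (ℤ → ℤ)} {Z : Set (ℤ × ℤ)}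
    (h : ∀ l < K, y + ((l : ℤ), (l : ℤ)) ∈ Z) :
    MeasurableSet[observed q ρ A Z] (diagonal p₀ p₁ K y) := by
  have : diagonal p₀ p₁ K y = ⋂ l : ℕ, ⋂ _ : l < K,
      {s : Sample | s.2.2 (y + ((l : ℤ), (l : ℤ))) ∈ {u : unitInterval | (u : ℝ) ≤ min p₀ p₁}} := by
    ext; simp [diagonal]
  rw [this]
  exact MeasurableSet.iInter fun l => MeasurableSet.iInter fun hl =>
    measurableSet_observed_uniform (h l hl) (measurableSet_force p₀ p₁)

section Law

variable {q : ℝ} [IsProbabilityMeasure (lazyStep q)] {ρ : ℝ≥0}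

/-- Ballisticity is assumed for the walk from the origin only; this transfers it to every starting
point. -/
theorem law_lagging (h0 : 0 ≤ q) (h1 : q ≤ 1) (p₀ p₁ vstar : ℝ) (L : ℕ) (y : ℤ × ℤ) :
    law q ρ (lagging p₀ p₁ vstar L y) = law q ρ (lagging p₀ p₁ vstar L (0, 0)) := by
  have hS : MeasurableSet {e : (ℤ × ℤ → Prop) × (ℤ × ℤ → Prop) |
      ∃ n : ℕ, 1 ≤ n ∧ ((walk e.1 (0, 0) n).1 : ℝ) < n * vstar - L} := by
    have : {e : (ℤ × ℤ → Prop) × (ℤ × ℤ → Prop) |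
        ∃ n : ℕ, 1 ≤ n ∧ ((walk e.1 (0, 0) n).1 : ℝ) < n * vstar - L} =
        ⋃ n : ℕ, ⋃ _ : 1 ≤ n, (fun e => walk e.1 (0, 0) n) ⁻¹'
          {z | ((z.1 : ℤ) : ℝ) < n * vstar - L} := by
      ext; simp
    rw [this]
    refine .iUnion fun n => .iUnion fun _ => ?_
    exact measurable_walk (d := fun e : (ℤ × ℤ → Prop) × (ℤ × ℤ → Prop) => e.1)
      (fun z => measurableSet_setOfPred.2 (by fun_prop)) _ _ .of_discrete
  have h := law_shift (ρ := ρ) h0 h1 one_pos p₀ p₁ y hS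
  convert! h.symm using 2
  · ext s
    simp only [lagging, Set.mem_ofPred_eq]
    refine exists_congr fun n => and_congr_right fun _ => ?_
    have := walk_translate (dir p₀ p₁ s) y (0, 0) n
    rw [show ((0, 0) : ℤ × ℤ) + y = y from zero_add y] at this
    rw [← this]
    simp
  · ext s
    simp [lagging]

theorem law_regen (h0 : 0 ≤ q) (h1 : q ≤ 1) {v : ℝ} (hv : 0 < v) (p₀ p₁ : ℝ) (y : ℤ × ℤ) :
    law q ρ (regen p₀ p₁ v y) = law q ρ (regen p₀ p₁ v (0, 0)) := by
  have hS : MeasurableSet {e : (ℤ × ℤ → Prop) × (ℤ × ℤ → Prop) |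
      e.2 (0, 0) ∧ ∀ i, walk e.1 (0, 0) i ∈ cone v (0, 0)} := by
    have : {e : (ℤ × ℤ → Prop) × (ℤ × ℤ → Prop) |
        e.2 (0, 0) ∧ ∀ i, walk e.1 (0, 0) i ∈ cone v (0, 0)} =
        {e | e.2 (0, 0)} ∩ ⋂ i : ℕ, (fun e => walk e.1 (0, 0) i) ⁻¹' cone v (0, 0) := by
      ext; simp
    rw [this]
    refine .inter (measurableSet_setOfPred.2 (by fun_prop)) (.iInter fun n => ?_)
    exact measurable_walk (d := fun e : (ℤ × ℤ → Prop) × (ℤ × ℤ → Prop) => e.1)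
      (fun z => measurableSet_setOfPred.2 (by fun_prop)) _ _ .of_discrete
  have h := law_shift (ρ := ρ) h0 h1 hv p₀ p₁ y hS
  convert! h.symm using 2
  ext s
  have e : ((0, 0) : ℤ × ℤ) + y = y := zero_add y
  simp only [regen, Set.mem_ofPred_eq, Set.mem_inter_iff, e]
  refine and_congr_right fun _ => forall_congr' fun n => ?_
  have := walk_translate (dir p₀ p₁ s) y (0, 0) n
  rw [e] at this
  rw [← this]
  have h2 := cone_translate v y (0, 0) (walk (fun z => dir p₀ p₁ s (z + y)) (0, 0) n)
  rwa [e] at h2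

theorem law_diagonal (p₀ p₁ : ℝ) (K : ℕ) (y : ℤ × ℤ) :
    law q ρ (diagonal p₀ p₁ K y) = forceProb p₀ p₁ ^ K := by
  have hinj : Function.Injective fun l : ℕ => y + ((l : ℤ), (l : ℤ)) := by
    intro l l' h
    simpa using h
  have hI : MeasurableSet {u : unitInterval | (u : ℝ) ≤ min p₀ p₁} := measurableSet_force p₀ p₁
  have h1 : diagonal p₀ p₁ K y = {s | s.2.2 ∈
      (((Finset.range K).map ⟨_, hinj⟩ : Finset (ℤ × ℤ)) : Set (ℤ × ℤ)).pi
        fun _ => {u : unitInterval | (u : ℝ) ≤ min p₀ p₁}} := by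
    ext s
    simp [diagonal]
  rw [h1, law_uniform (MeasurableSet.pi (Finset.countable_toSet _) fun _ _ => hI), uniformLaw,
    Measure.infinitePi_pi _ (fun _ _ => hI), Finset.prod_const, Finset.card_map, Finset.card_range]
  rfl

theorem measurableSet_freshRegen (h0 : 0 ≤ q) (h1 : q ≤ 1) {v : ℝ} (hv : 0 < v) (p₀ p₁ : ℝ) (K : ℕ)
    (y : ℤ × ℤ) : MeasurableSet[observed q ρ (meeting (backCone v y))ᶜ
      (cone v (y + ((K : ℤ), (K : ℤ))))] (freshRegen p₀ p₁ v K y) := by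
  refine MeasurableSet.inter (measurableSet_observed_void
    ((measurableSet_link _ _ _).diff (measurableSet_meeting _)) (fun w hw => hw.2)
    (((measure_mono Set.sdiff_subset).trans_lt (intensity_link h0 h1 hv le_rfl).lt_top).ne)) ?_
  rw [Set.ofPred_forall]
  exact MeasurableSet.iInter fun i => measurable_walk_dirOn p₀ p₁ (measurableSet_meeting _).compl
    _ _ i .of_discrete

/-- Conditionally on the past of `y`, the walk started at `y` has a uniformly positive chance to
make `K` steps to the right and then to see a fresh regeneration. -/
theorem le_law_past_inter (h0 : 0 ≤ q) (h1 : q ≤ 1) {v : ℝ} (hv : 0 < v) (hv1 : v ≤ 1) (p₀ p₁ : ℝ)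
    (K : ℕ) (y : ℤ × ℤ) {E : Set Sample}
    (hE : MeasurableSet[observed q ρ (meeting (backCone v y)) (backCone v y)] E) :
    law q ρ E * (forceProb p₀ p₁ ^ K * law q ρ (regen p₀ p₁ v (0, 0))) ≤
      law q ρ (E ∩ (diagonal p₀ p₁ K y ∩ freshRegen p₀ p₁ v K y)) := by
  have hcone : cone v (y + ((K : ℤ), (K : ℤ))) ⊆ (backCone v y)ᶜ :=
    (cone_subset hv.le (diag_mem_cone hv.le hv1 y K)).trans
      (Set.subset_compl_iff_disjoint_right.2 (disjoint_cone_backCone hv.le y))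
  have hdiag : ∀ l : ℕ, y + ((l : ℤ), (l : ℤ)) ∈ (backCone v y)ᶜ := fun l (h : _ ∈ backCone v y) =>
    Set.disjoint_left.1 (disjoint_cone_backCone hv.le y) (diag_mem_cone hv.le hv1 y l) h
  have hF := measurableSet_freshRegen (ρ := ρ) h0 h1 hv p₀ p₁ K y
  have hind1 := Indep_iff (observed q ρ (meeting (backCone v y)) (backCone v y))
    (observed q ρ (meeting (backCone v y))ᶜ (backCone v y)ᶜ) (law q ρ) |>.1
    (indep_observed disjoint_compl_right disjoint_compl_right)
  -- The forced steps use `U` at times strictly before that of `y + (K, K)`, the apex of the cone,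
  -- so no variable is shared.
  have hdisj : Disjoint {z | ∃ l < K, z = y + ((l : ℤ), (l : ℤ))}
      (cone v (y + ((K : ℤ), (K : ℤ)))) := by
    rw [Set.disjoint_left]
    rintro _ ⟨l, hl, rfl⟩ h
    rw [mem_cone_iff hv.le] at h
    have := h.1
    simp only [Prod.snd_add] at this
    omega
  have hind2 := Indep_iff (observed q ρ ∅ {z | ∃ l < K, z = y + ((l : ℤ), (l : ℤ))})
    (observed q ρ (meeting (backCone v y))ᶜ (cone v (y + ((K : ℤ), (K : ℤ))))) (law q ρ) |>.1
    (indep_observed (Set.empty_disjoint _) hdisj)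
  rw [hind1 _ _ hE (MeasurableSet.inter (measurableSet_diagonal p₀ p₁ fun l _ => hdiag l)
      (observed_mono subset_rfl hcone _ hF)),
    hind2 _ _ (measurableSet_diagonal p₀ p₁ fun l hl => ⟨l, hl, rfl⟩) hF, law_diagonal,
    ← law_regen h0 h1 hv p₀ p₁ (y + ((K : ℤ), (K : ℤ)))]
  gcongr
  exact regen_subset_freshRegen hv.le hv1 K y

theorem tendsto_exp_neg_log_rpow {c₀ γ : ℝ} (hc₀ : 0 < c₀) (hγ : 1 < γ) :
    Tendsto (fun L : ℕ => c₀⁻¹ * Real.exp (-c₀ * Real.log L ^ γ)) atTop (𝓝 0) := by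
  have h1 : Tendsto (fun L : ℕ => Real.log L ^ γ) atTop atTop :=
    (tendsto_rpow_atTop (by linarith)).comp (Real.tendsto_log_atTop.comp tendsto_natCast_atTop_atTop)
  have h2 : Tendsto (fun L : ℕ => -c₀ * Real.log L ^ γ) atTop atBot :=
    h1.const_mul_atTop_of_neg (by linarith)
  simpa using (Real.tendsto_exp_atBot.comp h2).const_mul c₀⁻¹

theorem law_lagging_le (h0 : 0 ≤ q) (h1 : q ≤ 1) {p₀ p₁ vstar c₀ γ : ℝ}
    (hball : BallisticityBound p₀ p₁ q ρ vstar c₀ γ) {L : ℕ} (hL : 1 ≤ L) (y : ℤ × ℤ) :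
    law q ρ (lagging p₀ p₁ vstar L y) ≤
      ENNReal.ofReal (c₀⁻¹ * Real.exp (-c₀ * Real.log L ^ γ)) := by
  rw [law_lagging h0 h1]
  refine le_trans (le_of_eq ?_) (hball L hL)
  congr 1
  ext s
  simp [lagging, X, Y_eq_walk]

/-- Regeneration at the origin has positive probability. -/
theorem law_regen_pos (h0 : 0 ≤ q) (h1 : q ≤ 1) {p₀ p₁ vstar c₀ γ : ℝ} (hp : forceProb p₀ p₁ ≠ 0)
    (hvstar : 0 < vstar) (hvstar1 : vstar ≤ 1) (hc₀ : 0 < c₀) (hγ : 1 < γ)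
    (hball : BallisticityBound p₀ p₁ q ρ vstar c₀ γ) :
    law q ρ (regen p₀ p₁ (vstar / 3) (0, 0)) ≠ 0 := by
  set v := vstar / 3 with hvdef
  have hv : 0 < v := by positivity
  have hfin := intensity_link (ρ := ρ) h0 h1 hv (le_refl ((0, 0) : ℤ × ℤ).2)
  have hV : law q ρ (void (link v (0, 0) (0, 0))) ≠ 0 := by
    rw [law_void (measurableSet_link _ _ _) hfin]
    simpa using Real.exp_pos _
  -- With lagging less likely than the absence of crossing particles, both good events occur
  -- together with positive probability, although they are not independent.
  obtain ⟨L, hLlt, hL1⟩ : ∃ L : ℕ, ENNReal.ofReal (c₀⁻¹ * Real.exp (-c₀ * Real.log L ^ γ)) <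
      law q ρ (void (link v (0, 0) (0, 0))) ∧ 1 ≤ L := by
    have h2 := ENNReal.tendsto_ofReal (tendsto_exp_neg_log_rpow hc₀ hγ)
    rw [ENNReal.ofReal_zero] at h2
    exact ((h2.eventually_lt_const (pos_iff_ne_zero.2 hV)).and (eventually_ge_atTop 1)).exists
  -- After `2 L` forced steps, a walk that never lags by more than `L` has level at least `L - 2 L v
  -- + 2 n v`, which is nonnegative because `v ≤ 1 / 3`.
  set y : ℤ × ℤ := (0, 0) + (((2 * L : ℕ) : ℤ), ((2 * L : ℕ) : ℤ)) with hy
  -- Once the forced steps are made, only the variables `U` from time `2 L` on matter; hence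
  -- independence of the forced steps, although all particles are observed.
  set Z : Set (ℤ × ℤ) := {z | y.2 ≤ z.2} with hZ
  set Q : Set Sample := void (link v (0, 0) (0, 0)) ∩
    {s | ∀ n, walk (dirOn p₀ p₁ Set.univ Z s) y n ∈ cone v (0, 0)} with hQ
  have hwalk : ∀ s n, walk (dirOn p₀ p₁ Set.univ Z s) y n = walk (dir p₀ p₁ s) y n := by
    intro s n
    refine walk_congr fun m _ => (dirOn_iff_dir ?_ ?_).symm
    · simp [hZ, walk_snd]
    · simp [void_empty]
  have hsub : diagonal p₀ p₁ (2 * L) (0, 0) ∩ Q ⊆ regen p₀ p₁ v (0, 0) := by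
    rintro s ⟨h2, h3, h4⟩
    refine ⟨h3, fun i => ?_⟩
    rcases le_total i (2 * L) with hi | hi
    · rw [diagonal_walk h2 hi]
      exact diag_mem_cone hv.le (by rw [hvdef]; linarith) _ _
    · obtain ⟨j, rfl⟩ := Nat.exists_eq_add_of_le hi
      rw [walk_add, diagonal_walk h2 le_rfl, ← hwalk]
      exact h4 j
  have hQsub : void (link v (0, 0) (0, 0)) \ lagging p₀ p₁ vstar L y ⊆ Q := by
    rintro s ⟨h2, h3⟩
    refine ⟨h2, fun n => ?_⟩
    rw [hwalk, mem_cone_iff hv.le]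
    have hL0 : (0 : ℝ) ≤ L := by positivity
    refine ⟨by rw [walk_snd]; simp [hy]; positivity, ?_⟩
    have h4 : (n : ℝ) * vstar - L ≤ ((walk (dir p₀ p₁ s) y n).1 : ℝ) - y.1 := by
      rcases Nat.eq_zero_or_pos n with hn | hn
      · simp [hn]
      · by_contra h5
        exact h3 ⟨n, hn, not_le.1 h5⟩
    have h5 : (walk (dir p₀ p₁ s) y n).2 = y.2 + n := walk_snd _ _ _
    have h6 : (y.1 : ℝ) = 2 * L := by simp [hy]
    have h7 : (y.2 : ℝ) = 2 * L := by simp [hy]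
    simp only [level, h5]
    push_cast
    rw [h7]
    have h8 : vstar = 3 * v := by rw [hvdef]; ring
    have h9 : v ≤ 1 / 3 := by rw [hvdef]; linarith
    have h10 : (0 : ℝ) ≤ n * v := by positivity
    rw [h8, h6] at h4
    nlinarith
  have hQpos : law q ρ Q ≠ 0 := by
    intro hcon
    have h2 : law q ρ (void (link v (0, 0) (0, 0))) ≤
        law q ρ Q + law q ρ (lagging p₀ p₁ vstar L y) := by
      refine (measure_mono ?_).trans (measure_union_le _ _)
      intro s hs
      by_cases h : s ∈ lagging p₀ p₁ vstar L y
      · exact Or.inr h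
      · exact Or.inl (hQsub ⟨hs, h⟩)
    rw [hcon, zero_add] at h2
    exact absurd (h2.trans (law_lagging_le h0 h1 hball hL1 y)) (not_le.2 hLlt)
  have hind := Indep_iff (observed q ρ ∅ {z | ∃ l < 2 * L, z = (0, 0) + ((l : ℤ), (l : ℤ))})
    (observed q ρ Set.univ Z) (law q ρ) |>.1
    (indep_observed (Set.empty_disjoint _) (by
      rw [Set.disjoint_left]
      rintro _ ⟨l, hl, rfl⟩ h
      simp only [hZ, hy, Set.mem_ofPred_eq, Prod.snd_add] at h
      omega))
  have hQm : MeasurableSet[observed q ρ Set.univ Z] Q := by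
    refine MeasurableSet.inter (measurableSet_observed_void (measurableSet_link _ _ _)
      (Set.subset_univ _) hfin) ?_
    rw [Set.ofPred_forall]
    exact MeasurableSet.iInter fun i => measurable_walk_dirOn p₀ p₁ .univ _ _ i .of_discrete
  have h2 := hind _ _ (measurableSet_diagonal p₀ p₁ (K := 2 * L) (y := (0, 0))
    fun l hl => ⟨l, hl, rfl⟩) hQm
  rw [law_diagonal] at h2
  intro hcon
  have h3 := le_antisymm ((measure_mono hsub).trans hcon.le) zero_le
  rw [h3] at h2
  exact mul_ne_zero (pow_ne_zero _ hp) hQpos h2.symm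

end Law

/-! ### Records of a space-time path -/

/-- `n` is the first time at which the level of the path `w` is at least `(1 - v) k`. -/
def IsRecord (v : ℝ) (w : ℕ → ℤ × ℤ) (k n : ℕ) : Prop :=
  (1 - v) * k ≤ level v (w n) ∧ ∀ m < n, level v (w m) < (1 - v) * k

/-- After the record `k` the path makes `K` steps to the right, arrives at a point where `c` holds,
and stays in the cone of that point until the record `k'`. -/
def Succeeds (v : ℝ) (K : ℕ) (w : ℕ → ℤ × ℤ) (c : ℤ × ℤ → Prop) (k k' : ℕ) : Prop :=
  ∃ n N, IsRecord v w k n ∧ IsRecord v w k' N ∧ n + K < N ∧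
    (∀ l ≤ K, w (n + l) = w n + ((l : ℤ), (l : ℤ))) ∧ c (w (n + K)) ∧
    ∀ m, n + K ≤ m → m ≤ N → w m ∈ cone v (w (n + K))

theorem IsRecord.unique {v : ℝ} {w : ℕ → ℤ × ℤ} {k n n' : ℕ} (h : IsRecord v w k n)
    (h' : IsRecord v w k n') : n = n' := by
  rcases lt_trichotomy n n' with hlt | rfl | hlt
  · exact absurd h.1 (not_le.2 (h'.2 n hlt))
  · rfl
  · exact absurd h'.1 (not_le.2 (h.2 n' hlt))

theorem exists_isRecord {v : ℝ} {w : ℕ → ℤ × ℤ} {k n : ℕ} (h : (1 - v) * k ≤ level v (w n)) :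
    ∃ m ≤ n, IsRecord v w k m := by
  classical
  have hex : ∃ n, (1 - v) * k ≤ level v (w n) := ⟨n, h⟩
  exact ⟨Nat.find hex, Nat.find_min' hex h, Nat.find_spec hex,
    fun m hm => not_le.1 (Nat.find_min hex hm)⟩

theorem IsRecord.le {v : ℝ} (hv1 : v ≤ 1) {w : ℕ → ℤ × ℤ} {k k' n n' : ℕ} (hk : k ≤ k')
    (h : IsRecord v w k n) (h' : IsRecord v w k' n') : n ≤ n' := by
  by_contra hlt
  have h1 := h.2 n' (not_le.1 hlt)
  have h2 := h'.1
  have h3 : (k : ℝ) ≤ k' := by exact_mod_cast hk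
  nlinarith

theorem IsRecord.congr {v : ℝ} {w w' : ℕ → ℤ × ℤ} {k n : ℕ} (hw : ∀ m ≤ n, w' m = w m)
    (h : IsRecord v w k n) : IsRecord v w' k n :=
  ⟨by rw [hw n le_rfl]; exact h.1, fun m hm => by rw [hw m hm.le]; exact h.2 m hm⟩

/-- A trial is settled by the path up to the record `k'`, and the point where `c` is tested comes
strictly before it. The outcome therefore belongs to the past of every later record. -/
theorem Succeeds.congr {v : ℝ} (hv1 : v ≤ 1) {K : ℕ} {w w' : ℕ → ℤ × ℤ} {c c' : ℤ × ℤ → Prop}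
    {k k' j n : ℕ} (hj : IsRecord v w j n) (hk : k' ≤ j) (hw : ∀ m ≤ n, w' m = w m)
    (hc : ∀ m < n, c (w m) → c' (w m)) (h : Succeeds v K w c k k') : Succeeds v K w' c' k k' := by
  obtain ⟨m, N, h1, h2, h3, h4, h5, h6⟩ := h
  have hN : N ≤ n := h2.le hv1 hk hj
  refine ⟨m, N, h1.congr fun i hi => hw i (by omega), h2.congr fun i hi => hw i (by omega), h3,
    fun l hl => ?_, ?_, fun i hi hi' => ?_⟩
  · rw [hw _ (by omega), hw _ (by omega), h4 l hl]
  · rw [hw _ (by omega)]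
    exact hc _ (by omega) h5
  · rw [hw _ (by omega), hw _ (by omega)]
    exact h6 i hi hi'

section Walk

variable {v : ℝ} {d : ℤ × ℤ → Prop}

/-- A step raises the level by at most `1 - v`, so a record is overshot by less than one unit. -/
theorem IsRecord.level_lt (hv1 : v < 1) {k n : ℕ} (h : IsRecord v (walk d (0, 0)) k n) :
    level v (walk d (0, 0) n) < (1 - v) * (k + 1) := by
  rcases n with _ | n
  · have hk : (0 : ℝ) ≤ k := by positivity
    simp only [walk_zero, level, Int.cast_zero, mul_zero, sub_zero]
    nlinarith
  · have h1 := h.2 n (by omega)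
    have h2 := level_walk_succ_le v d (0, 0) n
    linarith

theorem IsRecord.add_lt (hv1 : v < 1) {k k' n n' K : ℕ} (hk : k + K + 1 ≤ k')
    (h : IsRecord v (walk d (0, 0)) k n) (h' : IsRecord v (walk d (0, 0)) k' n') : n + K < n' := by
  have h1 := h.level_lt hv1
  have h2 := h'.1
  have h3 : n ≤ n' := h.le hv1.le (by omega) h'
  obtain ⟨m, rfl⟩ := Nat.exists_eq_add_of_le h3
  have h4 := level_walk_add_le v d (0, 0) n m
  have h5 : (k : ℝ) + K + 1 ≤ k' := by exact_mod_cast hk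
  have h6 : (1 - v) * K < (1 - v) * m := by nlinarith
  have h7 : (K : ℝ) < m := lt_of_mul_lt_mul_left h6 (by linarith)
  have h8 : K < m := by exact_mod_cast h7
  omega

/-- This makes the backward cone at a record point play the role of its past: it contains the whole
path up to then. -/
theorem IsRecord.mem_backCone (hv : 0 ≤ v) {k n m : ℕ} (h : IsRecord v (walk d (0, 0)) k n)
    (hm : m < n) : walk d (0, 0) m ∈ backCone v (walk d (0, 0) n) := by
  rw [mem_backCone_iff hv, walk_snd, walk_snd]
  exact ⟨by omega, (h.2 m hm).trans_le h.1⟩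

/-- Each step to the right gains exactly `1 - v`, the spacing of the records, and the overshoot at
`k` is less than that spacing. So the end of the forced steps is itself a record point, as the
definition of the regeneration time requires. -/
theorem IsRecord.add_diagonal (hv1 : v < 1) {k n K : ℕ} (h : IsRecord v (walk d (0, 0)) k n)
    (hK : ∀ l ≤ K, walk d (0, 0) (n + l) = walk d (0, 0) n + ((l : ℤ), (l : ℤ))) :
    IsRecord v (walk d (0, 0)) (k + K) (n + K) := by
  have hl : ∀ l ≤ K, level v (walk d (0, 0) (n + l)) = level v (walk d (0, 0) n) + (1 - v) * l := by
    intro l hl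
    rw [hK l hl, level_add, level_diag]
  refine ⟨?_, fun m hm => ?_⟩
  · rw [hl K le_rfl]
    push_cast
    linarith [h.1]
  · rcases lt_or_ge m n with hmn | hmn
    · have := h.2 m hmn
      have : (0 : ℝ) ≤ (1 - v) * K := mul_nonneg (by linarith) (by positivity)
      push_cast
      linarith
    · obtain ⟨l, rfl⟩ := Nat.exists_eq_add_of_le hmn
      rw [hl l (by omega)]
      have h1 := h.level_lt hv1
      have h2 : (l : ℝ) + 1 ≤ K := by exact_mod_cast (by omega : l + 1 ≤ K)
      push_cast
      nlinarith

end Walk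

/-! ### The walk and its regeneration time -/

/-- The box of space-time points that the walk can visit up to time `T`. -/
noncomputable def box (T : ℕ) : Finset (ℤ × ℤ) := Finset.Icc (-T : ℤ) T ×ˢ Finset.Icc (0 : ℤ) T

theorem mem_box {T : ℕ} {z : ℤ × ℤ} : z ∈ box T ↔ (-T ≤ z.1 ∧ z.1 ≤ T) ∧ 0 ≤ z.2 ∧ z.2 ≤ T := by
  simp [box, Finset.mem_product]

theorem card_box (T : ℕ) : (box T).card = (2 * T + 1) * (T + 1) := by
  rw [box, Finset.card_product, Int.card_Icc, Int.card_Icc]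
  congr 1
  omega

theorem walk_mem_box {d : ℤ × ℤ → Prop} {n T : ℕ} (h : n ≤ T) : walk d (0, 0) n ∈ box T := by
  have h1 := abs_walk_fst_sub_le d (0, 0) n
  have h2 := walk_snd d (0, 0) n
  rw [abs_le] at h1
  rw [mem_box]
  omega

/-- No walk started in the box lags, and no particle links points of the box whose levels are
far apart. -/
def typical (p₀ p₁ v : ℝ) (L T : ℕ) : Set Sample :=
  {s | (∀ z ∈ box T, s ∉ lagging p₀ p₁ (3 * v) L z) ∧
    ∀ y ∈ box T, ∀ z ∈ box T, y.2 ≤ z.2 → (L : ℝ) ≤ level v z - level v y → s ∈ void (link v y z)}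

/-- The walk from the origin. -/
noncomputable abbrev originWalk (p₀ p₁ : ℝ) (s : Sample) : ℕ → ℤ × ℤ := walk (dir p₀ p₁ s) (0, 0)

theorem recordTime_eq {p₀ p₁ v : ℝ} {s : Sample} {k n : ℕ}
    (h : IsRecord v (originWalk p₀ p₁ s) k n) : recordTime p₀ p₁ v s k = n := by
  have e : ∀ m : ℕ, (1 - v) * k + v * m ≤ (X p₀ p₁ s m : ℝ) ↔
      (1 - v) * k ≤ level v (originWalk p₀ p₁ s m) := by
    intro m
    simp only [X, Y_eq_walk, level, walk_snd]
    push_cast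
    constructor <;> intro h <;> linarith
  refine le_antisymm (sInf_le ⟨n, rfl, (e n).2 h.1⟩) (le_sInf ?_)
  rintro _ ⟨m, rfl, hm⟩
  by_contra hlt
  exact absurd ((e m).1 hm) (not_le.2 (h.2 m (by exact_mod_cast not_le.1 hlt)))

theorem recordTime_mono {p₀ p₁ v : ℝ} (hv1 : v ≤ 1) (s : Sample) {k k' : ℕ} (h : k ≤ k') :
    recordTime p₀ p₁ v s k ≤ recordTime p₀ p₁ v s k' := by
  refine sInf_le_sInf ?_
  rintro _ ⟨n, rfl, hn⟩
  refine ⟨n, rfl, le_trans ?_ hn⟩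
  have : (k : ℝ) ≤ k' := by exact_mod_cast h
  nlinarith

/-- The regeneration index may be smaller than `k`, but record times increase with the index. -/
theorem regenerationTime_le {p₀ p₁ v : ℝ} (hv1 : v ≤ 1) {s : Sample} {k n : ℕ} (hk : 1 ≤ k)
    (h : IsRecord v (originWalk p₀ p₁ s) k n) (hr : s ∈ regen p₀ p₁ v (originWalk p₀ p₁ s n)) :
    regenerationTime p₀ p₁ v s ≤ n := by
  have h1 : regenerationIndex p₀ p₁ v s ≤ k := by
    refine sInf_le ⟨k, n, rfl, hk, recordTime_eq h, ?_⟩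
    rw [Y_eq_walk]
    exact regenerates_of_mem_regen hr
  obtain ⟨k₀, hk₀⟩ := ENat.ne_top_iff_exists.1 (h1.trans_lt (ENat.natCast_lt_top k)).ne
  have h2 : regenerationTime p₀ p₁ v s = recordTime p₀ p₁ v s k₀ := by
    unfold regenerationTime
    rw [← hk₀]
  rw [← hk₀] at h1
  rw [h2, ← recordTime_eq h]
  exact recordTime_mono hv1 s (by exact_mod_cast h1)

section Typical

variable {p₀ p₁ v : ℝ} {L T : ℕ} {s : Sample}

/-- Speed `3 v` against a line of slope `v` leaves a gain of `2 v` per unit of time, up to the error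
`L`. -/
theorem level_le_of_typical (hs : s ∈ typical p₀ p₁ v L T) {n : ℕ} (hn : n ≤ T) (m : ℕ) :
    level v (originWalk p₀ p₁ s n) + 2 * v * m - L ≤ level v (originWalk p₀ p₁ s (n + m)) := by
  have h1 := hs.1 _ (walk_mem_box (d := dir p₀ p₁ s) hn)
  rw [originWalk, walk_add]
  set z := walk (dir p₀ p₁ s) (0, 0) n
  have h2 : (m : ℝ) * (3 * v) - L ≤ ((walk (dir p₀ p₁ s) z m).1 : ℝ) - z.1 := by
    rcases Nat.eq_zero_or_pos m with hm | hm
    · simp [hm]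
    · by_contra h5
      exact h1 ⟨m, hm, not_le.1 h5⟩
  simp only [level, walk_snd]
  push_cast
  linarith

theorem exists_isRecord_of_typical (hv : 0 ≤ v) (hs : s ∈ typical p₀ p₁ v L T) {k : ℕ}
    (hk : (L : ℝ) + k ≤ 2 * v * T) : ∃ n ≤ T, IsRecord v (originWalk p₀ p₁ s) k n := by
  refine exists_isRecord ?_
  have h := level_le_of_typical hs (Nat.zero_le T) T
  rw [zero_add] at h
  have h0 : level v (originWalk p₀ p₁ s 0) = 0 := by simp [level]
  have hk0 : (0 : ℝ) ≤ k := by positivity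
  rw [h0] at h
  nlinarith

theorem isRecord_le_of_typical (hv : 0 ≤ v) (hs : s ∈ typical p₀ p₁ v L T) {k k' n n' M : ℕ}
    (hn : n ≤ T) (h : IsRecord v (originWalk p₀ p₁ s) k n)
    (h' : IsRecord v (originWalk p₀ p₁ s) k' n') (hkk : k ≤ k')
    (hk : (L : ℝ) + k' ≤ k + 2 * v * M) : n' ≤ n + M := by
  have h1 := level_le_of_typical hs hn M
  have h2 : (1 - v) * k' ≤ level v (originWalk p₀ p₁ s (n + M)) := by
    have := h.1
    have h3 : (k : ℝ) ≤ k' := by exact_mod_cast hkk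
    nlinarith
  obtain ⟨m, hm, hr⟩ := exists_isRecord h2
  rw [h'.unique hr]
  exact hm

/-- Until the record `k + 3 L` the walk stays in the cone by definition of success. Afterwards
typicality lets it fall back by at most `L`, while it stands at level at least `(1 - v) (k + 3 L)`
and the apex lies below `(1 - v) (k + K + 1)`; with `K + 1 ≤ L` and `v ≤ 1 / 3` the apex level is
out of reach. -/
theorem regenerationTime_le_of_succeeds (hv : 0 ≤ v) (hv3 : v ≤ 1 / 3)
    (hs : s ∈ typical p₀ p₁ v L T) {K k : ℕ} (hK : 1 ≤ K) (hKL : K + 1 ≤ L)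
    (hk : (L : ℝ) + (k + 3 * L : ℕ) ≤ 2 * v * T)
    (h : Succeeds v K (originWalk p₀ p₁ s) (fun y => s ∈ void (link v y y)) k (k + 3 * L)) :
    regenerationTime p₀ p₁ v s ≤ T := by
  obtain ⟨n, N, h1, h2, h3, h4, h5, h6⟩ := h
  obtain ⟨N', hN', h2'⟩ := exists_isRecord_of_typical hv hs hk
  have hN : N ≤ T := by rw [h2.unique h2']; exact hN'
  have hrec := h1.add_diagonal (by linarith) h4
  have hreg : s ∈ regen p₀ p₁ v (originWalk p₀ p₁ s (n + K)) := by
    refine ⟨h5, fun i => ?_⟩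
    rw [originWalk, ← walk_add]
    rcases le_total (n + K + i) N with hi | hi
    · exact h6 _ (by omega) hi
    · obtain ⟨m, hm⟩ := Nat.exists_eq_add_of_le hi
      rw [mem_cone_iff hv, walk_snd, walk_snd]
      refine ⟨by push_cast; omega, ?_⟩
      rw [hm]
      have h7 := level_le_of_typical hs hN m
      have h8 := h2.1
      have h9 := hrec.level_lt (by linarith)
      have h10 : (K : ℝ) + 1 ≤ L := by exact_mod_cast hKL
      have h11 : 0 ≤ 2 * v * m := by positivity
      have h12 : (0 : ℝ) ≤ K := by positivity
      push_cast at h8 h9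
      simp only [originWalk] at *
      nlinarith
  refine (regenerationTime_le (by linarith) (by omega) hrec hreg).trans ?_
  exact_mod_cast (by omega : n + K ≤ T)

end Typical

/-! ### Failed trials -/

/-- The record `Δ j` is reached, and the trials at the records `Δ i`, `i < j`, have failed, for a
path `w` and a field `c`. -/
def FailedPath (v : ℝ) (K Δ j : ℕ) (w : ℕ → ℤ × ℤ) (c : ℤ × ℤ → Prop) : Prop :=
  (∃ n, IsRecord v w (Δ * j) n) ∧ ∀ i < j, ¬Succeeds v K w c (Δ * i) (Δ * (i + 1))

/-- The event that the walk reaches the record `Δ j` after `j` failed trials. -/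
def failed (p₀ p₁ v : ℝ) (K Δ j : ℕ) : Set Sample :=
  {s | FailedPath v K Δ j (originWalk p₀ p₁ s) fun z => s ∈ void (link v z z)}

/-- The event that the walk reaches the record `Δ j` at the point `y` after `j` failed trials. -/
def failedAt (p₀ p₁ v : ℝ) (K Δ j : ℕ) (y : ℤ × ℤ) : Set Sample :=
  failed p₀ p₁ v K Δ j ∩
    {s | ∃ n, IsRecord v (originWalk p₀ p₁ s) (Δ * j) n ∧ originWalk p₀ p₁ s n = y}

section Measurability

variable {Ω : Type*} [MeasurableSpace Ω] {w : Ω → ℕ → ℤ × ℤ} {c : Ω → ℤ × ℤ → Prop}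

theorem measurable_isRecord (hw : ∀ n, Measurable fun ω => w ω n) (v : ℝ) (k n : ℕ) :
    Measurable fun ω => IsRecord v (w ω) k n := by
  have h1 : ∀ (m : ℕ) (P : ℤ × ℤ → Prop), Measurable fun ω => P (w ω m) := fun m P =>
    (Measurable.of_discrete (f := P)).comp (hw m)
  exact (h1 n fun z => (1 - v) * k ≤ level v z).and
    (.forall fun m => .imp measurable_const (h1 m fun z => level v z < (1 - v) * k))

theorem measurable_succeeds (hw : ∀ n, Measurable fun ω => w ω n)
    (hc : ∀ z, MeasurableSet {ω | c ω z}) (v : ℝ) (K k k' : ℕ) :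
    Measurable fun ω => Succeeds v K (w ω) (c ω) k k' := by
  have h2 : ∀ (m m' : ℕ) (P : ℤ × ℤ → ℤ × ℤ → Prop), Measurable fun ω => P (w ω m) (w ω m') :=
    fun m m' P => (Measurable.of_discrete (f := fun z : (ℤ × ℤ) × (ℤ × ℤ) => P z.1 z.2)).comp
      ((hw m).prodMk (hw m'))
  have h3 : ∀ m, Measurable fun ω => c ω (w ω m) := by
    intro m
    refine measurableSet_setOfPred.1 ?_
    have : {ω | c ω (w ω m)} = ⋃ z, ((fun ω => w ω m) ⁻¹' {z} ∩ {ω | c ω z}) := by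
      ext ω; simp
    rw [this]
    exact .iUnion fun z => (hw m (measurableSet_singleton z)).inter (hc z)
  refine .exists fun n => .exists fun N => (measurable_isRecord hw v k n).and
    ((measurable_isRecord hw v k' N).and (measurable_const.and (.and ?_ ((h3 _).and ?_))))
  · exact .forall fun l => .imp measurable_const (h2 (n + l) n fun a b => a = b + ((l : ℤ), (l : ℤ)))
  · exact .forall fun m => .imp measurable_const (.imp measurable_const
      (h2 m (n + K) fun a b => a ∈ cone v b))

theorem measurable_failedPath (hw : ∀ n, Measurable fun ω => w ω n)
    (hc : ∀ z, MeasurableSet {ω | c ω z}) (v : ℝ) (K Δ j : ℕ) :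
    Measurable fun ω => FailedPath v K Δ j (w ω) (c ω) :=
  (Measurable.exists fun n => measurable_isRecord hw v _ n).and
    (.forall fun _ => .imp measurable_const (measurable_succeeds hw hc v K _ _).not)

end Measurability

theorem failedAt_pairwise_disjoint (p₀ p₁ v : ℝ) (K Δ j : ℕ) :
    Pairwise (Function.onFun Disjoint (failedAt p₀ p₁ v K Δ j)) := by
  intro y y' hne
  rw [Function.onFun, Set.disjoint_left]
  rintro s ⟨-, n, hn, rfl⟩ ⟨-, n', hn', rfl⟩
  exact hne (by rw [hn.unique hn'])

theorem iUnion_failedAt (p₀ p₁ v : ℝ) (K Δ j : ℕ) :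
    ⋃ y, failedAt p₀ p₁ v K Δ j y = failed p₀ p₁ v K Δ j := by
  ext s
  simp only [Set.mem_iUnion]
  constructor
  · rintro ⟨y, h, -⟩
    exact h
  · rintro ⟨⟨n, hn⟩, h⟩
    exact ⟨originWalk p₀ p₁ s n, ⟨⟨n, hn⟩, h⟩, n, hn, rfl⟩

theorem failed_succ_subset {p₀ p₁ v : ℝ} (hv1 : v ≤ 1) (K Δ j : ℕ) :
    failed p₀ p₁ v K Δ (j + 1) ⊆ failed p₀ p₁ v K Δ j := by
  rintro s ⟨⟨n, hn⟩, h⟩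
  refine ⟨?_, fun i hi => h i (by omega)⟩
  have h1 : (1 - v) * ((Δ * j : ℕ) : ℝ) ≤ level v (originWalk p₀ p₁ s n) := by
    refine le_trans ?_ hn.1
    have : ((Δ * j : ℕ) : ℝ) ≤ ((Δ * (j + 1) : ℕ) : ℝ) := by
      exact_mod_cast Nat.mul_le_mul_left _ (by omega)
    nlinarith
  obtain ⟨m, -, hm⟩ := exists_isRecord h1
  exact ⟨m, hm⟩

/-- Some particle that avoids the backward cone at `y` links, for some `z` near `y`, the backward
cone at `z` to the cone at `z + (K, K)`. -/
def freshLink (v : ℝ) (K M : ℕ) (y : ℤ × ℤ) : Set Sample :=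
  ⋃ a ∈ box M, (void (link v (y + a) (y + a + ((K : ℤ), (K : ℤ))) \ meeting (backCone v y)))ᶜ

/-- Before reaching the record point `y` the walk stays in the backward cone at `y`. There the
directions depend only on `U` in that cone and on particles meeting it, so the event can be
rewritten with the restricted walk and becomes observable from the past of `y`. -/
theorem failedAt_iff {p₀ p₁ v : ℝ} (hv : 0 ≤ v) (hv1 : v ≤ 1) {K Δ j : ℕ} {y : ℤ × ℤ} {s : Sample} :
    s ∈ failedAt p₀ p₁ v K Δ j y ↔
      FailedPath v K Δ j (walk (dirOn p₀ p₁ (meeting (backCone v y)) (backCone v y) s) (0, 0))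
        (fun z => z ∈ backCone v y ∧ s ∈ void (link v z z)) ∧
      ∃ n, IsRecord v (walk (dirOn p₀ p₁ (meeting (backCone v y)) (backCone v y) s) (0, 0))
        (Δ * j) n ∧
        walk (dirOn p₀ p₁ (meeting (backCone v y)) (backCone v y) s) (0, 0) n = y := by
  set d' := dirOn p₀ p₁ (meeting (backCone v y)) (backCone v y) s with hd'
  have hagree : ∀ z ∈ backCone v y, d' z ↔ dir p₀ p₁ s z := by
    intro z hz
    refine dirOn_iff_dir hz ?_
    rw [Set.sdiff_eq_empty.2 (through_subset_meeting hz), void_empty]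
    trivial
  have hwalk : ∀ (d₁ d₂ : ℤ × ℤ → Prop), (∀ z ∈ backCone v y, d₁ z ↔ d₂ z) → ∀ n,
      IsRecord v (walk d₁ (0, 0)) (Δ * j) n → walk d₁ (0, 0) n = y →
      (∀ m ≤ n, walk d₂ (0, 0) m = walk d₁ (0, 0) m) ∧
      (∀ m < n, walk d₁ (0, 0) m ∈ backCone v y) := by
    intro d₁ d₂ hd n hn hy
    have h1 : ∀ m < n, walk d₁ (0, 0) m ∈ backCone v y := fun m hm => hy ▸ hn.mem_backCone hv hm
    exact ⟨fun m hm => walk_congr fun i hi => hd _ (h1 i (by omega)), h1⟩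
  constructor
  · rintro ⟨⟨-, h2⟩, n, hn, hy⟩
    obtain ⟨h3, h4⟩ := hwalk (dir p₀ p₁ s) d' (fun z hz => (hagree z hz).symm) n hn hy
    have hn' := hn.congr h3
    refine ⟨⟨⟨n, hn'⟩, fun i hi hsucc => h2 i hi ?_⟩, n, hn', by rw [h3 n le_rfl]; exact hy⟩
    exact hsucc.congr hv1 hn' (Nat.mul_le_mul_left _ hi) (fun m hm => (h3 m hm).symm)
      fun m hm hc => hc.2
  · rintro ⟨⟨-, h2⟩, n, hn, hy⟩
    obtain ⟨h3, h4⟩ := hwalk d' (dir p₀ p₁ s) hagree n hn hy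
    have hn' := hn.congr h3
    refine ⟨⟨⟨n, hn'⟩, fun i hi hsucc => h2 i hi ?_⟩, n, hn', by rw [originWalk, h3 n le_rfl]; exact hy⟩
    refine hsucc.congr hv1 hn' (Nat.mul_le_mul_left _ hi) (fun m hm => (h3 m hm).symm)
      fun m hm hc => ⟨?_, hc⟩
    rw [h3 m hm.le]
    exact h4 m hm

section Law

variable {q : ℝ} [IsProbabilityMeasure (lazyStep q)] {ρ : ℝ≥0}

theorem measurableSet_observed_failedAt (h0 : 0 ≤ q) (h1 : q ≤ 1) {v : ℝ} (hv : 0 < v)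
    (hv1 : v ≤ 1) (p₀ p₁ : ℝ) (K Δ j : ℕ) (y : ℤ × ℤ) :
    MeasurableSet[observed q ρ (meeting (backCone v y)) (backCone v y)]
      (failedAt p₀ p₁ v K Δ j y) := by
  have hw := measurable_walk_dirOn (q := q) (ρ := ρ) p₀ p₁
    (measurableSet_meeting (backCone v y)) (backCone v y) (0, 0)
  have hc : ∀ z, MeasurableSet[observed q ρ (meeting (backCone v y)) (backCone v y)]
      {s | z ∈ backCone v y ∧ s ∈ void (link v z z)} := by
    intro z
    by_cases hz : z ∈ backCone v y
    · simp only [hz, true_and]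
      exact measurableSet_observed_void (measurableSet_link _ _ _)
        (fun w hw => meeting_mono (backCone_subset_of_mem hv.le hz) hw.1)
        (intensity_link h0 h1 hv le_rfl)
    · simp only [hz, false_and]
      exact @MeasurableSet.empty _ (observed q ρ _ _)
  have e : failedAt p₀ p₁ v K Δ j y = {s | _} := Set.ext fun s => failedAt_iff hv.le hv1
  rw [e]
  refine @measurableSet_setOfPred _ (observed q ρ _ _) _ |>.2 ?_
  refine @Measurable.and _ (observed q ρ _ _) _ _
    (@measurable_failedPath _ (observed q ρ _ _) _ _ hw hc v K Δ j) ?_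
  refine @Measurable.exists _ _ (observed q ρ _ _) _ _ fun n => ?_
  exact @Measurable.and _ (observed q ρ _ _) _ _
    (@measurable_isRecord _ (observed q ρ _ _) _ hw v _ n)
    (Measurable.comp (g := fun z => z = y) .of_discrete (hw n))

theorem measurableSet_failedAt (h0 : 0 ≤ q) (h1 : q ≤ 1) {v : ℝ} (hv : 0 < v)
    (hv1 : v ≤ 1) (p₀ p₁ : ℝ) (K Δ j : ℕ) (y : ℤ × ℤ) :
    MeasurableSet (failedAt p₀ p₁ v K Δ j y) :=
  observed_le _ (measurableSet_observed_failedAt (ρ := 0) h0 h1 hv hv1 p₀ p₁ K Δ j y)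

/-! ### Recursion for the number of failed trials -/

/-- The part of `failed` on which no particle links the past of the record point to the future
of the trial. -/
def unlinked (p₀ p₁ v : ℝ) (K Δ j : ℕ) : Set Sample :=
  ⋃ y, failedAt p₀ p₁ v K Δ j y ∩ void (link v y (y + ((K : ℤ), (K : ℤ))))

/-- Split according to the record point `y`. On `unlinked`, which is observable from the past of
`y`, forced steps followed by a fresh regeneration have conditional probability at least `σ`, and
produce a successful trial, hence are incompatible with one more failure. -/
theorem law_failed_succ_le (h0 : 0 ≤ q) (h1 : q ≤ 1) {v : ℝ} (hv : 0 < v) (hv1 : v < 1)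
    (p₀ p₁ : ℝ) {K Δ : ℕ} (hKΔ : K + 1 ≤ Δ) (j : ℕ) :
    law q ρ (failed p₀ p₁ v K Δ (j + 1)) + law q ρ (unlinked p₀ p₁ v K Δ j) *
      (forceProb p₀ p₁ ^ K * law q ρ (regen p₀ p₁ v (0, 0))) ≤ law q ρ (failed p₀ p₁ v K Δ j) := by
  set P : ℤ × ℤ → Set Sample :=
    fun y => failedAt p₀ p₁ v K Δ j y ∩ void (link v y (y + ((K : ℤ), (K : ℤ)))) with hP
  set S : ℤ × ℤ → Set Sample := fun y => diagonal p₀ p₁ K y ∩ freshRegen p₀ p₁ v K y with hS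
  have hPm : ∀ y, MeasurableSet[observed q ρ (meeting (backCone v y)) (backCone v y)] (P y) :=
    fun y => MeasurableSet.inter
      (measurableSet_observed_failedAt h0 h1 hv hv1.le p₀ p₁ K Δ j y)
      (measurableSet_observed_void (measurableSet_link _ _ _) Set.inter_subset_left
        (intensity_link h0 h1 hv (by simp)))
  have hSm : ∀ y, MeasurableSet (S y) := fun y =>
    (observed_le (q := q) (ρ := ρ) _ (measurableSet_diagonal (A := ∅) (Z := Set.univ) p₀ p₁
      fun _ _ => trivial)).inter (observed_le _ (measurableSet_freshRegen (ρ := ρ) h0 h1 hv p₀ p₁ K y))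
  have hdisj : Pairwise (Function.onFun Disjoint P) := fun y y' h =>
    (failedAt_pairwise_disjoint p₀ p₁ v K Δ j h).mono Set.inter_subset_left Set.inter_subset_left
  have hdisj2 : Pairwise (Function.onFun Disjoint fun y => P y ∩ S y) := fun y y' h =>
    (hdisj h).mono Set.inter_subset_left Set.inter_subset_left
  have h2 : law q ρ (unlinked p₀ p₁ v K Δ j) = ∑' y, law q ρ (P y) :=
    measure_iUnion hdisj fun y => observed_le _ (hPm y)
  have h3 : law q ρ (⋃ y, P y ∩ S y) = ∑' y, law q ρ (P y ∩ S y) :=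
    measure_iUnion hdisj2 fun y => (observed_le _ (hPm y)).inter (hSm y)
  have h4 : law q ρ (unlinked p₀ p₁ v K Δ j) *
      (forceProb p₀ p₁ ^ K * law q ρ (regen p₀ p₁ v (0, 0))) ≤ law q ρ (⋃ y, P y ∩ S y) := by
    rw [h2, h3, ← ENNReal.tsum_mul_right]
    exact ENNReal.tsum_le_tsum fun y => le_law_past_inter h0 h1 hv hv1.le p₀ p₁ K y (hPm y)
  have h5 : Disjoint (failed p₀ p₁ v K Δ (j + 1)) (⋃ y, P y ∩ S y) := by
    rw [Set.disjoint_left]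
    rintro s ⟨⟨N, hN⟩, hf⟩ hs
    obtain ⟨y, ⟨⟨-, n, hn, hy⟩, hlink⟩, hdiag, hfresh⟩ := Set.mem_iUnion.1 hs
    have hdw : ∀ l ≤ K, originWalk p₀ p₁ s (n + l) = y + ((l : ℤ), (l : ℤ)) := by
      intro l hl
      rw [originWalk, walk_add]
      change walk _ (originWalk p₀ p₁ s n) l = _
      rw [hy, diagonal_walk hdiag hl]
    have hreg := freshRegen_inter_subset_regen K y ⟨hfresh, hlink⟩
    rw [← hdw K le_rfl] at hreg
    refine hf j (by omega) ⟨n, N, hn, hN, hn.add_lt hv1 ?_ hN, ?_, hreg.1, fun m hm _ => ?_⟩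
    · rw [mul_add, mul_one]; omega
    · intro l hl
      rw [hdw l hl, hy]
    · obtain ⟨i, rfl⟩ := Nat.exists_eq_add_of_le hm
      have := hreg.2 i
      rwa [originWalk, ← walk_add] at this
  calc _ ≤ law q ρ (failed p₀ p₁ v K Δ (j + 1)) + law q ρ (⋃ y, P y ∩ S y) := by gcongr
    _ = law q ρ (failed p₀ p₁ v K Δ (j + 1) ∪ ⋃ y, P y ∩ S y) :=
        (measure_union h5 (.iUnion fun y => (observed_le _ (hPm y)).inter (hSm y))).symm
    _ ≤ _ := by
        refine measure_mono (Set.union_subset (failed_succ_subset hv1.le K Δ j) ?_)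
        exact Set.iUnion_subset fun y s hs => hs.1.1.1

theorem law_freshLink_le {v C : ℝ} (hC : ∀ y z : ℤ × ℤ, y.2 ≤ z.2 → intensity q ρ (link v y z) ≤
      ENNReal.ofReal (C * Real.exp (-(v * (level v z - level v y) / 2)))) (K M : ℕ) (y : ℤ × ℤ) :
    law q ρ (freshLink v K M y) ≤ ((2 * M + 1) * (M + 1) : ℕ) *
      ENNReal.ofReal (C * Real.exp (-(v * ((1 - v) * K) / 2))) := by
  rw [← card_box, ← nsmul_eq_mul]
  refine (measure_biUnion_finset_le _ _).trans (Finset.sum_le_card_nsmul _ _ _ fun a _ => ?_)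
  refine (law_void_compl_le ((measurableSet_link _ _ _).diff (measurableSet_meeting _))).trans
    ((measure_mono Set.sdiff_subset).trans ((hC _ _ (by simp)).trans (le_of_eq ?_)))
  rw [level_add v (y + a), level_diag, add_sub_cancel_left]

theorem law_failedAt_inter_freshLink (h0 : 0 ≤ q) (h1 : q ≤ 1) {v : ℝ} (hv : 0 < v) (hv1 : v ≤ 1)
    (p₀ p₁ : ℝ) (K M Δ j : ℕ) (y : ℤ × ℤ) :
    law q ρ (failedAt p₀ p₁ v K Δ j y ∩ freshLink v K M y) =
      law q ρ (failedAt p₀ p₁ v K Δ j y) * law q ρ (freshLink v K M y) := by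
  refine Indep_iff (observed q ρ (meeting (backCone v y)) (backCone v y))
    (observed q ρ (meeting (backCone v y))ᶜ ∅) (law q ρ) |>.1
    (indep_observed disjoint_compl_right (Set.disjoint_empty _)) _ _
    (measurableSet_observed_failedAt h0 h1 hv hv1 p₀ p₁ K Δ j y) ?_
  refine Finset.measurableSet_biUnion _ fun a _ => MeasurableSet.compl ?_
  exact measurableSet_observed_void ((measurableSet_link _ _ _).diff (measurableSet_meeting _))
    (fun w hw => hw.2)
    (((measure_mono Set.sdiff_subset).trans_lt (intensity_link h0 h1 hv (by simp)).lt_top).ne)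

/-- Let `y` and `z` be the points of the records `j` and `j + 1`. A particle linking `z` to `z + (K,
K)` cannot meet the backward cone at `y`: it would link `y` to `z`, whose levels differ by at least
`L`, which is excluded on typical environments. It is thus a fresh particle with respect to `y`. -/
theorem failed_diff_unlinked_subset {p₀ p₁ v : ℝ} (hv : 0 ≤ v) (hv3 : v ≤ 1 / 3) {K L T M j : ℕ}
    (hL : 1 ≤ L) (hT : (L : ℝ) + (3 * L * (j + 1) : ℕ) ≤ 2 * v * T) (hM : 2 * (L : ℝ) ≤ v * M) :
    failed p₀ p₁ v K (3 * L) (j + 1) \ unlinked p₀ p₁ v K (3 * L) (j + 1) ⊆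
      (typical p₀ p₁ v L T)ᶜ ∪ ⋃ y, failedAt p₀ p₁ v K (3 * L) j y ∩ freshLink v K M y := by
  rintro s ⟨hf, hu⟩
  by_cases hs : s ∈ typical p₀ p₁ v L T
  swap
  · exact Or.inl hs
  right
  obtain ⟨⟨N, hN⟩, hfail⟩ := hf
  obtain ⟨⟨n, hn⟩, hfail'⟩ := failed_succ_subset (by linarith) K (3 * L) j ⟨⟨N, hN⟩, hfail⟩
  have hlink : s ∉ void (link v (originWalk p₀ p₁ s N)
      (originWalk p₀ p₁ s N + ((K : ℤ), (K : ℤ)))) := fun h =>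
    hu (Set.mem_iUnion.2 ⟨_, ⟨⟨⟨N, hN⟩, hfail⟩, N, hN, rfl⟩, h⟩)
  refine Set.mem_iUnion.2 ⟨originWalk p₀ p₁ s n, ⟨⟨⟨n, hn⟩, hfail'⟩, n, hn, rfl⟩, ?_⟩
  obtain ⟨N', hN', hr⟩ := exists_isRecord_of_typical hv hs hT
  have hNT : N ≤ T := by rw [hN.unique hr]; exact hN'
  have hmul : 3 * L * j ≤ 3 * L * (j + 1) := Nat.mul_le_mul_left _ (by omega)
  have hnN : n ≤ N := hn.le (by linarith) hmul hN
  have hNM : N ≤ n + M := by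
    refine isRecord_le_of_typical hv hs (hnN.trans hNT) hn hN hmul ?_
    push_cast
    linarith
  obtain ⟨m, rfl⟩ := Nat.exists_eq_add_of_le hnN
  set y := originWalk p₀ p₁ s n with hy
  set z := originWalk p₀ p₁ s (n + m) with hz
  have hzw : z = walk (dir p₀ p₁ s) y m := walk_add _ _ _ _
  -- Between the two records at most `M` steps are made, so only finitely many positions of `z`
  -- relative to `y` need a union bound.
  have hzy : z - y ∈ box M := by
    have h1 := abs_walk_fst_sub_le (dir p₀ p₁ s) y m
    have h2 := walk_snd (dir p₀ p₁ s) y m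
    rw [← hzw, abs_le] at h1
    rw [← hzw] at h2
    rw [mem_box, Prod.fst_sub, Prod.snd_sub]
    omega
  refine Set.mem_biUnion hzy ?_
  rw [add_sub_cancel]
  intro hv2
  have hL1 : (1 : ℝ) ≤ L := by exact_mod_cast hL
  have hyz : s ∈ void (link v y z) := by
    refine hs.2 _ (walk_mem_box (by omega)) _ (walk_mem_box hNT) ?_ ?_
    · rw [walk_snd, walk_snd]; push_cast; omega
    · have h1 := hN.1
      have h2 := hn.level_lt (by linarith)
      push_cast at h1 h2
      change (L : ℝ) ≤ level v z - level v y
      change _ ≤ level v z at h1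
      change level v y < _ at h2
      nlinarith
  refine hlink (void_anti (B' := (link v z (z + ((K : ℤ), (K : ℤ))) \ meeting (backCone v y)) ∪
    link v y z) ?_ ?_)
  · intro w hw
    by_cases hb : w ∈ meeting (backCone v y)
    · exact Or.inr ⟨hb, meeting_mono (cone_subset hv (diag_mem_cone hv (by linarith) z K)) hw.2⟩
    · exact Or.inl ⟨hw, hb⟩
  · rw [void_union]
    exact ⟨hv2, hyz⟩

theorem law_failed_le (h0 : 0 ≤ q) (h1 : q ≤ 1) {p₀ p₁ v : ℝ} (hv : 0 < v) (hv3 : v ≤ 1 / 3)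
    {K L T M j : ℕ} {κ : ℝ≥0∞} (hκ : ∀ y, law q ρ (freshLink v K M y) ≤ κ)
    (hL : 1 ≤ L) (hT : (L : ℝ) + (3 * L * (j + 1) : ℕ) ≤ 2 * v * T) (hM : 2 * (L : ℝ) ≤ v * M) :
    law q ρ (failed p₀ p₁ v K (3 * L) (j + 1)) ≤ law q ρ (unlinked p₀ p₁ v K (3 * L) (j + 1)) +
      (law q ρ (typical p₀ p₁ v L T)ᶜ + law q ρ (failed p₀ p₁ v K (3 * L) j) * κ) := by
  have h2 : law q ρ (⋃ y, failedAt p₀ p₁ v K (3 * L) j y ∩ freshLink v K M y) ≤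
      law q ρ (failed p₀ p₁ v K (3 * L) j) * κ := by
    refine (measure_iUnion_le _).trans ?_
    rw [← iUnion_failedAt, measure_iUnion (failedAt_pairwise_disjoint p₀ p₁ v K (3 * L) j)
      (fun y => measurableSet_failedAt h0 h1 hv (by linarith) p₀ p₁ K (3 * L) j y),
      ← ENNReal.tsum_mul_right]
    refine ENNReal.tsum_le_tsum fun y => ?_
    rw [law_failedAt_inter_freshLink h0 h1 hv (by linarith)]
    gcongr
    exact hκ y
  refine (measure_le_inter_add_sdiff _ _ (unlinked p₀ p₁ v K (3 * L) (j + 1))).trans ?_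
  refine add_le_add (measure_mono Set.inter_subset_right) ?_
  refine (measure_mono (failed_diff_unlinked_subset hv.le hv3 hL hT hM)).trans ?_
  refine (measure_union_le _ _).trans ?_
  gcongr

/-- The ansatz `2 θ ^ j + 2 e` with `θ = 1 - σ / 2` is preserved: for the geometric part this is `(1
- σ) θ + σ / 4 ≤ θ ^ 2`, and for the constant part `κ ≤ 1 / 4` leaves enough room to absorb `σ e`.
The bound `a j ≤ 1` starts the induction. -/
theorem recursion_bound {a : ℕ → ℝ} {σ κ e : ℝ} (hσ0 : 0 ≤ σ) (hσ : σ ≤ 1 / 2)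
    (hκ : κ ≤ 1 / 4) (he : 0 ≤ e) (ha0 : ∀ j, 0 ≤ a j) (ha1 : ∀ j, a j ≤ 1) {J : ℕ}
    (h : ∀ j < J, a (j + 2) ≤ a (j + 1) - σ * (a (j + 1) - κ * a j - e)) :
    a (J + 1) ≤ 2 * (1 - σ / 2) ^ (J + 1) + 2 * e := by
  set θ := 1 - σ / 2 with hθ
  have hθ0 : 0 ≤ θ := by linarith
  have key : ∀ j ≤ J, a j ≤ 2 * θ ^ j + 2 * e ∧ a (j + 1) ≤ 2 * θ ^ (j + 1) + 2 * e := by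
    intro j
    induction j with
    | zero =>
      intro _
      have h1 := ha1 0
      have h2 := ha1 1
      simp only [pow_zero, zero_add, pow_one]
      constructor <;> linarith
    | succ j ih =>
      intro hj
      obtain ⟨h1, h2⟩ := ih (by omega)
      refine ⟨h2, (h j (by omega)).trans ?_⟩
      have h3 : 0 ≤ θ ^ j := pow_nonneg hθ0 j
      have h4 : (1 - σ) * a (j + 1) ≤ (1 - σ) * (2 * θ ^ (j + 1) + 2 * e) :=
        mul_le_mul_of_nonneg_left h2 (by linarith)
      have h5 : σ * (κ * a j) ≤ σ * (1 / 4 * (2 * θ ^ j + 2 * e)) := by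
        refine mul_le_mul_of_nonneg_left ?_ hσ0
        exact (mul_le_mul_of_nonneg_right hκ (ha0 j)).trans
          (mul_le_mul_of_nonneg_left h1 (by norm_num))
      have h6 : (1 - σ) * θ + σ * (1 / 4) ≤ θ * θ := by rw [hθ]; nlinarith
      have h7 := mul_le_mul_of_nonneg_left h6 h3
      have h8 : 0 ≤ σ * e := mul_nonneg hσ0 he
      have e1 : θ ^ (j + 1) = θ ^ j * θ := pow_succ _ _
      have e2 : θ ^ (j + 1 + 1) = θ ^ j * θ * θ := by rw [pow_succ, pow_succ]
      rw [e1] at h4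
      rw [e2]
      nlinarith
  exact (key J le_rfl).2

/-! ### Tail of the regeneration time at fixed parameters -/

/-- The tail of the regeneration time in terms of the parameters of the trials. -/
theorem law_regenerationTime_gt_le (h0 : 0 ≤ q) (h1 : q ≤ 1) {p₀ p₁ v : ℝ} (hv : 0 < v)
    (hv3 : v ≤ 1 / 3) {K L T M J : ℕ} {κ : ℝ≥0∞} (hκ : ∀ y, law q ρ (freshLink v K M y) ≤ κ)
    (hκ4 : κ ≤ ENNReal.ofReal (1 / 4)) (hK : 1 ≤ K) (hKL : K + 1 ≤ L)
    (hT : (L : ℝ) + (3 * L * (J + 1) : ℕ) ≤ 2 * v * T) (hM : 2 * (L : ℝ) ≤ v * M) :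
    law q ρ {s | (T : ℕ∞) < regenerationTime p₀ p₁ v s} ≤
      3 * law q ρ (typical p₀ p₁ v L T)ᶜ + ENNReal.ofReal (2 * Real.exp
        (-((forceProb p₀ p₁ ^ K * law q ρ (regen p₀ p₁ v (0, 0))).toReal / 4 * (J + 1)))) := by
  have hforce : forceProb p₀ p₁ ≤ 1 := prob_le_one
  have hs1 : forceProb p₀ p₁ ^ K * law q ρ (regen p₀ p₁ v (0, 0)) ≤ 1 :=
    mul_le_one' (pow_le_one' hforce K) prob_le_one
  set σ : ℝ≥0∞ := forceProb p₀ p₁ ^ K * law q ρ (regen p₀ p₁ v (0, 0)) with hσdef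
  have hσtop : σ ≠ ∞ := (hs1.trans_lt ENNReal.one_lt_top).ne
  set a : ℕ → ℝ := fun j => (law q ρ (failed p₀ p₁ v K (3 * L) j)).toReal with ha
  set e : ℝ := (law q ρ (typical p₀ p₁ v L T)ᶜ).toReal with he
  have hκtop : κ ≠ ∞ := (hκ4.trans_lt ENNReal.ofReal_lt_top).ne
  have hκr : κ.toReal ≤ 1 / 4 := ENNReal.toReal_le_of_le_ofReal (by norm_num) hκ4
  have hσr : σ.toReal ≤ 1 := by simpa using ENNReal.toReal_mono ENNReal.one_ne_top hs1
  have hTj : ∀ j ≤ J, (L : ℝ) + (3 * L * (j + 1) : ℕ) ≤ 2 * v * T := by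
    intro j hj
    refine le_trans ?_ hT
    have : ((3 * L * (j + 1) : ℕ) : ℝ) ≤ ((3 * L * (J + 1) : ℕ) : ℝ) := by
      exact_mod_cast Nat.mul_le_mul_left _ (by omega)
    linarith
  -- The success probability is halved to meet the hypothesis `σ ≤ 1 / 2` of `recursion_bound`. This
  -- weakens the inequality because the probability of `unlinked` is nonnegative.
  have hrec : ∀ j < J, a (j + 2) ≤ a (j + 1) - σ.toReal / 2 * (a (j + 1) - κ.toReal * a j - e) := by
    intro j hj
    have h2 := law_failed_succ_le (ρ := ρ) h0 h1 hv (by linarith) p₀ p₁ (K := K) (Δ := 3 * L)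
      (by omega) (j + 1)
    have h3 := law_failed_le (p₀ := p₀) (p₁ := p₁) h0 h1 hv hv3 hκ (by omega) (hTj j hj.le) hM
    have h2' := ENNReal.toReal_mono (measure_ne_top _ _) h2
    have h3' := ENNReal.toReal_mono (ENNReal.add_ne_top.2 ⟨measure_ne_top _ _,
      ENNReal.add_ne_top.2 ⟨measure_ne_top _ _, ENNReal.mul_ne_top (measure_ne_top _ _) hκtop⟩⟩) h3
    rw [ENNReal.toReal_add (measure_ne_top _ _) (ENNReal.mul_ne_top (measure_ne_top _ _) hσtop),
      ENNReal.toReal_mul] at h2'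
    rw [ENNReal.toReal_add (measure_ne_top _ _) (ENNReal.add_ne_top.2 ⟨measure_ne_top _ _,
      ENNReal.mul_ne_top (measure_ne_top _ _) hκtop⟩), ENNReal.toReal_add (measure_ne_top _ _)
      (ENNReal.mul_ne_top (measure_ne_top _ _) hκtop), ENNReal.toReal_mul] at h3'
    set b := (law q ρ (unlinked p₀ p₁ v K (3 * L) (j + 1))).toReal
    have hb : 0 ≤ b := ENNReal.toReal_nonneg
    have hσ0 : 0 ≤ σ.toReal := ENNReal.toReal_nonneg
    change a (j + 2) + b * σ.toReal ≤ a (j + 1) at h2'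
    change a (j + 1) ≤ b + (e + a j * κ.toReal) at h3'
    nlinarith
  have hbound := recursion_bound (a := a) (J := J) (σ := σ.toReal / 2) (κ := κ.toReal) (e := e)
    (by positivity) (by linarith) hκr ENNReal.toReal_nonneg (fun _ => ENNReal.toReal_nonneg)
    (fun j => by
      simpa using ENNReal.toReal_mono ENNReal.one_ne_top
        (prob_le_one (μ := law q ρ) (s := failed p₀ p₁ v K (3 * L) j))) hrec
  have hexp : (1 - σ.toReal / 2 / 2) ^ (J + 1) ≤ Real.exp (-(σ.toReal / 4 * (J + 1))) := by
    have h2 : 1 - σ.toReal / 2 / 2 ≤ Real.exp (-(σ.toReal / 4)) := by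
      linarith [Real.add_one_le_exp (-(σ.toReal / 4))]
    refine (pow_le_pow_left₀ (by linarith) h2 _).trans (le_of_eq ?_)
    rw [← Real.exp_nat_mul]
    congr 1
    push_cast
    ring
  -- On a typical environment the record `3 L (J + 1)` is reached by time `T`, so either all `J + 1`
  -- trials fail or one succeeds and regeneration occurs by time `T`.
  have hsub : {s | (T : ℕ∞) < regenerationTime p₀ p₁ v s} ⊆
      (typical p₀ p₁ v L T)ᶜ ∪ failed p₀ p₁ v K (3 * L) (J + 1) := by
    intro s hs
    by_contra hcon
    rw [Set.mem_union, not_or, Set.mem_compl_iff, not_not] at hcon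
    obtain ⟨htyp, hnf⟩ := hcon
    obtain ⟨N, -, hN⟩ := exists_isRecord_of_typical hv.le htyp hT
    have : ∃ i < J + 1, Succeeds v K (originWalk p₀ p₁ s) (fun z => s ∈ void (link v z z))
        (3 * L * i) (3 * L * (i + 1)) := by
      by_contra hall
      push Not at hall
      exact hnf ⟨⟨N, hN⟩, hall⟩
    obtain ⟨i, hi, hsucc⟩ := this
    rw [mul_add, mul_one] at hsucc
    have h2 := hTj i (by omega)
    rw [mul_add, mul_one] at h2
    exact absurd (regenerationTime_le_of_succeeds hv.le hv3 htyp hK hKL h2 hsucc) (not_le.2 hs)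
  have hfail : law q ρ (failed p₀ p₁ v K (3 * L) (J + 1)) ≤
      2 * law q ρ (typical p₀ p₁ v L T)ᶜ + ENNReal.ofReal (2 * Real.exp (-(σ.toReal / 4 * (J + 1)))) := by
    rw [← ENNReal.ofReal_toReal (measure_ne_top (law q ρ) (failed p₀ p₁ v K (3 * L) (J + 1))),
      ← ENNReal.ofReal_toReal (measure_ne_top (law q ρ) (typical p₀ p₁ v L T)ᶜ),
      ← ENNReal.ofReal_ofNat 2, ← ENNReal.ofReal_mul (by norm_num),
      ← ENNReal.ofReal_add (by positivity) (by positivity)]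
    refine ENNReal.ofReal_le_ofReal ?_
    change a (J + 1) ≤ 2 * e + _
    linarith
  refine (measure_mono hsub).trans ((measure_union_le _ _).trans ?_)
  calc _ ≤ law q ρ (typical p₀ p₁ v L T)ᶜ + (2 * law q ρ (typical p₀ p₁ v L T)ᶜ +
        ENNReal.ofReal (2 * Real.exp (-(σ.toReal / 4 * (J + 1))))) := by gcongr
    _ = _ := by ring

/-- The probability that the environment is not typical. -/
theorem law_typical_compl_le (h0 : 0 ≤ q) (h1 : q ≤ 1) {p₀ p₁ v C c₀ γ : ℝ} (hv : 0 ≤ v)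
    (hC0 : 0 ≤ C) (hC : ∀ y z : ℤ × ℤ, y.2 ≤ z.2 → intensity q ρ (link v y z) ≤
      ENNReal.ofReal (C * Real.exp (-(v * (level v z - level v y) / 2))))
    (hball : BallisticityBound p₀ p₁ q ρ (3 * v) c₀ γ) {L T : ℕ} (hL : 1 ≤ L) :
    law q ρ (typical p₀ p₁ v L T)ᶜ ≤
      ((2 * T + 1) * (T + 1) : ℕ) * ENNReal.ofReal (c₀⁻¹ * Real.exp (-c₀ * Real.log L ^ γ)) +
      ((2 * T + 1) * (T + 1) : ℕ) * (((2 * T + 1) * (T + 1) : ℕ) *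
        ENNReal.ofReal (C * Real.exp (-(v * L / 2)))) := by
  classical
  have hsub : (typical p₀ p₁ v L T)ᶜ ⊆ (⋃ z ∈ box T, lagging p₀ p₁ (3 * v) L z) ∪
      ⋃ y ∈ box T, ⋃ z ∈ box T,
        {s | (y.2 ≤ z.2 ∧ (L : ℝ) ≤ level v z - level v y) ∧ s ∉ void (link v y z)} := by
    intro s hs
    simp only [typical, Set.mem_compl_iff, Set.mem_ofPred_eq, not_and_or] at hs
    rcases hs with hs | hs
    · push Not at hs
      exact Or.inl (by simpa using hs)
    · push Not at hs
      obtain ⟨y, hy, z, hz, h2, h3, h4⟩ := hs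
      exact Or.inr (Set.mem_biUnion hy (Set.mem_biUnion hz ⟨⟨h2, h3⟩, h4⟩))
  refine (measure_mono hsub).trans ((measure_union_le _ _).trans ?_)
  rw [← card_box, ← nsmul_eq_mul, ← nsmul_eq_mul, ← nsmul_eq_mul]
  refine add_le_add ?_ ?_
  · exact (measure_biUnion_finset_le _ _).trans (Finset.sum_le_card_nsmul _ _ _ fun z _ =>
      law_lagging_le h0 h1 hball hL z)
  · refine (measure_biUnion_finset_le _ _).trans (Finset.sum_le_card_nsmul _ _ _ fun y _ => ?_)
    refine (measure_biUnion_finset_le _ _).trans (Finset.sum_le_card_nsmul _ _ _ fun z _ => ?_)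
    by_cases h : y.2 ≤ z.2 ∧ (L : ℝ) ≤ level v z - level v y
    · simp only [h, true_and]
      refine (law_void_compl_le (measurableSet_link _ _ _)).trans ((hC y z h.1).trans ?_)
      refine ENNReal.ofReal_le_ofReal (mul_le_mul_of_nonneg_left (Real.exp_le_exp.2 ?_) hC0)
      have := mul_le_mul_of_nonneg_left h.2 hv
      linarith
    · simp [h]

end Law

/-! ### Asymptotics -/

/-- A power `L ^ m` is `exp (m log L)`, and `log ^ γ L` dominates every multiple of `log L` exactly
because `γ > 1`. -/
theorem eventually_mul_pow_le_exp_log_rpow (A : ℝ) (m : ℕ) {ε γ : ℝ} (hε : 0 < ε) (hγ : 1 < γ) :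
    ∀ᶠ L : ℕ in atTop, A * (L : ℝ) ^ m ≤ Real.exp (ε * Real.log L ^ γ) := by
  have hlog : Tendsto (fun L : ℕ => Real.log L) atTop atTop :=
    Real.tendsto_log_atTop.comp tendsto_natCast_atTop_atTop
  have h1 := ((tendsto_rpow_atTop (sub_pos.2 hγ)).comp hlog).eventually_ge_atTop ((m + |A|) / ε)
  filter_upwards [h1, hlog.eventually_ge_atTop 1, eventually_ge_atTop 1] with L h2 h3 h4
  have hL : (0 : ℝ) < L := by exact_mod_cast h4
  set x := Real.log L with hx
  have h5 : x ^ γ = x ^ (γ - 1) * x := by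
    rw [Real.rpow_sub_one (by linarith), div_mul_cancel₀ _ (by linarith)]
  have h6 : (m + |A|) ≤ ε * x ^ (γ - 1) := by
    rw [Function.comp_apply, div_le_iff₀ hε] at h2
    linarith
  have h7 : m * x + |A| ≤ ε * x ^ γ := by
    rw [h5]
    nlinarith [abs_nonneg A]
  have h8 : (L : ℝ) ^ m = Real.exp (m * x) := by
    rw [hx, Real.exp_nat_mul, Real.exp_log hL]
  calc A * (L : ℝ) ^ m ≤ Real.exp |A| * Real.exp (m * x) := by
        rw [h8]
        refine mul_le_mul_of_nonneg_right ?_ (by positivity)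
        linarith [le_abs_self A, Real.add_one_le_exp |A|]
    _ = Real.exp (m * x + |A|) := by rw [← Real.exp_add, add_comm]
    _ ≤ _ := Real.exp_le_exp.2 h7

theorem eventually_mul_log_rpow_le (D : ℝ) {ε : ℝ} (γ : ℝ) (hε : 0 < ε) :
    ∀ᶠ L : ℕ in atTop, D * Real.log L ^ γ ≤ ε * L := by
  have h1 := ((isLittleO_log_rpow_rpow_atTop γ one_pos).const_mul_left D).comp_tendsto
    tendsto_natCast_atTop_atTop
  filter_upwards [h1.def hε] with L hL
  simp only [Function.comp_apply, Real.rpow_one, Real.norm_eq_abs, Nat.abs_cast] at hL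
  exact (le_abs_self _).trans hL

theorem expLogPow_natCast_mono {c γ : ℝ} (hc : 0 ≤ c) (hγ : 0 ≤ γ) {m n : ℕ} (h : m ≤ n) :
    expLogPow c γ m ≤ expLogPow c γ n := by
  refine ENNReal.ofReal_le_ofReal (Real.exp_le_exp.2 (mul_le_mul_of_nonneg_left ?_ hc))
  refine Real.rpow_le_rpow (Real.log_natCast_nonneg m) ?_ hγ
  rcases Nat.eq_zero_or_pos m with h0 | h0
  · simpa [h0] using Real.log_natCast_nonneg n
  · exact Real.log_le_log (by exact_mod_cast h0) (by exact_mod_cast h)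

theorem one_le_expLogPow {c γ : ℝ} (hc : 0 ≤ c) (n : ℕ) : 1 ≤ expLogPow c γ n := by
  rw [← ENNReal.ofReal_one]
  refine ENNReal.ofReal_le_ofReal (Real.one_le_exp ?_)
  exact mul_nonneg hc (Real.rpow_nonneg (Real.log_natCast_nonneg n) _)

-- Summation over the blocks between consecutive values of `(L₀ + k) ^ a`: a finite `t` beyond `L₀ ^
-- a` lies in one block and is bounded by its right end. At `t = ⊤` all terms are at least `1` and
-- the series diverges, as it should.
open Classical in
theorem expLogPow_le_tsum {c γ : ℝ} (hc : 0 ≤ c) (hγ : 0 ≤ γ) {a : ℕ} (ha : 1 ≤ a) (L₀ : ℕ)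
    (t : ℕ∞) : expLogPow c γ t ≤ expLogPow c γ ((L₀ ^ a : ℕ) : ℕ∞) +
      ∑' k : ℕ, if (((L₀ + k) ^ a : ℕ) : ℕ∞) < t then
        expLogPow c γ (((L₀ + k + 1) ^ a : ℕ) : ℕ∞) else 0 := by
  induction t using ENat.recTopCoe with
  | top =>
    have h1 : (⊤ : ℝ≥0∞) ≤ ∑' k : ℕ, if (((L₀ + k) ^ a : ℕ) : ℕ∞) < ⊤ then
        expLogPow c γ (((L₀ + k + 1) ^ a : ℕ) : ℕ∞) else 0 := by
      rw [← ENNReal.tsum_const_eq_top_of_ne_zero (α := ℕ) one_ne_zero]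
      refine ENNReal.tsum_le_tsum fun k => ?_
      rw [if_pos (ENat.natCast_lt_top _)]
      exact one_le_expLogPow hc _
    exact le_top.trans (h1.trans le_add_self)
  | coe n =>
    rcases le_or_gt n (L₀ ^ a) with h | h
    · exact (expLogPow_natCast_mono hc hγ h).trans le_self_add
    · have hex : ∃ k, n ≤ (L₀ + k + 1) ^ a :=
        ⟨n, (by omega : n ≤ L₀ + n + 1).trans (Nat.le_self_pow (by omega) _)⟩
      have h1 := Nat.find_spec hex
      have h2 : (L₀ + Nat.find hex) ^ a < n := by
        rcases Nat.eq_zero_or_pos (Nat.find hex) with h0 | h0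
        · rw [h0]; exact h
        · have h3 := Nat.find_min hex (m := Nat.find hex - 1) (by omega)
          have h4 : L₀ + (Nat.find hex - 1) + 1 = L₀ + Nat.find hex := by omega
          rw [h4] at h3
          exact not_le.1 h3
      refine le_trans ?_ (le_trans (ENNReal.le_tsum (Nat.find hex)) le_add_self)
      rw [if_pos (by exact_mod_cast h2)]
      exact expLogPow_natCast_mono hc hγ h1

/-- A tail bound along a polynomial sequence gives a finite moment. -/
theorem exists_lintegral_expLogPow_lt_top {Ω : Type*} [MeasurableSpace Ω] {μ : Measure Ω}
    [IsProbabilityMeasure μ] {τ : Ω → ℕ∞} {δ γ : ℝ} (hδ : 0 < δ) (hγ : 1 < γ) {a : ℕ} (ha : 1 ≤ a)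
    (h : ∀ᶠ L : ℕ in atTop, μ {ω | ((L ^ a : ℕ) : ℕ∞) < τ ω} ≤
      ENNReal.ofReal (Real.exp (-(δ * Real.log L ^ γ)))) :
    ∃ c : ℝ, 0 < c ∧ ∫⁻ ω, expLogPow c γ (τ ω) ∂μ < ⊤ := by
  classical
  have ha0 : (0 : ℝ) < (2 * a) ^ γ := Real.rpow_pos_of_pos (by positivity) _
  -- Since `log ((L + 1) ^ a) ≤ 2 a log L`, this `c` makes the weight at most `exp (δ / 2 * log ^ γ
  -- L)`. Half of the tail exponent is left over, and it beats `L ^ 2`.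
  set c : ℝ := δ / (2 * (2 * a) ^ γ) with hcdef
  have hc : 0 < c := by positivity
  refine ⟨c, hc, ?_⟩
  obtain ⟨L₀, hL₀⟩ := eventually_atTop.1 (h.and
    ((eventually_mul_pow_le_exp_log_rpow 1 2 (half_pos hδ) hγ).and (eventually_ge_atTop 2)))
  -- Measurable hulls keep the measures of the tail events, so no measurability of `τ` is needed.
  set A : ℕ → Set Ω := fun k => toMeasurable μ {ω | (((L₀ + k) ^ a : ℕ) : ℕ∞) < τ ω} with hA
  have hAm : ∀ k, MeasurableSet (A k) := fun k => measurableSet_toMeasurable _ _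
  have hle : ∀ ω, expLogPow c γ (τ ω) ≤ expLogPow c γ ((L₀ ^ a : ℕ) : ℕ∞) +
      ∑' k : ℕ, (A k).indicator (fun _ => expLogPow c γ (((L₀ + k + 1) ^ a : ℕ) : ℕ∞)) ω := by
    intro ω
    refine (expLogPow_le_tsum hc.le (by linarith) ha L₀ (τ ω)).trans ?_
    gcongr with k
    split_ifs with hk
    · rw [Set.indicator_of_mem (subset_toMeasurable μ _ hk)]
    · exact zero_le
  refine (lintegral_mono hle).trans_lt ?_
  rw [lintegral_add_left measurable_const, lintegral_const, measure_univ, mul_one,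
    lintegral_tsum fun k => (measurable_const.indicator (hAm k)).aemeasurable]
  refine ENNReal.add_lt_top.2 ⟨ENNReal.ofReal_lt_top, ?_⟩
  have hterm : ∀ k : ℕ, ∫⁻ ω, (A k).indicator
      (fun _ => expLogPow c γ (((L₀ + k + 1) ^ a : ℕ) : ℕ∞)) ω ∂μ ≤
      ENNReal.ofReal (1 / ((L₀ + k : ℕ) : ℝ) ^ 2) := by
    intro k
    obtain ⟨h1, h2, h3⟩ := hL₀ (L₀ + k) (by omega)
    rw [lintegral_indicator (hAm k), lintegral_const, Measure.restrict_apply_univ, hA,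
      measure_toMeasurable]
    refine (mul_le_mul_right h1 _).trans ?_
    change ENNReal.ofReal _ * _ ≤ _
    set L := L₀ + k with hL
    have hLr : (2 : ℝ) ≤ L := by exact_mod_cast h3
    have hx0 : 0 ≤ Real.log L := Real.log_natCast_nonneg L
    have hlog : Real.log ((L + 1) ^ a : ℕ) ≤ 2 * a * Real.log L := by
      have h4 : Real.log (L + 1 : ℝ) ≤ 2 * Real.log L := by
        rw [← Real.log_rpow (by linarith)]
        refine Real.log_le_log (by linarith) ?_
        norm_num
        nlinarith
      push_cast
      rw [Real.log_pow]
      have : (0 : ℝ) ≤ a := by positivity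
      nlinarith
    have hpow : c * Real.log ((L + 1) ^ a : ℕ) ^ γ ≤ δ / 2 * Real.log L ^ γ := by
      have h4 : Real.log ((L + 1) ^ a : ℕ) ^ γ ≤ (2 * a) ^ γ * Real.log L ^ γ := by
        rw [← Real.mul_rpow (by positivity) hx0]
        exact Real.rpow_le_rpow (Real.log_natCast_nonneg _) hlog (by linarith)
      refine (mul_le_mul_of_nonneg_left h4 hc.le).trans (le_of_eq ?_)
      rw [hcdef]
      field_simp
    rw [← ENNReal.ofReal_mul (by positivity), ← Real.exp_add]
    refine ENNReal.ofReal_le_ofReal ?_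
    have h5 : c * Real.log ((L + 1) ^ a : ℕ) ^ γ + -(δ * Real.log L ^ γ) ≤
        -(δ / 2 * Real.log L ^ γ) := by linarith
    refine (Real.exp_le_exp.2 h5).trans ?_
    rw [Real.exp_neg, one_div]
    refine inv_anti₀ (by positivity) ?_
    rw [one_mul] at h2
    exact h2
  refine (ENNReal.tsum_le_tsum hterm).trans_lt ?_
  have hs : Summable fun k : ℕ => 1 / ((L₀ + k : ℕ) : ℝ) ^ 2 := by
    have := (summable_nat_add_iff L₀).2 (Real.summable_one_div_nat_pow.2 (one_lt_two))
    exact this.congr fun k => by rw [add_comm]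
  exact hs.tsum_ofReal_lt_top

/-! ### Choice of the scales -/

section Law

variable {q : ℝ} [IsProbabilityMeasure (lazyStep q)] {ρ : ℝ≥0}

theorem mul_le_six_mul_sq {T : ℝ} (hT : 1 ≤ T) : (2 * T + 1) * (T + 1) ≤ 6 * T ^ 2 := by
  nlinarith

/-- The regeneration time has tails of order `exp (- log ^ γ)`. -/
theorem exists_regenerationTime_tail (h0 : 0 ≤ q) (h1 : q ≤ 1) {p₀ p₁ v c₀ γ : ℝ}
    (hp : 0 < min p₀ p₁) (hp1 : min p₀ p₁ ≤ 1) (hv : 0 < v) (hv3 : v ≤ 1 / 3) (hc₀ : 0 < c₀)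
    (hγ : 1 < γ) (hball : BallisticityBound p₀ p₁ q ρ (3 * v) c₀ γ)
    (hreg : law q ρ (regen p₀ p₁ v (0, 0)) ≠ 0) :
    ∃ a : ℕ, 1 ≤ a ∧ ∀ᶠ L : ℕ in atTop,
      law q ρ {s | ((L ^ a : ℕ) : ℕ∞) < regenerationTime p₀ p₁ v s} ≤
        ENNReal.ofReal (Real.exp (-(c₀ / 2 * Real.log L ^ γ))) := by
  obtain ⟨C, hC0, hC⟩ := exists_intensity_link_le h0 h1 hv ρ
  set p := min p₀ p₁ with hpdef
  set r := (law q ρ (regen p₀ p₁ v (0, 0))).toReal with hr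
  have hr0 : 0 < r := ENNReal.toReal_pos hreg (measure_ne_top _ _)
  have hlp : Real.log p ≤ 0 := Real.log_nonpos hp.le hp1
  -- With `K` close to `15 / v * log L`, the cost `p ^ K` of the forced steps is at least `p ^ 2 * L
  -- ^ (-b)`.
  set b : ℕ := ⌈15 / v * -Real.log p⌉₊ with hb
  set a : ℕ := b + 3 with ha
  set c₂ : ℝ := p ^ 2 * r / 4 with hc₂
  have hc₂0 : 0 < c₂ := by positivity
  refine ⟨a, by omega, ?_⟩
  have hloglin : ∀ᶠ L : ℕ in atTop, 15 / v * Real.log L ≤ 1 / 2 * L := by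
    simpa using eventually_mul_log_rpow_le (15 / v) 1 (half_pos one_pos)
  filter_upwards [hloglin, eventually_ge_atTop 6,
    tendsto_natCast_atTop_atTop.eventually_ge_atTop (24 * C),
    tendsto_natCast_atTop_atTop.eventually_ge_atTop (7 / (2 * v)),
    tendsto_natCast_atTop_atTop.eventually_ge_atTop (2 / v),
    eventually_mul_pow_le_exp_log_rpow (54 * c₀⁻¹) (2 * a) (half_pos hc₀) hγ,
    eventually_mul_pow_le_exp_log_rpow (324 * C) (4 * a) (half_pos hc₀) hγ,
    eventually_mul_pow_le_exp_log_rpow 6 0 (half_pos hc₀) hγ,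
    eventually_mul_log_rpow_le c₀ γ (half_pos hv),
    eventually_mul_log_rpow_le c₀ γ hc₂0] with L hlog hL6 hLC hLv hLv2 hA1 hA2 hA3 hB1 hB2
  have hL6' : (6 : ℝ) ≤ L := by exact_mod_cast hL6
  have hLpos : (0 : ℝ) < L := by linarith
  have hx0 : 0 ≤ Real.log L := Real.log_natCast_nonneg L
  -- The factor `15 / v` gives `v (1 - v) K / 2 ≥ 5 log L`, so a fresh link at a given point has
  -- probability at most `C L ^ (-5)`. This beats the at most `6 L ^ 4` points of the box of size `M
  -- = L ^ 2`.
  set K : ℕ := ⌈15 / v * Real.log L⌉₊ + 1 with hK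
  have hKlow : 15 / v * Real.log L ≤ K := by
    rw [hK]; push_cast; linarith [Nat.le_ceil (15 / v * Real.log L)]
  have hKup : (K : ℝ) ≤ 15 / v * Real.log L + 2 := by
    rw [hK]; push_cast; linarith [Nat.ceil_lt_add_one (a := 15 / v * Real.log L) (by positivity)]
  have hKL : K + 1 ≤ L := by
    have : (K : ℝ) + 1 ≤ L := by linarith
    exact_mod_cast this
  set M : ℕ := L ^ 2 with hM
  have hMr : (M : ℝ) = (L : ℝ) ^ 2 := by rw [hM]; push_cast; rfl
  set T : ℕ := L ^ a with hT
  -- One power of `L` more than `1 / p ^ K` makes the failure of all trials exponentially unlikely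
  -- in `L`. The two further powers in `T = L ^ (b + 3)` leave time for `J + 1` trials at distance
  -- `3 L`.
  set J : ℕ := L ^ (b + 1) with hJ
  have hT1 : (1 : ℝ) ≤ T := by
    rw [hT]; push_cast; exact one_le_pow₀ (by linarith)
  set κ : ℝ≥0∞ := ((2 * M + 1) * (M + 1) : ℕ) *
    ENNReal.ofReal (C * Real.exp (-(v * ((1 - v) * K) / 2))) with hκ
  have hκ4 : κ ≤ ENNReal.ofReal (1 / 4) := by
    rw [hκ, ← ENNReal.ofReal_natCast, ← ENNReal.ofReal_mul (by positivity)]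
    refine ENNReal.ofReal_le_ofReal ?_
    push_cast
    have e1 : 5 * Real.log L ≤ v * ((1 - v) * K) / 2 := by
      have e2 : 15 * Real.log L ≤ v * K := by
        have := mul_le_mul_of_nonneg_left hKlow hv.le
        rwa [← mul_assoc, mul_div_cancel₀ _ hv.ne'] at this
      have e3 := mul_le_mul_of_nonneg_right hv3 (by positivity : (0 : ℝ) ≤ v * K)
      linarith
    have e4 : Real.exp (-(v * ((1 - v) * K) / 2)) ≤ ((L : ℝ) ^ 5)⁻¹ := by
      have e5 : ((L : ℝ) ^ 5)⁻¹ = Real.exp (-(5 * Real.log L)) := by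
        rw [Real.exp_neg]
        congr 1
        have := Real.exp_nat_mul (Real.log L) 5
        rw [Real.exp_log hLpos] at this
        push_cast at this
        exact this.symm
      rw [e5]
      exact Real.exp_le_exp.2 (by linarith)
    have e6 : (2 * (M : ℝ) + 1) * (M + 1) ≤ 6 * (L : ℝ) ^ 4 := by
      have := mul_le_six_mul_sq (T := (M : ℝ)) (by rw [hMr]; exact one_le_pow₀ (by linarith))
      rw [hMr] at this ⊢
      linarith [this, (by ring : ((L : ℝ) ^ 2) ^ 2 = (L : ℝ) ^ 4)]
    calc (2 * (M : ℝ) + 1) * (M + 1) * (C * Real.exp (-(v * ((1 - v) * K) / 2)))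
        ≤ 6 * (L : ℝ) ^ 4 * (C * ((L : ℝ) ^ 5)⁻¹) := by gcongr
      _ = 6 * C / L := by field_simp
      _ ≤ 1 / 4 := by
          rw [div_le_iff₀ hLpos]
          linarith
  have hTJ : (L : ℝ) + (3 * L * (J + 1) : ℕ) ≤ 2 * v * T := by
    have e1 : (T : ℝ) = L * (L * J) := by
      rw [hT, hJ, ha]; push_cast; ring
    have e2 : (1 : ℝ) ≤ J := by rw [hJ]; push_cast; exact one_le_pow₀ (by linarith)
    have e3 : 7 ≤ 2 * v * L := by
      rw [div_le_iff₀ (by positivity)] at hLv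
      linarith
    have e4 : (0 : ℝ) ≤ L * J := by positivity
    have e5 := mul_le_mul_of_nonneg_right e3 e4
    have e6 : (L : ℝ) ≤ L * J := le_mul_of_one_le_right hLpos.le e2
    push_cast
    rw [e1]
    linarith
  have hMv : 2 * (L : ℝ) ≤ v * M := by
    rw [hMr]
    rw [div_le_iff₀ hv] at hLv2
    have := mul_le_mul_of_nonneg_right hLv2 hLpos.le
    linarith
  have hmain := law_regenerationTime_gt_le (p₀ := p₀) (p₁ := p₁) h0 h1 hv hv3 (J := J)
    (fun y => law_freshLink_le hC K M y) hκ4 (by omega) hKL hTJ hMv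
  have htyp := law_typical_compl_le (p₀ := p₀) (p₁ := p₁) h0 h1 hv.le hC0.le hC hball
    (L := L) (T := T) (by omega)
  have hσ : (forceProb p₀ p₁ ^ K * law q ρ (regen p₀ p₁ v (0, 0))).toReal = p ^ K * r := by
    rw [ENNReal.toReal_mul, forceProb_eq hp.le hp1, ← ENNReal.ofReal_pow hp.le,
      ENNReal.toReal_ofReal (by positivity)]
  have hpK : p ^ 2 / (L : ℝ) ^ b ≤ p ^ K := by
    have e1 : p ^ K = Real.exp (K * Real.log p) := by rw [Real.exp_nat_mul, Real.exp_log hp]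
    have e2 : p ^ 2 / (L : ℝ) ^ b = Real.exp (2 * Real.log p - b * Real.log L) := by
      rw [Real.exp_sub, Real.exp_nat_mul, Real.exp_log hLpos]
      have := Real.exp_nat_mul (Real.log p) 2
      rw [Real.exp_log hp] at this
      push_cast at this
      rw [this]
    rw [e1, e2]
    refine Real.exp_le_exp.2 ?_
    have e3 : 15 / v * -Real.log p ≤ b := Nat.le_ceil _
    have e4 := mul_le_mul_of_nonneg_right e3 hx0
    have e5 := mul_le_mul_of_nonneg_right hKup (neg_nonneg.2 hlp)
    linarith
  have hexp3 : Real.exp (-((forceProb p₀ p₁ ^ K * law q ρ (regen p₀ p₁ v (0, 0))).toReal / 4 *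
      (J + 1))) ≤ Real.exp (-(c₂ * L)) := by
    refine Real.exp_le_exp.2 (neg_le_neg ?_)
    rw [hσ, hc₂]
    have e1 : (J : ℝ) = (L : ℝ) ^ b * L := by rw [hJ]; push_cast; ring
    have e2 : p ^ 2 ≤ p ^ K * (L : ℝ) ^ b := by rwa [div_le_iff₀ (by positivity)] at hpK
    have e3 : p ^ 2 * (r * L) ≤ p ^ K * (L : ℝ) ^ b * (r * L) :=
      mul_le_mul_of_nonneg_right e2 (by positivity)
    have e4 : 0 ≤ p ^ K * r := by positivity
    rw [e1]
    linarith
  set l := Real.log L ^ γ with hl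
  have hTL : (T : ℝ) = (L : ℝ) ^ a := by rw [hT]; push_cast; rfl
  have hbox : (((2 * T + 1) * (T + 1) : ℕ) : ℝ) ≤ 6 * (L : ℝ) ^ (2 * a) := by
    push_cast
    refine (mul_le_six_mul_sq hT1).trans (le_of_eq ?_)
    rw [hTL, ← pow_mul, mul_comm a 2]
  -- Each of the three error terms is to take a third of the target; half of the exponent `c₀` is
  -- spent on absorbing the polynomial factors.
  have t1 : 18 * (L : ℝ) ^ (2 * a) * (c₀⁻¹ * Real.exp (-c₀ * l)) ≤
      1 / 3 * Real.exp (-(c₀ / 2 * l)) := by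
    have e1 : Real.exp (-c₀ * l) * Real.exp (c₀ / 2 * l) = Real.exp (-(c₀ / 2 * l)) := by
      rw [← Real.exp_add]; congr 1; ring
    rw [← e1]
    have := mul_le_mul_of_nonneg_right hA1 (Real.exp_pos (-c₀ * l)).le
    linarith
  have t2 : 108 * (L : ℝ) ^ (4 * a) * (C * Real.exp (-(v * L / 2))) ≤
      1 / 3 * Real.exp (-(c₀ / 2 * l)) := by
    have e0 : Real.exp (-(v * L / 2)) ≤ Real.exp (-c₀ * l) := Real.exp_le_exp.2 (by linarith)
    have e1 : Real.exp (-c₀ * l) * Real.exp (c₀ / 2 * l) = Real.exp (-(c₀ / 2 * l)) := by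
      rw [← Real.exp_add]; congr 1; ring
    rw [← e1]
    have h2 := mul_le_mul_of_nonneg_right hA2 (Real.exp_pos (-c₀ * l)).le
    have h3 := mul_le_mul_of_nonneg_left e0 (by positivity : 0 ≤ 108 * (L : ℝ) ^ (4 * a) * C)
    linarith
  have t3 : 2 * Real.exp (-(c₂ * L)) ≤ 1 / 3 * Real.exp (-(c₀ / 2 * l)) := by
    have e0 : Real.exp (-(c₂ * L)) ≤ Real.exp (-c₀ * l) := Real.exp_le_exp.2 (by linarith)
    have e1 : Real.exp (-c₀ * l) * Real.exp (c₀ / 2 * l) = Real.exp (-(c₀ / 2 * l)) := by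
      rw [← Real.exp_add]; congr 1; ring
    rw [← e1]
    rw [pow_zero, mul_one] at hA3
    have h2 := mul_le_mul_of_nonneg_right hA3 (Real.exp_pos (-c₀ * l)).le
    linarith
  refine hmain.trans ((add_le_add_left (mul_le_mul_right htyp 3) _).trans ?_)
  set n : ℕ := (2 * T + 1) * (T + 1) with hn
  rw [← ENNReal.ofReal_natCast n, ← ENNReal.ofReal_mul (by positivity),
    ← ENNReal.ofReal_mul (by positivity), ← ENNReal.ofReal_mul (by positivity),
    ← ENNReal.ofReal_add (by positivity) (by positivity), ← ENNReal.ofReal_ofNat 3,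
    ← ENNReal.ofReal_mul (by positivity), ← ENNReal.ofReal_add (by positivity) (by positivity)]
  refine ENNReal.ofReal_le_ofReal ?_
  have hn0 : (0 : ℝ) ≤ n := by positivity
  have u1 : (n : ℝ) * (c₀⁻¹ * Real.exp (-c₀ * l)) ≤
      6 * (L : ℝ) ^ (2 * a) * (c₀⁻¹ * Real.exp (-c₀ * l)) :=
    mul_le_mul_of_nonneg_right hbox (by positivity)
  have u2 : (n : ℝ) * (n * (C * Real.exp (-(v * L / 2)))) ≤
      36 * (L : ℝ) ^ (4 * a) * (C * Real.exp (-(v * L / 2))) := by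
    have e1 : (n : ℝ) * n ≤ 6 * (L : ℝ) ^ (2 * a) * (6 * (L : ℝ) ^ (2 * a)) :=
      mul_le_mul hbox hbox hn0 (by positivity)
    have e2 : (L : ℝ) ^ (2 * a) * (L : ℝ) ^ (2 * a) = (L : ℝ) ^ (4 * a) := by
      rw [← pow_add]; congr 1; ring
    rw [← mul_assoc]
    refine mul_le_mul_of_nonneg_right (e1.trans (le_of_eq ?_)) (by positivity)
    rw [← e2]
    ring
  linarith

end Law

end RWDRE

theorem theoremt
    (p₀ p₁ : ℝ) (hp₀ : p₀ ∈ Set.Icc (0 : ℝ) 1) (hp₁ : p₁ ∈ Set.Icc (0 : ℝ) 1)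
    (v₀ v₁ : ℝ) (hv₀ : v₀ = 2 * p₀ - 1) (hv₁ : v₁ = 2 * p₁ - 1) (hell : -1 < v₀)
    (q : ℝ) (hq : q ∈ Set.Ioo (0 : ℝ) 1) (ρ : ℝ≥0) (hρ : 0 < ρ)
    (vstar : ℝ) (hvstar : vstar ∈ Set.Ioo (0 : ℝ) v₁)
    (c₀ γ : ℝ) (hc₀ : 0 < c₀) (hγ : 1 < γ)
    (hball : RWDRE.BallisticityBound p₀ p₁ q ρ vstar c₀ γ) :
    RWDRE.law q ρ (RWDRE.originRegenerates p₀ p₁ (vstar / 3)) ≠ 0 ∧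
    ∃ c : ℝ, 0 < c ∧
      ∫⁻ s, RWDRE.expLogPow c γ (RWDRE.regenerationTime p₀ p₁ (vstar / 3) s)
        ∂(RWDRE.law q ρ) < ⊤ ∧
      ∫⁻ s, RWDRE.expLogPow c γ (RWDRE.regenerationTime p₀ p₁ (vstar / 3) s)
        ∂(RWDRE.coneLaw p₀ p₁ q ρ (vstar / 3)) < ⊤ := by
  have h0 : 0 ≤ q := hq.1.le
  have h1 : q ≤ 1 := hq.2.le
  have := RWDRE.isProbabilityMeasure_lazyStep h0 h1
  obtain ⟨hvpos, hvlt⟩ := hvstar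
  have hvle : vstar ≤ 1 := by linarith [hp₁.2]
  -- The bound `v₀ > -1` gives `p₀ > 0`, and `v₁ > vstar > 0` gives `p₁ > 1 / 2`.
  have hp : 0 < min p₀ p₁ := lt_min (by linarith) (by linarith)
  have hp1 : min p₀ p₁ ≤ 1 := (min_le_left _ _).trans hp₀.2
  have hforce : RWDRE.forceProb p₀ p₁ ≠ 0 := by
    rw [RWDRE.forceProb_eq hp.le hp1]
    simpa using hp
  have hreg := RWDRE.law_regen_pos h0 h1 hforce hvpos hvle hc₀ hγ hball
  have horigin : RWDRE.law q ρ (RWDRE.originRegenerates p₀ p₁ (vstar / 3)) ≠ 0 := fun hcon =>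
    hreg (le_antisymm ((MeasureTheory.measure_mono fun s hs =>
      RWDRE.regenerates_of_mem_regen hs).trans hcon.le) zero_le)
  obtain ⟨a, ha, htail⟩ := RWDRE.exists_regenerationTime_tail (v := vstar / 3) h0 h1 hp hp1
    (by positivity) (by linarith) hc₀ hγ (by rwa [mul_div_cancel₀ _ three_ne_zero]) hreg
  obtain ⟨c, hc, hfin⟩ := RWDRE.exists_lintegral_expLogPow_lt_top (half_pos hc₀) hγ ha htail
  refine ⟨horigin, c, hc, hfin, ?_⟩
  -- The conditional law is at most the law divided by the probability of the conditioning event, so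
  -- the same `c` works. Domination of the restricted measure requires no measurability of that
  -- event.
  rw [RWDRE.coneLaw, ProbabilityTheory.cond, MeasureTheory.lintegral_smul_measure, smul_eq_mul]
  exact ENNReal.mul_lt_top (ENNReal.inv_lt_top.2 (pos_iff_ne_zero.2 horigin))
    ((MeasureTheory.lintegral_mono' MeasureTheory.Measure.restrict_le_self le_rfl).trans_lt hfin)
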